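/- Notation. Let $\tilde{\mathbb C}^*=\,]0,\infty[\,\times\mathbb R$ be the Riemann surface of the logarithm, with points $x=|x|e^{i\arg x}$ and global holomorphic chart $\log x=\ln|x|+i\arg x$; for $\rho>0$ let $\Omega_\rho=\{x\in\tilde{\mathbb C}^*:|x|>\rho\}$, and identify $\{\Re x>0\}$ with $\{x\in\tilde{\mathbb C}^*:|\arg x|<\pi/2\}$. A Hankel contour $\mathcal C$ comes from $-\infty$ along the negative real axis (where $\arg t=-\pi$), turns once around the origin in the positive direction and returns to $-\infty$ along the negative real axis (where $\arg t=\pi$); $\log t$ is continued along it. Let $W$ be the principal branch of the Lambert function, continued to $\Omega_1$: the analytic function on $\Omega_1$ with $W(z)e^{W(z)}=z$ that is positive for $\arg z=0$. Let $\ell$ be the germ of analytic function at $0$ with $\ell(0)=0$, $\ell'(0)=1$ and $(\ell(z)-1)e^{\ell(z)-1}=-e^{-1-z^2/2}$, i.e. $\ell(z)=1+W(-e^{-1-z^2/2})$. For $\lambda>0$ put $\omega(x)=\lambda W(x/\lambda)$ for $x\in\Omega_\lambda$, $$V(\sigma)=e^{\frac\lambda2\left(\ell(\sigma)^2+\sigma^2\ell(\sigma)+\frac{\sigma^4}4\right)}\ell'(\sigma)=\sum_{n\ge0}V_n\sigma^n,\qquad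 U_N(z)=1+\sum_{n=1}^N\frac{(2n)!\,V_{2n}}{2^n\,n!}\Bigl(-\frac1z\Bigr)^n .$$ Theorem. Let $\lambda>0$. The integral $$u(x)=u(\lambda,x)=\int_{\mathcal C}e^{xt+\frac\lambda2\log^2t}\,dt$$ converges absolutely for $\Re x>0$, for every Hankel contour $\mathcal C$, and does not depend on $\mathcal C$; the function $u$ extends to an analytic function on $\tilde{\mathbb C}^*$. Moreover, for every $\rho>\lambda$ and every $A>2\pi$ there is a constant $C>0$ such that, for all integers $N\ge1$ and all $x\in\Omega_\rho$, the number $r_N(x)$ defined by $$u(x)=i\,e^{\frac1{2\lambda}\omega(x)^2+\left(1-\frac1\lambda\right)\omega(x)}\sqrt{\frac{2\pi}{\omega(x)}}\,\bigl(U_N(\omega(x))+r_N(x)\bigr)$$ (principal square root) satisfies $$|r_N(x)|\le C\,A^N\,\frac{N!}{\omega(|x|)^{N+1}} .$$ -/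

import Mathlib

open MeasureTheory Filter Topology

noncomputable section

/-- The Riemann surface of the logarithm: points `|x| e^{i arg x}` are identified with pairs
`(|x|, arg x)` in `]0, ∞[ × ℝ`. -/
@[ext]
structure LogSurface where
  modulus : ℝ
  modulus_pos : 0 < modulus
  arg : ℝ

namespace LogSurface

/-- The underlying non-zero complex number. -/
def toComplex (x : LogSurface) : ℂ :=
  (x.modulus : ℂ) * Complex.exp ((x.arg : ℂ) * Complex.I)

/-- The point with logarithm `ζ`; this is the inverse of the global holomorphic chart
`x ↦ log |x| + i arg x` of the Riemann surface. -/
def ofLog (ζ : ℂ) : LogSurface := ⟨Real.exp ζ.re, Real.exp_pos _, ζ.im⟩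

/-- The point `|x|` of the positive real axis (`arg = 0`). -/
def absPoint (x : LogSurface) : LogSurface := ⟨x.modulus, x.modulus_pos, 0⟩

/-- The point `x / c` for a positive real number `c`. -/
def divPos (x : LogSurface) (c : ℝ) (hc : 0 < c) : LogSurface :=
  ⟨x.modulus / c, div_pos x.modulus_pos hc, x.arg⟩

/-- `Ω_ρ`, the points of modulus larger than `ρ`. -/
def exterior (ρ : ℝ) : Set LogSurface := {x | ρ < x.modulus}

/-- Analyticity of a function on an open subset of the Riemann surface, read in the global chart. -/
def IsAnalyticOn (f : LogSurface → ℂ) (S : Set LogSurface) : Prop :=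
  DifferentiableOn ℂ (fun ζ : ℂ => f (ofLog ζ)) (ofLog ⁻¹' S)

end LogSurface

/-- `L` describes a Hankel contour `s ↦ t = exp (L s)` together with the value `log t = L s` of the
logarithm along it: the contour is continuously differentiable, comes from `-∞` along the negative
real axis (with `arg t = -π`), turns once around the origin in the positive direction, and goes back
to `-∞` along the negative real axis (with `arg t = π`). -/
structure IsHankelContour (L : ℝ → ℂ) : Prop where
  contDiff : ContDiff ℝ 1 L
  ends : ∃ R : ℝ, 0 < R ∧
    (∀ s : ℝ, s ≤ -R → L s = (Real.log (-s) : ℂ) - (Real.pi : ℂ) * Complex.I) ∧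
    (∀ s : ℝ, R ≤ s → L s = (Real.log s : ℂ) + (Real.pi : ℂ) * Complex.I)

/-- The function integrated over `s ∈ ℝ` in the contour integral of `e^{x t + (lam / 2) log² t} dt`,
where `t = exp (L s)`, so that `dt = exp (L s) L'(s) ds`. -/
def hankelIntegrand (lam : ℝ) (x : ℂ) (L : ℝ → ℂ) (s : ℝ) : ℂ :=
  Complex.exp (x * Complex.exp (L s) + (lam : ℂ) / 2 * (L s) ^ 2) *
    (Complex.exp (L s) * deriv L s)

/-- The branch of the Lambert function on the part `|z| > 1` of the Riemann surface of the
logarithm: it is analytic, solves `W e^W = z`, and on the positive real axis it is the principal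
branch, i.e. the positive solution. -/
structure IsLambertW (W : LogSurface → ℂ) : Prop where
  analytic : LogSurface.IsAnalyticOn W (LogSurface.exterior 1)
  equation : ∀ z ∈ LogSurface.exterior 1, W z * Complex.exp (W z) = z.toComplex
  positive : ∀ z ∈ LogSurface.exterior 1, z.arg = 0 → ∃ y : ℝ, 0 < y ∧ W z = (y : ℂ)

/-- The Lambert function; it is determined by `IsLambertW` on `|z| > 1`, and only used there. -/
def lambertW : LogSurface → ℂ := Classical.epsilon IsLambertW

/-- `ω(x) = lam W(x / lam)`. -/
def omega (lam : ℝ) (hlam : 0 < lam) (x : LogSurface) : ℂ :=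
  (lam : ℂ) * lambertW (x.divPos lam hlam)

/-- The germ at `0` of `ℓ(z) = 1 + W(-e^{-1-z²/2})`, normalized by `ℓ(0) = 0`, `ℓ'(0) = 1`
(`-1/e` is the branch point of `W`; the normalization selects the branch). -/
structure IsEll (l : ℂ → ℂ) : Prop where
  analytic : AnalyticAt ℂ l 0
  value : l 0 = 0
  derivative : deriv l 0 = 1
  equation : ∀ᶠ z in 𝓝 (0 : ℂ),
    (l z - 1) * Complex.exp (l z - 1) = -Complex.exp (-1 - z ^ 2 / 2)

/-- A representative of the germ `ℓ`, which is unique; only its Taylor coefficients are used. -/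
def ell : ℂ → ℂ := Classical.epsilon IsEll

/-- `V(σ) = exp ((lam / 2) (ℓ(σ)² + σ² ℓ(σ) + σ⁴ / 4)) ℓ'(σ)`. -/
def saddleV (lam : ℝ) (σ : ℂ) : ℂ :=
  Complex.exp ((lam : ℂ) / 2 * (ell σ ^ 2 + σ ^ 2 * ell σ + σ ^ 4 / 4)) * deriv ell σ

/-- The Taylor coefficients `V_n` of `V` at the origin. -/
def coeffV (lam : ℝ) (n : ℕ) : ℂ :=
  iteratedDeriv n (saddleV lam) 0 / (n.factorial : ℂ)

/-- `U_N(z) = 1 + ∑_{n=1}^N ((2n)! V_{2n} / (2^n n!)) (-1/z)^n`. -/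
def partialU (lam : ℝ) (N : ℕ) (z : ℂ) : ℂ :=
  1 + ∑ n ∈ Finset.Icc 1 N,
    (((2 * n).factorial : ℂ) * coeffV lam (2 * n) / (2 ^ n * (n.factorial : ℂ))) * (-1 / z) ^ n

end

/-! For `ζ = log x` the substitution `t = exp (M - ζ)` turns the Hankel integral into the integral
of the entire function `logKernel lam ζ M = exp (exp M + (lam / 2) (M - ζ)² + (M - ζ))` from
`+∞ - iπ` to `+∞ + iπ`. A primitive of the kernel has the same limit along all curves that go to
infinity within `|Im M ∓ π| ≤ β < π / 2` (`tendsto_primitive_logKernel`). Hence every Hankel contour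
gives the value `hankelValue lam ζ` of a fixed contour, which is entire in `ζ`; this is the
continuation of `u`.

The equation `W + log W = log (x / lam)` (`lambertW_add_log`) says that `M = log ω(x)` is a saddle
point of `exp M + (lam / 2) (M - ζ)²`. With `M = s + log ω` the exponent becomes a constant minus
`ω (1 + s - exp s)`, plus `(lam / 2) s² + s`. The function `1 + s - exp s` has, up to a translation
by `± iπ`, the inverse `stripInv` of `p + exp p`, defined on a half-plane. This yields two curves
`s = saddleBranch (± 1) (e q²)`, `q > 0`, that leave the saddle and on which the exponent is
`-ω e q²`; here `e` is any unit vector with `Re e > 0` and `Re (ω e) > 0`. The same limit theorem,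
applied to these curves, represents `u(x)` as a Gaussian integral (`hankelValue_eq_integral`).

In the chart `σ(s)² = 2 (exp s - 1 - s)` the curves are the rays `σ = ∓ i q √(2e)`, `ℓ(σ)` is
`1 - exp s`, and the amplitude is `V`. On `|s| ≤ 5/4` the chart is bounded below by `4/5` on the
boundary, so that Cauchy's estimate for the coefficients and the maximum principle for the
remainders give the Taylor expansion of `V` with rate `4/5` (`exists_chartAmplitude_bounds`), that
is, radius `8/25` in the variable `q²`. Beyond this radius the amplitude grows slower than
`exp (δ q²)` for every `δ > 0`, and a crude bound is enough (`exists_norm_amplitude_sub_le`).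

Integration against the Gaussian gives `partialU` and a remainder (`exists_watson_bound`). The
inequality `|Re W| ≤ |W| / exp 1` for `Re W < 0` keeps `ω` away from the negative half-line, and
with `e = (3 ∓ 4i)/5` one has `Re (ω e) ≥ (13/25) |ω|`. Giving up `1/50` for the growth of the
amplitude, the rate of the remainder is `2 · 25/8 = 25/4 < 2π < A`, and the excess absorbs the
polynomial factors in `N`. Finally `|ω(x)| ≥ ω(|x|)` (`re_lambertW_absPoint_le`). -/

/-! ### The inverse of `p + exp p` and the Lambert function -/

/-- A properness argument for surjectivity: the image of `U` is open because `f` is locally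
invertible, and relatively closed in `D` because points of `closure U` over `D` lie in `U`. -/
theorem subset_image_of_isPreconnected {f : ℂ → ℂ} {U D : Set ℂ} (hf : Differentiable ℂ f)
    (hU : IsOpen U) (hf' : ∀ s ∈ U, deriv f s ≠ 0) (hD : IsPreconnected D)
    (hfr : ∀ s ∈ closure U, f s ∈ D → s ∈ U)
    (hbd : ∀ R : ℝ, Bornology.IsBounded {s ∈ U | ‖f s‖ ≤ R})
    (hne : (D ∩ f '' U).Nonempty) : D ⊆ f '' U := by
  have hopen : IsOpen (f '' U) := by
    rw [isOpen_iff_mem_nhds]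
    rintro _ ⟨s, hs, rfl⟩
    have h1 : HasStrictDerivAt f (deriv f s) s := (hf.analyticAt s).hasStrictDerivAt
    rw [← h1.map_nhds_eq (hf' s hs)]
    exact image_mem_map (hU.mem_nhds hs)
  refine hD.subset_of_closure_inter_subset hopen hne ?_
  rintro y ⟨hy, hyD⟩
  obtain ⟨u, hu, hlim⟩ := mem_closure_iff_seq_limit.1 hy
  choose s hsU hsu using hu
  have hev : ∀ᶠ n in atTop, s n ∈ {s ∈ U | ‖f s‖ ≤ ‖y‖ + 1} := by
    have : ∀ᶠ n in atTop, ‖u n‖ < ‖y‖ + 1 :=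
      (hlim.norm).eventually_lt_const (by linarith)
    filter_upwards [this] with n hn
    exact ⟨hsU n, by rw [hsu]; exact hn.le⟩
  obtain ⟨a, -, φ, hφ, hφl⟩ := tendsto_subseq_of_frequently_bounded (hbd _) hev.frequently
  have hfa : f a = y := by
    have h1 : Tendsto (fun n => f (s (φ n))) atTop (𝓝 (f a)) :=
      (hf.continuous.tendsto a).comp hφl
    have h2 : Tendsto (fun n => f (s (φ n))) atTop (𝓝 y) := by
      simp only [hsu]; exact hlim.comp hφ.tendsto_atTop
    exact tendsto_nhds_unique h1 h2
  have hac : a ∈ closure U := mem_closure_of_tendsto hφl (Eventually.of_forall fun n => hsU _)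
  exact ⟨a, hfr a hac (hfa ▸ hyD), hfa⟩

theorem add_exp_im (p : ℂ) : (p + Complex.exp p).im = p.im + Real.exp p.re * Real.sin p.im := by
  simp [Complex.exp_im]

theorem add_exp_re (p : ℂ) : (p + Complex.exp p).re = p.re + Real.exp p.re * Real.cos p.im := by
  simp [Complex.exp_re]

/-- In the open strip `0 < Im p < π` the derivative `1 + exp p` has positive imaginary part, which
makes `p + exp p` injective there. -/
theorem add_exp_injective_upper {p q : ℂ} (hp : 0 < p.im) (hp' : p.im < Real.pi) (hq : 0 < q.im)
    (hq' : q.im < Real.pi) (h : p + Complex.exp p = q + Complex.exp q) : p = q := by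
  by_contra hne
  -- along the segment, `(p + exp p) * conj (p - q)` has increasing imaginary part
  set d := p - q with hd
  have hd0 : d ≠ 0 := sub_ne_zero.2 hne
  let φ : ℝ → ℝ := fun t =>
    (((q + t * d) + Complex.exp (q + t * d)) * (starRingEnd ℂ) d).im
  have hderiv : ∀ t : ℝ, HasDerivAt φ
      (((d + Complex.exp (q + t * d) * d) * (starRingEnd ℂ) d).im) t := by
    intro t
    have h1 : HasDerivAt (fun t : ℝ => q + (t : ℂ) * d) d t := by
      simpa using ((Complex.ofRealCLM.hasDerivAt (x := t)).mul_const d).const_add q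
    have h2 := (h1.add h1.cexp).mul_const ((starRingEnd ℂ) d)
    exact Complex.imCLM.hasFDerivAt.comp_hasDerivAt t h2
  have h01 : φ 0 = φ 1 := by
    have e1 : q + ((1 : ℝ) : ℂ) * d = p := by simp [hd]
    simp only [φ, e1, h]
    simp
  obtain ⟨t, ht, ht0⟩ := exists_hasDerivAt_eq_zero (f := φ) zero_lt_one
    (fun t _ => (hderiv t).continuousAt.continuousWithinAt) h01 (fun t _ => hderiv t)
  have e2 : ((d + Complex.exp (q + t * d) * d) * (starRingEnd ℂ) d) =
      (1 + Complex.exp (q + t * d)) * ((Complex.normSq d : ℝ) : ℂ) := by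
    rw [← Complex.mul_conj]; ring
  rw [e2, Complex.im_mul_ofReal] at ht0
  have hns : 0 < Complex.normSq d := Complex.normSq_pos.2 hd0
  have him : (q + t * d).im = (1 - t) * q.im + t * p.im := by
    simp [hd]; ring
  have hpos : 0 < (1 + Complex.exp (q + t * d)).im := by
    simp only [Complex.add_im, Complex.one_im, zero_add, Complex.exp_im]
    apply mul_pos (Real.exp_pos _)
    have := ht.1
    have := ht.2
    have e3 : (q + t * d).im = (1 - t) * q.im + t * p.im := him
    simp only [Complex.add_im] at e3
    rw [e3]
    apply Real.sin_pos_of_pos_of_lt_pi <;> nlinarith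
  exact (mul_pos hpos hns).ne' ht0

theorem add_exp_im_pos {p : ℂ} (hp : 0 < p.im) (hp' : p.im < Real.pi) :
    0 < (p + Complex.exp p).im := by
  rw [add_exp_im]
  have := Real.sin_pos_of_pos_of_lt_pi hp hp'
  positivity

theorem add_exp_conj (p : ℂ) : (starRingEnd ℂ) p + Complex.exp ((starRingEnd ℂ) p) =
    (starRingEnd ℂ) (p + Complex.exp p) := by
  rw [map_add, Complex.exp_conj]

theorem add_exp_im_neg {p : ℂ} (hp : p.im < 0) (hp' : -Real.pi < p.im) :
    (p + Complex.exp p).im < 0 := by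
  have := add_exp_im_pos (p := (starRingEnd ℂ) p) (by simpa using hp) (by simp; linarith)
  rw [add_exp_conj, Complex.conj_im] at this
  linarith

theorem add_exp_im_of_im_eq_zero {p : ℂ} (hp : p.im = 0) : (p + Complex.exp p).im = 0 := by
  rw [add_exp_im, hp]; simp

/-- `p + exp p` is injective on the strip `|Im p| < π`. -/
theorem add_exp_injective {p q : ℂ} (hp : |p.im| < Real.pi) (hq : |q.im| < Real.pi)
    (h : p + Complex.exp p = q + Complex.exp q) : p = q := by
  rw [abs_lt] at hp hq
  have him : (p + Complex.exp p).im = (q + Complex.exp q).im := by rw [h]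
  rcases lt_trichotomy p.im 0 with h1 | h1 | h1 <;> rcases lt_trichotomy q.im 0 with h2 | h2 | h2
  · have := add_exp_injective_upper (p := (starRingEnd ℂ) p) (q := (starRingEnd ℂ) q)
      (by simpa using h1) (by simp; linarith) (by simpa using h2) (by simp; linarith)
      (by rw [add_exp_conj, add_exp_conj, h])
    exact (starRingEnd ℂ).injective this
  · linarith [add_exp_im_neg h1 hp.1, add_exp_im_of_im_eq_zero h2]
  · linarith [add_exp_im_neg h1 hp.1, add_exp_im_pos h2 hq.2]
  · linarith [add_exp_im_neg h2 hq.1, add_exp_im_of_im_eq_zero h1]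
  · have hre : (p + Complex.exp p).re = (q + Complex.exp q).re := by rw [h]
    rw [add_exp_re, add_exp_re, h1, h2] at hre
    simp only [Real.cos_zero, mul_one] at hre
    apply Complex.ext _ (h1.trans h2.symm)
    rcases lt_trichotomy p.re q.re with h3 | h3 | h3
    · linarith [Real.exp_lt_exp.2 h3]
    · exact h3
    · linarith [Real.exp_lt_exp.2 h3]
  · linarith [add_exp_im_pos h2 hq.2, add_exp_im_of_im_eq_zero h1]
  · linarith [add_exp_im_neg h2 hq.1, add_exp_im_pos h1 hp.2]
  · linarith [add_exp_im_pos h1 hp.2, add_exp_im_of_im_eq_zero h2]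
  · exact add_exp_injective_upper h1 hp.2 h2 hq.2 h

theorem one_add_exp_ne_zero {p : ℂ} (hp : |p.im| < Real.pi) : 1 + Complex.exp p ≠ 0 := by
  intro h
  have h1 : Complex.exp p = -1 := by linear_combination h
  have him : Real.exp p.re * Real.sin p.im = 0 := by
    rw [← Complex.exp_im, h1]; simp
  have hs : Real.sin p.im = 0 := by
    rcases mul_eq_zero.1 him with h2 | h2
    · exact absurd h2 (Real.exp_pos _).ne'
    · exact h2
  have h0 : p.im = 0 := (Real.sin_eq_zero_iff_of_lt_of_lt (abs_lt.1 hp).1 (abs_lt.1 hp).2).1 hs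
  have hre : Real.exp p.re * Real.cos p.im = -1 := by
    rw [← Complex.exp_re, h1]; simp
  rw [h0, Real.cos_zero, mul_one] at hre
  linarith [Real.exp_pos p.re]

theorem hasDerivAt_add_exp (p : ℂ) :
    HasDerivAt (fun p => p + Complex.exp p) (1 + Complex.exp p) p :=
  (hasDerivAt_id p).add (Complex.hasDerivAt_exp p)

/-- `p + exp p` maps the strip `|Im p| < π` onto the complement of two slits, and in particular
onto `Re > -1`. -/
theorem exists_add_exp_eq {ζ : ℂ} (hζ : -1 < ζ.re) :
    ∃ p : ℂ, |p.im| < Real.pi ∧ p + Complex.exp p = ζ := by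
  have hU : IsOpen {p : ℂ | |p.im| < Real.pi} :=
    isOpen_lt (Complex.continuous_im.abs) continuous_const
  have key := subset_image_of_isPreconnected (f := fun p => p + Complex.exp p)
    (U := {p : ℂ | |p.im| < Real.pi}) (D := {ζ : ℂ | -1 < ζ.re})
    (fun p => (hasDerivAt_add_exp p).differentiableAt) hU
    (fun p hp => by rw [(hasDerivAt_add_exp p).deriv]; exact one_add_exp_ne_zero hp)
    (convex_halfSpace_re_gt (-1)).isPreconnected ?_ ?_ ?_
  · obtain ⟨p, hp, h⟩ := key hζ
    exact ⟨p, hp, h⟩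
  · intro p hp hD
    have hcl : p ∈ {p : ℂ | |p.im| ≤ Real.pi} := by
      refine closure_minimal ?_ (isClosed_le (Complex.continuous_im.abs) continuous_const) hp
      intro q hq
      have hq : |q.im| < Real.pi := hq
      exact hq.le
    have hcl : |p.im| ≤ Real.pi := hcl
    rcases lt_or_eq_of_le hcl with h | h
    · exact h
    · exfalso
      have hc : Real.cos p.im = -1 := by rw [← Real.cos_abs, h, Real.cos_pi]
      have hD' : -1 < (p + Complex.exp p).re := hD
      rw [add_exp_re, hc] at hD'
      linarith [Real.add_one_le_exp p.re]
  · intro R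
    rw [isBounded_iff_forall_norm_le]
    refine ⟨2 * (R + Real.pi + 1) + Real.pi, ?_⟩
    rintro p ⟨hp, hR⟩
    have hp : |p.im| < Real.pi := hp
    have h1 : ‖p‖ ≤ |p.re| + |p.im| := Complex.norm_le_abs_re_add_abs_im p
    have h0 : 0 ≤ R := (norm_nonneg _).trans hR
    have hpi := Real.pi_pos
    have h2 : |p.re| ≤ 2 * (R + Real.pi + 1) := by
      rcases le_total 0 p.re with h | h
      · rw [abs_of_nonneg h]
        have h3 : ‖Complex.exp p‖ ≤ ‖p + Complex.exp p‖ + ‖p‖ := by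
          have := norm_sub_le (p + Complex.exp p) p
          simpa using this
        rw [Complex.norm_exp] at h3
        have h4 := Real.quadratic_le_exp_of_nonneg h
        rw [abs_of_nonneg h] at h1
        have h5 : p.re ^ 2 / 2 ≤ R + Real.pi := by linarith
        nlinarith [sq_nonneg (p.re - 2)]
      · rw [abs_of_nonpos h]
        have h3 := (abs_le.1 ((Complex.abs_re_le_norm _).trans hR)).1
        rw [add_exp_re] at h3
        have h4 : Real.exp p.re * Real.cos p.im ≤ 1 := by
          have := Real.cos_le_one p.im
          have := Real.exp_le_one_iff.2 h
          have := Real.exp_pos p.re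
          nlinarith
        linarith
    linarith
  · refine ⟨1, by simp, 0, by simp [Real.pi_pos], by simp⟩

/-- The inverse on `Re > -1` of `p + exp p`, with values in the strip `|Im p| < π`. -/
noncomputable def stripInv (ζ : ℂ) : ℂ :=
  open Classical in if h : -1 < ζ.re then (exists_add_exp_eq h).choose else 0

theorem stripInv_im {ζ : ℂ} (h : -1 < ζ.re) : |(stripInv ζ).im| < Real.pi := by
  rw [stripInv, dif_pos h]; exact (exists_add_exp_eq h).choose_spec.1

theorem stripInv_eq {ζ : ℂ} (h : -1 < ζ.re) : stripInv ζ + Complex.exp (stripInv ζ) = ζ := by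
  rw [stripInv, dif_pos h]; exact (exists_add_exp_eq h).choose_spec.2

theorem hasDerivAt_stripInv {ζ : ℂ} (h : -1 < ζ.re) :
    HasDerivAt stripInv (1 + Complex.exp (stripInv ζ))⁻¹ ζ := by
  have hd : HasStrictDerivAt (fun p => p + Complex.exp p) (1 + Complex.exp (stripInv ζ))
      (stripInv ζ) :=
    (hasStrictDerivAt_id _).add (Complex.hasStrictDerivAt_exp _)
  have hne := one_add_exp_ne_zero (stripInv_im h)
  have hopen : IsOpen {p : ℂ | |p.im| < Real.pi} :=
    isOpen_lt (Complex.continuous_im.abs) continuous_const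
  have hev : ∀ᶠ p in 𝓝 (stripInv ζ), stripInv (p + Complex.exp p) = p := by
    have h1 : ∀ᶠ p in 𝓝 (stripInv ζ), |p.im| < Real.pi := hopen.mem_nhds (stripInv_im h)
    have h2 : ∀ᶠ p in 𝓝 (stripInv ζ), -1 < (p + Complex.exp p).re := by
      have : Continuous fun p : ℂ => (p + Complex.exp p).re := by fun_prop
      refine this.continuousAt.eventually_const_lt ?_
      simpa only [stripInv_eq h] using h
    filter_upwards [h1, h2] with p hp1 hp2
    exact add_exp_injective (stripInv_im hp2) hp1 (stripInv_eq hp2)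
  have := (hd.to_local_left_inverse hne hev).hasDerivAt
  rwa [stripInv_eq h] at this

theorem LogSurface.toComplex_eq_exp (x : LogSurface) :
    x.toComplex = Complex.exp (Real.log x.modulus + x.arg * Complex.I) := by
  rw [Complex.exp_add, ← Complex.ofReal_exp, Real.exp_log x.modulus_pos]; rfl

/-- `W = exp p`, where `p + exp p = log x`. -/
theorem isLambertW_stripInv : IsLambertW fun x =>
    Complex.exp (stripInv (Real.log x.modulus + x.arg * Complex.I)) := by
  have hre : ∀ x ∈ LogSurface.exterior 1, 0 < (Real.log x.modulus + x.arg * Complex.I : ℂ).re := by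
    intro x hx
    simpa using Real.log_pos hx
  constructor
  · intro ζ hζ
    have h0 : 0 < ζ.re := by
      have : 1 < Real.exp ζ.re := hζ
      rwa [Real.one_lt_exp_iff] at this
    have : (fun ζ : ℂ => Complex.exp (stripInv (Real.log (LogSurface.ofLog ζ).modulus +
        (LogSurface.ofLog ζ).arg * Complex.I))) = fun ζ => Complex.exp (stripInv ζ) := by
      funext ζ
      simp [LogSurface.ofLog, Complex.re_add_im]
    simp only [this]
    have h1 := (hasDerivAt_stripInv (by linarith : -1 < ζ.re)).cexp
    exact h1.differentiableAt.differentiableWithinAt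
  · intro x hx
    have h := stripInv_eq (ζ := Real.log x.modulus + x.arg * Complex.I) (by linarith [hre x hx])
    rw [x.toComplex_eq_exp, ← Complex.exp_add, h]
  · intro x hx h0
    set p := stripInv (Real.log x.modulus + x.arg * Complex.I) with hp
    have hgt : -1 < (Real.log x.modulus + x.arg * Complex.I : ℂ).re := by linarith [hre x hx]
    have h := stripInv_eq hgt
    have him := abs_lt.1 (stripInv_im hgt)
    rw [← hp] at h him
    have h1 : (p + Complex.exp p).im = 0 := by rw [h]; simp [h0]
    have h2 : p.im = 0 := by
      rcases lt_trichotomy p.im 0 with h2 | h2 | h2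
      · linarith [add_exp_im_neg h2 him.1]
      · exact h2
      · linarith [add_exp_im_pos h2 him.2]
    refine ⟨Real.exp p.re, Real.exp_pos _, ?_⟩
    rw [Complex.ofReal_exp]
    congr 1
    exact Complex.ext (by simp) (by simp [h2])

theorem isLambertW_lambertW : IsLambertW lambertW :=
  Classical.epsilon_spec ⟨_, isLambertW_stripInv⟩

theorem LogSurface.norm_toComplex (x : LogSurface) : ‖x.toComplex‖ = x.modulus := by
  rw [LogSurface.toComplex, norm_mul, Complex.norm_exp_ofReal_mul_I, mul_one, Complex.norm_real,
    Real.norm_of_nonneg x.modulus_pos.le]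

theorem norm_lambertW_mul_exp {x : LogSurface} (hx : x ∈ LogSurface.exterior 1) :
    1 < ‖lambertW x‖ * Real.exp (lambertW x).re := by
  rw [← Complex.norm_exp, ← norm_mul, isLambertW_lambertW.equation x hx, x.norm_toComplex]
  exact hx

theorem lambertW_ne_zero {x : LogSurface} (hx : x ∈ LogSurface.exterior 1) : lambertW x ≠ 0 := by
  intro h
  have := norm_lambertW_mul_exp hx
  rw [h] at this
  norm_num at this

/-- `|W| > 1/2`, since `(1/2) exp (1/2) < 1`. -/
theorem half_lt_norm_lambertW {x : LogSurface} (hx : x ∈ LogSurface.exterior 1) :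
    1 / 2 < ‖lambertW x‖ := by
  by_contra! h
  have h1 := norm_lambertW_mul_exp hx
  have h2 : Real.exp (lambertW x).re ≤ Real.exp (1 / 2) :=
    Real.exp_le_exp.2 ((Complex.re_le_norm _).trans h)
  have h3 : Real.exp (1 / 2) < 2 := by
    have h4 : Real.exp (1 / 2) ^ 2 < 2 ^ 2 := by
      rw [← Real.exp_nat_mul]
      norm_num
      linarith [Real.exp_one_lt_three]
    exact lt_of_pow_lt_pow_left₀ 2 (by norm_num) h4
  nlinarith [Real.exp_pos (lambertW x).re, norm_nonneg (lambertW x)]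

/-- Since `a exp (-a) ≤ exp (-1)`, the values of `W` stay away from the negative half-line. -/
theorem neg_re_lambertW_le {x : LogSurface} (hx : x ∈ LogSurface.exterior 1) :
    -(lambertW x).re * Real.exp 1 ≤ ‖lambertW x‖ := by
  have h1 := norm_lambertW_mul_exp hx
  set r := (lambertW x).re
  have h2 : -r ≤ Real.exp (-r - 1) := by linarith [Real.add_one_le_exp (-r - 1)]
  have h3 : Real.exp (-r - 1) * Real.exp 1 = Real.exp (-r) := by rw [← Real.exp_add]; congr 1; ring
  have h4 : Real.exp (-r) * Real.exp r = 1 := by rw [← Real.exp_add]; simp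
  have h5 : Real.exp (-r) ≤ ‖lambertW x‖ := by
    have := Real.exp_pos r
    have : Real.exp (-r) * Real.exp r ≤ ‖lambertW x‖ * Real.exp r := by linarith
    exact le_of_mul_le_mul_right this (Real.exp_pos r)
  have := Real.exp_pos 1
  nlinarith

theorem lambertW_mem_slitPlane {x : LogSurface} (hx : x ∈ LogSurface.exterior 1) :
    lambertW x ∈ Complex.slitPlane := by
  rw [Complex.mem_slitPlane_iff_not_le_zero]
  intro h
  have him : (lambertW x).im = 0 := (Complex.nonpos_iff.1 h).2
  have hre : (lambertW x).re ≤ 0 := (Complex.nonpos_iff.1 h).1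
  have hn : ‖lambertW x‖ = -(lambertW x).re := by
    rw [← Complex.re_add_im (lambertW x), him]
    simp [abs_of_nonpos hre]
  have h1 := neg_re_lambertW_le hx
  have h2 := half_lt_norm_lambertW hx
  nlinarith [Real.add_one_lt_exp (one_ne_zero)]

/-- The defining equation of `W` in logarithmic form, with the principal logarithm of `W`. -/
theorem lambertW_add_log {x : LogSurface} (hx : x ∈ LogSurface.exterior 1) :
    lambertW x + Complex.log (lambertW x) = Real.log x.modulus + x.arg * Complex.I := by
  let H : Set ℂ := {ζ : ℂ | 0 < ζ.re}
  let v : ℂ → ℂ := fun ζ => lambertW (LogSurface.ofLog ζ)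
  have hmem : ∀ ζ ∈ H, LogSurface.ofLog ζ ∈ LogSurface.exterior 1 := fun ζ hζ =>
    Real.one_lt_exp_iff.2 hζ
  have hH : LogSurface.ofLog ⁻¹' LogSurface.exterior 1 = H := by
    ext ζ; exact Real.one_lt_exp_iff
  have hHo : IsOpen H := isOpen_lt continuous_const Complex.continuous_re
  have hvd : DifferentiableOn ℂ v H := hH ▸ isLambertW_lambertW.analytic
  let k : ℂ → ℂ := fun ζ => v ζ + Complex.log (v ζ) - ζ
  have hkd : DifferentiableOn ℂ k H :=
    (hvd.add (hvd.clog fun ζ hζ => lambertW_mem_slitPlane (hmem ζ hζ))).sub differentiableOn_id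
  have hexp : ∀ ζ ∈ H, Complex.exp (k ζ) = 1 := by
    intro ζ hζ
    have h1 := isLambertW_lambertW.equation _ (hmem ζ hζ)
    have h2 := lambertW_ne_zero (hmem ζ hζ)
    simp only [k, v]
    rw [Complex.exp_sub, Complex.exp_add, Complex.exp_log h2, mul_comm (Complex.exp _), h1,
      LogSurface.toComplex_eq_exp]
    simp [LogSurface.ofLog, Complex.re_add_im, Complex.exp_ne_zero]
  have hk' : ∀ ζ ∈ H, deriv k ζ = 0 := by
    intro ζ hζ
    have h1 := (hkd.differentiableAt (hHo.mem_nhds hζ)).hasDerivAt.cexp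
    have h2 : (fun ζ => Complex.exp (k ζ)) =ᶠ[𝓝 ζ] fun _ => 1 := by
      filter_upwards [hHo.mem_nhds hζ] with z hz using hexp z hz
    have h3 := h1.congr_of_eventuallyEq h2.symm
    have h4 := h3.unique (hasDerivAt_const ζ (1 : ℂ))
    rwa [hexp ζ hζ, one_mul] at h4
  have hconst : ∀ ζ ∈ H, k ζ = k 1 := fun ζ hζ =>
    hHo.is_const_of_deriv_eq_zero (convex_halfSpace_re_gt 0).isPreconnected hkd hk' hζ
      (by simp [H])
  have hk1 : k 1 = 0 := by
    have h1m : (1 : ℂ) ∈ H := by simp [H]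
    obtain ⟨y, hy, hyv⟩ := isLambertW_lambertW.positive _ (hmem 1 h1m) (by simp [LogSurface.ofLog])
    have h1 := hexp 1 h1m
    have hkr : k 1 = ((y + Real.log y - 1 : ℝ) : ℂ) := by
      simp only [k, v, hyv]
      rw [← Complex.ofReal_log hy.le]; push_cast; ring
    rw [hkr, ← Complex.ofReal_exp] at h1
    have h2 : Real.exp (y + Real.log y - 1) = 1 := by exact_mod_cast h1
    rw [hkr, (Real.exp_eq_one_iff _).1 h2]; simp
  have hx' : (Real.log x.modulus + x.arg * Complex.I : ℂ) ∈ H := by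
    have := Real.log_pos hx
    simpa [H] using this
  have hof : LogSurface.ofLog (Real.log x.modulus + x.arg * Complex.I) = x := by
    ext <;> simp [LogSurface.ofLog, Real.exp_log x.modulus_pos]
  have := (hconst _ hx').trans hk1
  simp only [k, v, hof] at this
  linear_combination this

/-- `W` at the point `|x|` is at most `|W x|`, as `W(|x|)` solves `v + log v = log |x|` and
`|W x| + log |W x| ≥ log |x|`. -/
theorem re_lambertW_absPoint_le {x : LogSurface} (hx : x ∈ LogSurface.exterior 1) :
    0 < (lambertW x.absPoint).re ∧ (lambertW x.absPoint).re ≤ ‖lambertW x‖ := by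
  have hx' : x.absPoint ∈ LogSurface.exterior 1 := hx
  obtain ⟨y, hy, hyv⟩ := isLambertW_lambertW.positive _ hx' rfl
  refine ⟨by simpa [hyv] using hy, ?_⟩
  rw [hyv, Complex.ofReal_re]
  have h1 := congrArg norm (isLambertW_lambertW.equation _ hx')
  have h2 := congrArg norm (isLambertW_lambertW.equation _ hx)
  rw [norm_mul, Complex.norm_exp, LogSurface.norm_toComplex] at h1 h2
  rw [hyv] at h1
  simp only [Complex.norm_real, Real.norm_of_nonneg hy.le, Complex.ofReal_re] at h1
  have h3 : x.absPoint.modulus = x.modulus := rfl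
  by_contra! hlt
  have h4 : Real.exp (lambertW x).re < Real.exp y :=
    Real.exp_lt_exp.2 ((Complex.re_le_norm _).trans_lt hlt)
  have h5 : ‖lambertW x‖ * Real.exp (lambertW x).re < y * Real.exp y :=
    mul_lt_mul'' hlt h4 (norm_nonneg _) (Real.exp_pos _).le
  linarith

/-! ### Contour integrals of `exp (exp M + (lam / 2) (M - ζ)² + (M - ζ))` -/

/-- The integrand of `u` after the substitution `t = exp (M - ζ)`, where `ζ = log x`. -/
noncomputable def logKernel (lam : ℝ) (ζ M : ℂ) : ℂ :=
  Complex.exp (Complex.exp M + (lam : ℂ) / 2 * (M - ζ) ^ 2 + (M - ζ))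

/-- `exp` dominates quadratic polynomials, in the form used for all tail estimates. -/
theorem exists_quadratic_le_exp {κ : ℝ} (hκ : 0 < κ) (A K R : ℝ) (hA : 0 ≤ A) (hK : 0 ≤ K)
    (hR : 0 ≤ R) :
    ∃ C : ℝ, ∀ a : ℝ, 0 ≤ a → A * (a + R) ^ 2 + K * (a + R) ≤ C + κ * Real.exp a := by
  set δ := κ * Real.exp (-R) / 6 with hδ
  have hδ0 : 0 < δ := by positivity
  set T := (A + K) / δ + 1 with hT
  have hT1 : 1 ≤ T := by rw [hT]; linarith [div_nonneg (add_nonneg hA hK) hδ0.le]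
  refine ⟨A * T ^ 2 + K * T, fun a ha => ?_⟩
  set p := a + R with hp
  have hp0 : 0 ≤ p := add_nonneg ha hR
  have hexp : δ * p ^ 3 ≤ κ * Real.exp a := by
    have h1 : p ^ 3 / 6 ≤ Real.exp p := by
      have := Real.pow_div_factorial_le_exp p hp0 3
      norm_num [Nat.factorial] at this
      exact this
    have h2 : Real.exp a = Real.exp (-R) * Real.exp p := by
      rw [← Real.exp_add]; congr 1; rw [hp]; ring
    rw [h2, hδ]
    have := mul_le_mul_of_nonneg_left h1 (mul_pos hκ (Real.exp_pos (-R))).le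
    linarith
  rcases le_total p T with h | h
  · have h1 : p ^ 2 ≤ T ^ 2 := pow_le_pow_left₀ hp0 h 2
    have h2 : 0 ≤ κ * Real.exp a := by positivity
    nlinarith [mul_le_mul_of_nonneg_left h1 hA, mul_le_mul_of_nonneg_left h hK]
  · have hp1 : 1 ≤ p := hT1.trans h
    have h3 : A + K ≤ δ * p := by
      have h4 : (A + K) / δ ≤ p := by linarith
      rw [div_le_iff₀ hδ0] at h4; linarith
    have h5 : (A + K) * p ^ 2 ≤ δ * p ^ 3 := by
      have := mul_le_mul_of_nonneg_right h3 (sq_nonneg p)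
      nlinarith
    have h6 : K * p ≤ K * p ^ 2 := mul_le_mul_of_nonneg_left (by nlinarith) hK
    have h7 : 0 ≤ A * T ^ 2 + K * T := by positivity
    nlinarith

theorem norm_logKernel_le {lam : ℝ} (hlam : 0 ≤ lam) (ζ M : ℂ) :
    ‖logKernel lam ζ M‖ ≤
      Real.exp ((Complex.exp M).re + (lam / 2 * (‖M‖ + ‖ζ‖) ^ 2 + (‖M‖ + ‖ζ‖))) := by
  rw [logKernel, Complex.norm_exp]
  apply Real.exp_le_exp.2
  have h1 : ‖M - ζ‖ ≤ ‖M‖ + ‖ζ‖ := norm_sub_le _ _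
  have h2 : ((lam : ℂ) / 2 * (M - ζ) ^ 2).re ≤ lam / 2 * (‖M‖ + ‖ζ‖) ^ 2 := by
    refine (Complex.re_le_norm _).trans ?_
    rw [norm_mul, norm_pow, norm_div, Complex.norm_real, Real.norm_of_nonneg hlam]
    have : ‖(2 : ℂ)‖ = 2 := by simp
    rw [this]
    gcongr
  have h3 : (M - ζ).re ≤ ‖M‖ + ‖ζ‖ := (Complex.re_le_norm _).trans h1
  rw [Complex.add_re, Complex.add_re]
  linarith

theorem hasDerivAt_logKernel_param (lam : ℝ) (ζ M : ℂ) :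
    HasDerivAt (fun ζ => logKernel lam ζ M)
      (logKernel lam ζ M * (-((lam : ℂ) * (M - ζ)) - 1)) ζ := by
  have h1 : HasDerivAt (fun ζ : ℂ => M - ζ) (-1) ζ := by
    simpa using (hasDerivAt_id ζ).const_sub M
  have h2 := ((((h1.pow 2).const_mul ((lam : ℂ) / 2)).const_add (Complex.exp M)).add h1).cexp
  refine HasDerivAt.congr_deriv (f := fun ζ => logKernel lam ζ M) h2 ?_
  simp only [logKernel, Pi.add_apply, Pi.pow_apply]
  push_cast
  ring

theorem continuous_logKernel (lam : ℝ) : Continuous fun p : ℂ × ℂ => logKernel lam p.1 p.2 := by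
  unfold logKernel; fun_prop

/-- An integral of the kernel over a curve `c` is entire in the parameter, provided that the kernel
is integrable with a margin. -/
theorem differentiable_integral_logKernel {lam : ℝ} (hlam : 0 ≤ lam) {μ : Measure ℝ} {c : ℝ → ℂ}
    (hc : Continuous c)
    (hint : ∀ R : ℝ, 0 ≤ R → Integrable (fun t => Real.exp ((Complex.exp (c t)).re +
      (lam / 2 * (‖c t‖ + R) ^ 2 + 2 * (‖c t‖ + R)))) μ) :
    Differentiable ℂ fun ζ => ∫ t, logKernel lam ζ (c t) ∂μ := by
  intro ζ₀
  have hcont : ∀ ζ, Continuous fun t => logKernel lam ζ (c t) := fun ζ =>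
    (continuous_logKernel lam).comp (continuous_const.prodMk hc)
  set R := ‖ζ₀‖ + 1 with hR
  have hR0 : 0 ≤ R := by positivity
  have hball : ∀ ζ ∈ Metric.ball ζ₀ 1, ‖ζ‖ ≤ R := by
    intro ζ hζ
    have := norm_sub_norm_le ζ ζ₀
    rw [mem_ball_iff_norm] at hζ
    linarith
  have hmono : ∀ ζ, ‖ζ‖ ≤ R → ∀ t, ‖logKernel lam ζ (c t)‖ ≤
      Real.exp ((Complex.exp (c t)).re + (lam / 2 * (‖c t‖ + R) ^ 2 + (‖c t‖ + R))) := by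
    intro ζ hζ t
    refine (norm_logKernel_le hlam _ _).trans (Real.exp_le_exp.2 ?_)
    gcongr
  refine (hasDerivAt_integral_of_dominated_loc_of_deriv_le (s := Metric.ball ζ₀ 1)
    (F' := fun ζ t => logKernel lam ζ (c t) * (-((lam : ℂ) * (c t - ζ)) - 1))
    (bound := fun t => (lam + 1) * Real.exp ((Complex.exp (c t)).re +
      (lam / 2 * (‖c t‖ + R) ^ 2 + 2 * (‖c t‖ + R))))
    (Metric.ball_mem_nhds _ one_pos) (Eventually.of_forall fun ζ => (hcont ζ).aestronglyMeasurable)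
    ?_ ?_ ?_ ((hint R hR0).const_mul _) ?_).2.differentiableAt
  · refine (hint R hR0).mono' (hcont _).aestronglyMeasurable (Eventually.of_forall fun t => ?_)
    refine (hmono ζ₀ (by linarith) t).trans (Real.exp_le_exp.2 ?_)
    have : 0 ≤ ‖c t‖ + R := by positivity
    linarith
  · have := hcont ζ₀
    exact (this.mul (by fun_prop)).aestronglyMeasurable
  · refine Eventually.of_forall fun t ζ hζ => ?_
    have h0 : 0 ≤ ‖c t‖ + R := by positivity
    have h1 : ‖-((lam : ℂ) * (c t - ζ)) - 1‖ ≤ (lam + 1) * Real.exp (‖c t‖ + R) := by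
      have h2 : ‖c t - ζ‖ ≤ ‖c t‖ + R := (norm_sub_le _ _).trans (by linarith [hball ζ hζ])
      have h3 : ‖-((lam : ℂ) * (c t - ζ)) - 1‖ ≤ lam * ‖c t - ζ‖ + 1 := by
        refine (norm_sub_le _ _).trans ?_
        rw [norm_neg, norm_mul, Complex.norm_real, Real.norm_of_nonneg hlam, norm_one]
      have h4 := Real.add_one_le_exp (‖c t‖ + R)
      nlinarith [mul_le_mul_of_nonneg_left h2 hlam]
    rw [norm_mul]
    calc _ ≤ _ := mul_le_mul (hmono ζ (hball ζ hζ) t) h1 (norm_nonneg _) (Real.exp_pos _).le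
      _ = _ := by
        rw [mul_left_comm, ← Real.exp_add]
        ring_nf
  · exact Eventually.of_forall fun t ζ _ => hasDerivAt_logKernel_param lam ζ (c t)

theorem exp_re_le_of_cos_le {M : ℂ} {κ : ℝ} (h : Real.cos M.im ≤ -κ) :
    (Complex.exp M).re ≤ -(κ * Real.exp M.re) := by
  rw [Complex.exp_re]
  nlinarith [Real.exp_pos M.re]

/-- Exponential decay of the kernel along `Re M → ∞`, uniformly where `cos (Im M) ≤ -κ < 0`. -/
theorem exists_kernel_decay (lam : ℝ) (hlam : 0 ≤ lam) {κ : ℝ} (hκ : 0 < κ) (B R : ℝ) (hB : 0 ≤ B)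
    (hR : 0 ≤ R) : ∃ C : ℝ, 0 < C ∧ ∀ M : ℂ, 0 ≤ M.re → |M.im| ≤ B → Real.cos M.im ≤ -κ →
      Real.exp ((Complex.exp M).re + (lam / 2 * (‖M‖ + R) ^ 2 + 2 * (‖M‖ + R))) ≤
        C * Real.exp (-M.re) := by
  obtain ⟨C, hC⟩ := exists_quadratic_le_exp hκ (lam / 2) 3 (B + R) (by positivity) (by norm_num)
    (by positivity)
  refine ⟨Real.exp C, Real.exp_pos _, fun M h0 hB' hcos => ?_⟩
  rw [← Real.exp_add]
  apply Real.exp_le_exp.2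
  have h1 : ‖M‖ ≤ M.re + B := by
    have := Complex.norm_le_abs_re_add_abs_im M
    rw [abs_of_nonneg h0] at this
    linarith
  have h2 := hC M.re h0
  have h3 := exp_re_le_of_cos_le hcos
  have h4 : lam / 2 * (‖M‖ + R) ^ 2 ≤ lam / 2 * (M.re + (B + R)) ^ 2 := by
    have h5 : ‖M‖ + R ≤ M.re + (B + R) := by linarith
    have h6 : 0 ≤ ‖M‖ + R := by positivity
    gcongr
  linarith

/-- Decay of the kernel itself in a half-strip around the line `Im M = c`, `c = ±π`. -/
theorem exists_norm_logKernel_le {lam : ℝ} (hlam : 0 ≤ lam) (ζ : ℂ) {c : ℝ} (hc : Real.cos c = -1)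
    {β : ℝ} (hβ : β < Real.pi / 2) (hβ0 : 0 ≤ β) :
    ∃ C : ℝ, 0 < C ∧ ∀ M : ℂ, 0 ≤ M.re → |M.im - c| ≤ β →
      ‖logKernel lam ζ M‖ ≤ C * Real.exp (-M.re) := by
  have hκ : 0 < Real.cos β := Real.cos_pos_of_mem_Ioo ⟨by linarith [Real.pi_pos], hβ⟩
  obtain ⟨C, hC0, hC⟩ := exists_kernel_decay lam hlam hκ (|c| + β) ‖ζ‖ (by positivity)
    (norm_nonneg _)
  refine ⟨C, hC0, fun M h0 hM => ?_⟩
  have hs : Real.sin c = 0 := by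
    have := Real.sin_sq_add_cos_sq c
    rw [hc] at this
    nlinarith
  have hcos : Real.cos M.im ≤ -Real.cos β := by
    have h1 : Real.cos M.im = -Real.cos (M.im - c) := by
      rw [Real.cos_sub, hc, hs]; ring
    rw [h1, ← Real.cos_abs (M.im - c)]
    have := Real.cos_le_cos_of_nonneg_of_le_pi (abs_nonneg (M.im - c))
      (by linarith [Real.pi_pos]) hM
    linarith
  have hB : |M.im| ≤ |c| + β := by
    have := abs_add_le c (M.im - c)
    rw [add_sub_cancel] at this
    linarith
  refine (norm_logKernel_le hlam ζ M).trans (le_trans (Real.exp_le_exp.2 ?_) (hC M h0 hB hcos))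
  have : 0 ≤ ‖M‖ + ‖ζ‖ := by positivity
  linarith

theorem integrableOn_exp_kernel_line {lam : ℝ} (hlam : 0 ≤ lam) {c : ℝ} (hc : Real.cos c = -1)
    {R : ℝ} (hR : 0 ≤ R) :
    IntegrableOn (fun t : ℝ => Real.exp ((Complex.exp (t + c * Complex.I)).re +
      (lam / 2 * (‖(t + c * Complex.I : ℂ)‖ + R) ^ 2 + 2 * (‖(t + c * Complex.I : ℂ)‖ + R))))
      (Set.Ioi 0) := by
  obtain ⟨C, hC0, hC⟩ := exists_kernel_decay lam hlam one_pos |c| R (abs_nonneg c) hR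
  refine Integrable.mono' ((integrableOn_exp_neg_Ioi 0).const_mul C) ?_ ?_
  · refine Continuous.aestronglyMeasurable ?_
    fun_prop
  · refine (ae_restrict_iff' measurableSet_Ioi).2 (Eventually.of_forall fun t ht => ?_)
    rw [Real.norm_of_nonneg (Real.exp_pos _).le]
    have := hC (t + c * Complex.I) (by simpa using le_of_lt ht) (by simp) (by simp [hc])
    simpa using this

/-- The integral of the kernel over the contour that comes from `+∞ - iπ` and goes to `+∞ + iπ`
along two half-lines and a vertical segment. -/
noncomputable def hankelValue (lam : ℝ) (ζ : ℂ) : ℂ :=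
  (∫ t in Set.Ioi (0 : ℝ), logKernel lam ζ (t + Real.pi * Complex.I)) -
    (∫ t in Set.Ioi (0 : ℝ), logKernel lam ζ (t + (-Real.pi : ℝ) * Complex.I)) +
    (∫ b in Set.Ioc (-Real.pi) Real.pi, logKernel lam ζ (b * Complex.I)) * Complex.I

theorem differentiable_hankelValue {lam : ℝ} (hlam : 0 ≤ lam) :
    Differentiable ℂ (hankelValue lam) := by
  refine ((differentiable_integral_logKernel hlam (by fun_prop) fun R hR =>
    integrableOn_exp_kernel_line hlam (by simp) hR).sub
    (differentiable_integral_logKernel hlam (by fun_prop) fun R hR =>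
    integrableOn_exp_kernel_line hlam (by simp) hR)).add
    ((differentiable_integral_logKernel hlam (by fun_prop) fun R hR => ?_).mul_const _)
  have : Continuous fun t : ℝ => Real.exp ((Complex.exp (t * Complex.I)).re +
      (lam / 2 * (‖(t * Complex.I : ℂ)‖ + R) ^ 2 + 2 * (‖(t * Complex.I : ℂ)‖ + R))) := by
    fun_prop
  exact (this.integrableOn_Icc (a := -Real.pi) (b := Real.pi)).mono_set Set.Ioc_subset_Icc_self

theorem exists_primitive_logKernel (lam : ℝ) (ζ : ℂ) :
    ∃ F : ℂ → ℂ, ∀ M, HasDerivAt F (logKernel lam ζ M) M := by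
  have : Differentiable ℂ (logKernel lam ζ) := by
    unfold logKernel; fun_prop
  obtain ⟨F, hF⟩ := this.isExactOn_univ
  exact ⟨F, fun M => hF M trivial⟩

/-- A primitive of the kernel has one and the same limit along all curves going to infinity
near the line `Im M = c`, `c = ±π`. -/
theorem tendsto_primitive_logKernel {lam : ℝ} (hlam : 0 ≤ lam) {ζ : ℂ} {F : ℂ → ℂ}
    (hF : ∀ M, HasDerivAt F (logKernel lam ζ M) M) {c : ℝ} (hc : Real.cos c = -1)
    {β : ℝ} (hβ : β < Real.pi / 2) {ι : Type*} {l : Filter ι} {M : ι → ℂ}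
    (hre : Tendsto (fun i => (M i).re) l atTop) (him : ∀ᶠ i in l, |(M i).im - c| ≤ β) :
    Tendsto (fun i => F (M i)) l (𝓝 (F (c * Complex.I) +
      ∫ t in Set.Ioi (0 : ℝ), logKernel lam ζ (t + c * Complex.I))) := by
  rcases l.eq_or_neBot with rfl | hl
  · exact tendsto_bot
  have hβ0 : 0 ≤ β := by
    obtain ⟨i, hi⟩ := him.exists
    exact (abs_nonneg _).trans hi
  obtain ⟨C, hC0, hC⟩ := exists_norm_logKernel_le hlam ζ hc hβ hβ0
  have hline : ∀ t : ℝ, HasDerivAt (fun t : ℝ => F (t + c * Complex.I))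
      (logKernel lam ζ (t + c * Complex.I)) t := by
    intro t
    have h1 : HasDerivAt (fun t : ℂ => t + c * Complex.I) 1 (t : ℂ) :=
      (hasDerivAt_id _).add_const _
    have h2 := (HasDerivAt.comp (t : ℂ) (hF (t + c * Complex.I)) h1).comp_ofReal
    simpa using h2
  have hcont : Continuous fun t : ℝ => logKernel lam ζ (t + c * Complex.I) := by
    unfold logKernel; fun_prop
  have hint : IntegrableOn (fun t : ℝ => logKernel lam ζ (t + c * Complex.I)) (Set.Ioi 0) := by
    refine Integrable.mono' ((integrableOn_exp_neg_Ioi 0).const_mul C)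
      hcont.aestronglyMeasurable ?_
    refine (ae_restrict_iff' measurableSet_Ioi).2 (Eventually.of_forall fun t ht => ?_)
    simpa using hC (t + c * Complex.I) (by simpa using le_of_lt ht) (by simpa using hβ0)
  have hlim1 : Tendsto (fun a : ℝ => F (a + c * Complex.I)) atTop (𝓝 (F (c * Complex.I) +
      ∫ t in Set.Ioi (0 : ℝ), logKernel lam ζ (t + c * Complex.I))) := by
    have h1 := (intervalIntegral_tendsto_integral_Ioi 0 hint tendsto_id).const_add
      (F (c * Complex.I))
    refine h1.congr fun a => ?_
    rw [id, intervalIntegral.integral_eq_sub_of_hasDerivAt (fun t _ => hline t)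
      (hcont.intervalIntegrable _ _)]
    simp
  have hlim2 : Tendsto (fun i => F (M i) - F ((M i).re + c * Complex.I)) l (𝓝 0) := by
    have hexp : Tendsto (fun i => C * Real.exp (-(M i).re) * β) l (𝓝 0) := by
      have := (Real.tendsto_exp_neg_atTop_nhds_zero.comp hre).const_mul C |>.mul_const β
      simpa using this
    refine squeeze_zero_norm' ?_ hexp
    filter_upwards [him, hre.eventually_ge_atTop 0] with i hi hi0
    set S : Set ℂ := {z | (M i).re ≤ z.re} ∩ {z | |z.im - c| ≤ β} with hS
    have hconv : Convex ℝ S := by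
      refine (convex_halfSpace_re_ge _).inter ?_
      have : {z : ℂ | |z.im - c| ≤ β} = {z | c - β ≤ z.im} ∩ {z | z.im ≤ c + β} := by
        ext z
        simp only [Set.mem_ofPred_eq, Set.mem_inter_iff, abs_le]
        constructor <;> rintro ⟨h1, h2⟩ <;> constructor <;> linarith
      rw [this]
      exact (convex_halfSpace_im_ge _).inter (convex_halfSpace_im_le _)
    have hle := hconv.norm_image_sub_le_of_norm_hasDerivWithin_le
      (f := F) (f' := logKernel lam ζ) (C := C * Real.exp (-(M i).re))
      (fun z _ => (hF z).hasDerivWithinAt) (fun z hz => by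
        refine (hC z (hi0.trans hz.1) hz.2).trans ?_
        have h3 : (M i).re ≤ z.re := hz.1
        gcongr)
      (x := (M i).re + c * Complex.I) (y := M i) (by simp [hS, hβ0]) ⟨le_refl (M i).re, hi⟩
    refine hle.trans ?_
    have h4 : M i - ((M i).re + c * Complex.I) = (((M i).im - c : ℝ) : ℂ) * Complex.I := by
      apply Complex.ext <;> simp
    rw [h4, norm_mul, Complex.norm_I, mul_one, Complex.norm_real]
    gcongr
    exact hi
  have := hlim2.add (hlim1.comp hre)
  simpa using this

/-- The difference of the limits of a primitive at `+∞ ± iπ` is the value of the contour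
integral. -/
theorem hankelValue_eq {lam : ℝ} {ζ : ℂ} {F : ℂ → ℂ}
    (hF : ∀ M, HasDerivAt F (logKernel lam ζ M) M) :
    hankelValue lam ζ =
      (F ((Real.pi : ℝ) * Complex.I) +
        ∫ t in Set.Ioi (0 : ℝ), logKernel lam ζ (t + (Real.pi : ℝ) * Complex.I)) -
      (F ((-Real.pi : ℝ) * Complex.I) +
        ∫ t in Set.Ioi (0 : ℝ), logKernel lam ζ (t + (-Real.pi : ℝ) * Complex.I)) := by
  have hline : ∀ b : ℝ, HasDerivAt (fun b : ℝ => F (b * Complex.I))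
      (logKernel lam ζ (b * Complex.I) * Complex.I) b := by
    intro b
    have h1 : HasDerivAt (fun b : ℂ => b * Complex.I) Complex.I (b : ℂ) := by
      simpa using (hasDerivAt_id (b : ℂ)).mul_const Complex.I
    exact (HasDerivAt.comp (b : ℂ) (hF (b * Complex.I)) h1).comp_ofReal
  have hcont : Continuous fun b : ℝ => logKernel lam ζ (b * Complex.I) * Complex.I := by
    unfold logKernel; fun_prop
  have h1 := intervalIntegral.integral_eq_sub_of_hasDerivAt (fun b _ => hline b)
    (hcont.intervalIntegrable (-Real.pi) Real.pi)
  rw [intervalIntegral.integral_mul_const, intervalIntegral.integral_of_le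
    (by linarith [Real.pi_pos])] at h1
  rw [hankelValue, h1]
  push_cast
  ring

theorem tendsto_log_add_const_atTop {a : ℝ} : Tendsto (fun s : ℝ => Real.log s + a) atTop atTop :=
  tendsto_atTop_add_const_right _ _ Real.tendsto_log_atTop

/-- The tails of a Hankel contour, where `dt/t = ds/s` on `t = s exp (± iπ)`. -/
theorem exists_hankel_end_bound {lam : ℝ} (hlam : 0 ≤ lam) (ζ : ℂ) {m θ : ℝ} (hm : 0 < m) {c : ℝ}
    (hc : Real.cos c = -1) (hθ : |θ| < Real.pi / 2) :
    ∃ C : ℝ, ∀ᶠ s : ℝ in atTop, ‖logKernel lam ζ (((Real.log s + Real.log m : ℝ) : ℂ) +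
      ((c + θ : ℝ) : ℂ) * Complex.I)‖ * s⁻¹ ≤ C * s ^ (-2 : ℝ) := by
  obtain ⟨C, hC, hb⟩ := exists_norm_logKernel_le hlam ζ hc hθ (abs_nonneg _)
  refine ⟨C * m⁻¹, ?_⟩
  filter_upwards [eventually_gt_atTop 0,
    (tendsto_log_add_const_atTop (a := Real.log m)).eventually_ge_atTop 0]
    with s hs hs0
  have := hb (((Real.log s + Real.log m : ℝ) : ℂ) + ((c + θ : ℝ) : ℂ) * Complex.I)
    (by simpa using hs0) (by simp)
  have hre : (((Real.log s + Real.log m : ℝ) : ℂ) + ((c + θ : ℝ) : ℂ) * Complex.I).re =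
    Real.log s + Real.log m := by simp
  have hexplog : Real.exp (-(Real.log s + Real.log m)) = s⁻¹ * m⁻¹ := by
    rw [neg_add, Real.exp_add, Real.exp_neg, Real.exp_neg, Real.exp_log hs, Real.exp_log hm]
  rw [hre, hexplog] at this
  rw [Real.rpow_neg hs.le, Real.rpow_two]
  calc _ ≤ C * (s⁻¹ * m⁻¹) * s⁻¹ := by gcongr
    _ = _ := by ring

theorem integrableOn_abs_rpow_Iio :
    IntegrableOn (fun s : ℝ => |s| ^ (-2 : ℝ)) (Set.Iio (-1)) := by
  have h : IntegrableOn (fun s : ℝ => |s| ^ (-2 : ℝ)) (Set.Ioi 1) := by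
    refine (integrableOn_Ioi_rpow_of_lt (by norm_num : (-2 : ℝ) < -1) one_pos).congr_fun
      (fun s hs => ?_) measurableSet_Ioi
    have hs' : (0 : ℝ) < s := lt_trans one_pos hs
    simp only [abs_of_pos hs']
  have h' : IntegrableOn (fun s : ℝ => |s| ^ (-2 : ℝ)) (Set.Ioi (-(-1))) := by rwa [neg_neg]
  have h2 := h'.comp_neg_Iio
  simpa only [abs_neg] using h2

/-- Every Hankel contour gives the same value, since along it `M = L + ζ` goes to infinity along
`Im M = arg x ± π`. -/
theorem hankelContour_integral {lam : ℝ} (hlam : 0 ≤ lam) {L : ℝ → ℂ} (hL : IsHankelContour L)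
    (x : LogSurface) (hx : |x.arg| < Real.pi / 2) :
    Integrable (hankelIntegrand lam x.toComplex L) ∧
      hankelValue lam (Real.log x.modulus + x.arg * Complex.I) =
        ∫ s : ℝ, hankelIntegrand lam x.toComplex L s := by
  set ζ : ℂ := Real.log x.modulus + x.arg * Complex.I with hζ
  obtain ⟨R, hR, hneg, hpos⟩ := hL.ends
  have hdiff : Differentiable ℝ L := hL.contDiff.differentiable one_ne_zero
  have heq : ∀ s, hankelIntegrand lam x.toComplex L s = logKernel lam ζ (L s + ζ) * deriv L s := by
    intro s
    rw [hankelIntegrand, x.toComplex_eq_exp, ← hζ, logKernel, add_sub_cancel_right,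
      Complex.exp_add, Complex.exp_add (Complex.exp (L s + ζ) + _), Complex.exp_add (Complex.exp _),
      Complex.exp_add (L s)]
    ring_nf
  have hcont : Continuous (hankelIntegrand lam x.toComplex L) := by
    have h1 : Continuous (deriv L) := hL.contDiff.continuous_deriv le_rfl
    have h2 : Continuous L := hdiff.continuous
    unfold hankelIntegrand
    fun_prop
  have hposL : ∀ s, R ≤ s → L s + ζ = ((Real.log s + Real.log x.modulus : ℝ) : ℂ) +
      ((Real.pi + x.arg : ℝ) : ℂ) * Complex.I := by
    intro s hs
    rw [hpos s hs, hζ]; push_cast; ring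
  have hnegL : ∀ s, s ≤ -R → L s + ζ = ((Real.log (-s) + Real.log x.modulus : ℝ) : ℂ) +
      ((-Real.pi + x.arg : ℝ) : ℂ) * Complex.I := by
    intro s hs
    rw [hneg s hs, hζ]; push_cast; ring
  have hposD : ∀ s, R < s → deriv L s = ((s⁻¹ : ℝ) : ℂ) := by
    intro s hs
    have h1 : L =ᶠ[𝓝 s] fun s => (Real.log s : ℂ) + (Real.pi : ℂ) * Complex.I := by
      filter_upwards [Ioi_mem_nhds hs] with t ht using hpos t (le_of_lt ht)
    rw [h1.deriv_eq]
    exact ((Real.hasDerivAt_log (hR.trans hs).ne').ofReal_comp.add_const _).deriv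
  have hnegD : ∀ s, s < -R → deriv L s = ((s⁻¹ : ℝ) : ℂ) := by
    intro s hs
    have h1 : L =ᶠ[𝓝 s] fun s => (Real.log s : ℂ) - (Real.pi : ℂ) * Complex.I := by
      filter_upwards [Iio_mem_nhds hs] with t ht
      rw [hneg t (le_of_lt ht), Real.log_neg_eq_log]
    rw [h1.deriv_eq]
    exact ((Real.hasDerivAt_log (by linarith : s < 0).ne).ofReal_comp.sub_const _).deriv
  obtain ⟨C₁, hb₁⟩ := exists_hankel_end_bound hlam ζ x.modulus_pos Real.cos_pi hx
  obtain ⟨C₂, hb₂⟩ := exists_hankel_end_bound hlam ζ x.modulus_pos (c := -Real.pi) (by simp) hx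
  have hint : Integrable (hankelIntegrand lam x.toComplex L) := by
    have hO₁ : hankelIntegrand lam x.toComplex L =O[atTop] fun s : ℝ => s ^ (-2 : ℝ) := by
      refine Asymptotics.IsBigO.of_bound C₁ ?_
      filter_upwards [eventually_gt_atTop R, hb₁] with s hs hs1
      have hs' : 0 < s := hR.trans hs
      rw [heq, norm_mul, hposL s hs.le, hposD s hs, Complex.norm_real,
        Real.norm_of_nonneg (inv_pos.2 hs').le, Real.norm_of_nonneg (Real.rpow_nonneg hs'.le _)]
      exact hs1
    have hO₂ : hankelIntegrand lam x.toComplex L =O[atBot] fun s : ℝ => |s| ^ (-2 : ℝ) := by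
      refine Asymptotics.IsBigO.of_bound C₂ ?_
      filter_upwards [eventually_lt_atBot (-R), tendsto_neg_atBot_atTop.eventually hb₂]
        with s hs hs1
      have hs' : 0 < -s := by linarith
      rw [heq, norm_mul, hnegL s hs.le, hnegD s hs, Complex.norm_real, norm_inv, Real.norm_eq_abs,
        abs_of_neg (by linarith : s < 0), Real.norm_of_nonneg (Real.rpow_nonneg hs'.le _)]
      exact hs1
    have hI : IntegrableOn (fun s : ℝ => s ^ (-2 : ℝ)) (Set.Ioi 1) :=
      integrableOn_Ioi_rpow_of_lt (by norm_num) one_pos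
    exact (hcont.locallyIntegrable).integrable_of_isBigO_atBot_atTop hO₂
      ⟨Set.Iio (-1), Iio_mem_atBot (-1), integrableOn_abs_rpow_Iio⟩ hO₁
      ⟨Set.Ioi 1, Ioi_mem_atTop 1, hI⟩
  refine ⟨hint, ?_⟩
  obtain ⟨F, hF⟩ := exists_primitive_logKernel lam ζ
  have hderiv : ∀ s, HasDerivAt (fun s => F (L s + ζ)) (hankelIntegrand lam x.toComplex L s) s := by
    intro s
    rw [heq]
    exact (hF (L s + ζ)).comp_of_eq s ((hdiff s).hasDerivAt.add_const ζ) rfl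
  rw [hankelValue_eq hF]
  refine (integral_of_hasDerivAt_of_tendsto hderiv hint ?_ ?_).symm
  · refine tendsto_primitive_logKernel hlam hF (c := -Real.pi) (by simp) hx ?_ ?_
    · refine ((tendsto_log_add_const_atTop (a := Real.log x.modulus)).comp
        tendsto_neg_atBot_atTop).congr' ?_
      filter_upwards [eventually_le_atBot (-R)] with s hs
      rw [hnegL s hs]; simp
    · filter_upwards [eventually_le_atBot (-R)] with s hs
      rw [hnegL s hs]; simp
  · refine tendsto_primitive_logKernel hlam hF Real.cos_pi hx ?_ ?_
    · refine (tendsto_log_add_const_atTop (a := Real.log x.modulus)).congr' ?_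
      filter_upwards [eventually_ge_atTop R] with s hs
      rw [hposL s hs]; simp
    · filter_upwards [eventually_ge_atTop R] with s hs
      rw [hposL s hs]; simp

/-! ### Expansion of an analytic function in powers of a chart -/

/-- The successive remainders of the expansion of `f` in powers of the chart `σ = s κ(s)`:
`f = ∑_{n < k} c_n σ ^ n + σ ^ k * chartRemainder κ f k` with `c_n = chartRemainder κ f n 0`. -/
noncomputable def chartRemainder (κ f : ℂ → ℂ) : ℕ → ℂ → ℂ
  | 0 => f
  | k + 1 => fun s => dslope (chartRemainder κ f k) 0 s / κ s

section Chart

variable {κ f : ℂ → ℂ} {U : Set ℂ}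

theorem differentiableOn_chartRemainder (hU : U ∈ 𝓝 (0 : ℂ)) (hκ : DifferentiableOn ℂ κ U)
    (hκ0 : ∀ s ∈ U, κ s ≠ 0) (hf : DifferentiableOn ℂ f U) (k : ℕ) :
    DifferentiableOn ℂ (chartRemainder κ f k) U := by
  induction k with
  | zero => exact hf
  | succ k ih => exact ((Complex.differentiableOn_dslope hU).2 ih).div hκ hκ0

theorem chartRemainder_eq (hκ0 : ∀ s ∈ U, κ s ≠ 0) (k : ℕ) {s : ℂ} (hs : s ∈ U) :
    chartRemainder κ f k s =
      chartRemainder κ f k 0 + s * κ s * chartRemainder κ f (k + 1) s := by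
  have h := sub_smul_dslope (chartRemainder κ f k) 0 s
  have h0 := hκ0 s hs
  simp only [sub_zero, smul_eq_mul] at h
  rw [chartRemainder]
  field_simp
  linear_combination -h

theorem chart_expansion (hκ0 : ∀ s ∈ U, κ s ≠ 0) (k : ℕ) {s : ℂ} (hs : s ∈ U) :
    f s = ∑ n ∈ Finset.range k, chartRemainder κ f n 0 * (s * κ s) ^ n +
      (s * κ s) ^ k * chartRemainder κ f k s := by
  induction k with
  | zero => simp [chartRemainder]
  | succ k ih =>
    rw [Finset.sum_range_succ]
    rw [ih, chartRemainder_eq (f := f) hκ0 k hs]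
    ring

/-- The coefficients of the chart expansion are the Taylor coefficients of `f ∘ σ⁻¹`. -/
theorem chartRemainder_zero_eq (hU : U ∈ 𝓝 (0 : ℂ)) (hκ : DifferentiableOn ℂ κ U)
    (hκ0 : ∀ s ∈ U, κ s ≠ 0) {V : ℂ → ℂ} (hV : AnalyticAt ℂ V 0)
    (hVf : ∀ᶠ s in 𝓝 (0 : ℂ), V (s * κ s) = f s) (n : ℕ) :
    chartRemainder κ f n 0 = iteratedDeriv n V 0 / (n.factorial : ℂ) := by
  have hps := hV.hasFPowerSeriesAt
  have hit := fun n => hps.has_fpower_series_iterate_dslope_fslope n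
  have h0U : (0 : ℂ) ∈ U := mem_of_mem_nhds hU
  have hσ : HasDerivAt (fun s => s * κ s) (κ 0) 0 := by
    have h1 := (hasDerivAt_id' (0 : ℂ)).fun_mul (hκ.differentiableAt hU).hasDerivAt
    simpa using h1
  have hκe : ∀ᶠ s in 𝓝 (0 : ℂ), κ s ≠ 0 := by
    filter_upwards [hU] with s hs using hκ0 s hs
  have key : ∀ n, ∀ᶠ s in 𝓝 (0 : ℂ),
      ((Function.swap dslope 0)^[n] V) (s * κ s) = chartRemainder κ f n s := by
    intro n
    induction n with
    | zero => exact hVf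
    | succ n ih =>
      have h0 := ih.self_of_nhds
      filter_upwards [ih, hκe] with s hs hκs
      rw [Function.iterate_succ_apply']
      set W := (Function.swap dslope 0)^[n] V with hW
      change dslope W 0 (s * κ s) = dslope (chartRemainder κ f n) 0 s / κ s
      rcases eq_or_ne s 0 with rfl | hs0
      · rw [zero_mul, dslope_same, dslope_same]
        have hWd : HasDerivAt W (deriv W 0) ((0 : ℂ) * κ 0) := by
          rw [zero_mul]
          exact (hit n).differentiableAt.hasDerivAt
        have h1 := (hWd.comp (0 : ℂ) hσ).congr_of_eventuallyEq (EventuallyEq.symm ih)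
        rw [h1.deriv]
        field_simp
      · rw [dslope_of_ne _ (mul_ne_zero hs0 hκs), dslope_of_ne _ hs0, slope_def_field,
          slope_def_field, hs]
        rw [zero_mul] at h0
        rw [h0]
        field_simp
        simp only [sub_zero]
        ring
  have h1 := (key n).self_of_nhds
  rw [zero_mul] at h1
  rw [← h1, ← (hit n).coeff_zero 1, ← FormalMultilinearSeries.coeff,
    FormalMultilinearSeries.coeff_iterate_fslope, zero_add, FormalMultilinearSeries.coeff_ofScalars]

variable {ρ m : ℝ}

/-- Cauchy's estimate in the chart `σ`; injectivity of `σ` is not needed, because the coefficients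
are the integrals of `f σ' / σ ^ (n + 1)` over a circle in the `s`-plane. -/
theorem exists_norm_chartRemainder_zero_le (hUo : IsOpen U) (hρ : 0 < ρ)
    (hUρ : Metric.closedBall (0 : ℂ) ρ ⊆ U) (hκ : DifferentiableOn ℂ κ U)
    (hκ0 : ∀ s ∈ U, κ s ≠ 0) (hf : DifferentiableOn ℂ f U) (hm : 0 < m)
    (hσm : ∀ s ∈ Metric.sphere (0 : ℂ) ρ, m ≤ ‖s * κ s‖) :
    ∃ C : ℝ, 0 < C ∧ ∀ n, ‖chartRemainder κ f n 0‖ ≤ C / m ^ n := by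
  have h0U : (0 : ℂ) ∈ U := hUρ (Metric.mem_closedBall_self hρ.le)
  have hsph : Metric.sphere (0 : ℂ) ρ ⊆ U := Metric.sphere_subset_closedBall.trans hUρ
  have hs0 : ∀ s ∈ Metric.sphere (0 : ℂ) ρ, s ≠ 0 := by
    rintro s hs rfl
    simp at hs
    exact hρ.ne hs
  set σ : ℂ → ℂ := fun s => s * κ s with hσdef
  have hσ : DifferentiableOn ℂ σ U := differentiableOn_id.mul hκ
  have hσd : ∀ s ∈ U, HasDerivAt σ (deriv σ s) s := fun s hs =>
    (hσ.differentiableAt (hUo.mem_nhds hs)).hasDerivAt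
  have hσ' : DifferentiableOn ℂ (deriv σ) U := hσ.deriv hUo
  have hσ0 : ∀ s ∈ Metric.sphere (0 : ℂ) ρ, σ s ≠ 0 := fun s hs =>
    mul_ne_zero (hs0 s hs) (hκ0 s (hsph hs))
  have hdR := differentiableOn_chartRemainder (hUo.mem_nhds h0U) hκ hκ0 hf
  set c : ℕ → ℂ := fun n => chartRemainder κ f n 0 with hc
  have hcontσ : ContinuousOn σ (Metric.sphere 0 ρ) := hσ.continuousOn.mono hsph
  have hcontσ' : ContinuousOn (deriv σ) (Metric.sphere 0 ρ) := hσ'.continuousOn.mono hsph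
  have hlog : (∮ s in C(0, ρ), deriv σ s / σ s) = 2 * Real.pi * Complex.I := by
    have h1 : ∀ s ∈ Metric.sphere (0 : ℂ) ρ, deriv σ s / σ s = (s - 0)⁻¹ + deriv κ s / κ s := by
      intro s hs
      have h2 := (hasDerivAt_id s).mul
        (hκ.differentiableAt (hUo.mem_nhds (hsph hs))).hasDerivAt
      have h3 : deriv σ s = κ s + s * deriv κ s := by
        have h4 : HasDerivAt σ (1 * κ s + id s * deriv κ s) s := h2
        rw [h4.deriv]; simp
      rw [h3]
      have := hs0 s hs
      have := hκ0 s (hsph hs)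
      simp only [hσdef, sub_zero]
      field_simp
    rw [circleIntegral.integral_congr hρ.le h1]
    have hdl : DifferentiableOn ℂ (fun s => deriv κ s / κ s) U := (hκ.deriv hUo).div hκ hκ0
    rw [circleIntegral.integral_add, circleIntegral.integral_sub_center_inv _ hρ.ne',
      DiffContOnCl.circleIntegral_eq_zero hρ.le (hdl.diffContOnCl_ball hUρ), add_zero]
    · exact circleIntegrable_sub_inv_iff.2 (Or.inr (by simpa [abs_of_pos hρ] using hρ.ne))
    · exact (hdl.continuousOn.mono hsph).circleIntegrable hρ.le
  have hpow : ∀ j : ℕ, (∮ s in C(0, ρ), deriv σ s / σ s ^ (j + 2)) = 0 := by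
    intro j
    refine circleIntegral.integral_eq_zero_of_hasDerivWithinAt
      (f := fun s => -((j + 1 : ℂ))⁻¹ * (σ s ^ (j + 1))⁻¹) hρ.le fun s hs => ?_
    have h1 := (((hσd s (hsph hs)).pow (j + 1)).inv (pow_ne_zero _ (hσ0 s hs))).const_mul
      (-((j + 1 : ℂ))⁻¹)
    refine (HasDerivAt.hasDerivWithinAt (HasDerivAt.congr_deriv h1 ?_))
    have := hσ0 s hs
    have : (j + 1 : ℂ) ≠ 0 := by exact_mod_cast Nat.succ_ne_zero j
    simp only [Pi.pow_apply, Nat.add_sub_cancel]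
    field_simp
    push_cast
    ring
  have hcauchy : ∀ n, (∮ s in C(0, ρ), f s * deriv σ s / σ s ^ (n + 1)) =
      2 * Real.pi * Complex.I * c n := by
    intro n
    have h1 : ∀ s ∈ Metric.sphere (0 : ℂ) ρ, f s * deriv σ s / σ s ^ (n + 1) =
        (∑ k ∈ Finset.range n, c k * (deriv σ s / σ s ^ ((n - 1 - k) + 2)) +
          c n * (deriv σ s / σ s)) + chartRemainder κ f (n + 1) s * deriv σ s := by
      intro s hs
      have h0 := hσ0 s hs
      have h2 := chart_expansion (f := f) hκ0 (n + 1) (hsph hs)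
      rw [Finset.sum_range_succ] at h2
      change f s = (∑ k ∈ Finset.range n, c k * σ s ^ k + c n * σ s ^ n) +
        σ s ^ (n + 1) * chartRemainder κ f (n + 1) s at h2
      rw [h2, add_mul, add_mul, add_div, add_div, Finset.sum_mul, Finset.sum_div]
      congr 1
      · congr 1
        · refine Finset.sum_congr rfl fun k hk => ?_
          have hk' := Finset.mem_range.1 hk
          have h3 : n + 1 = k + ((n - 1 - k) + 2) := by omega
          rw [h3, pow_add]
          have : k + (n - 1 - k + 2) - 1 - 1 - k = n - 1 - k := by omega
          field_simp
        · field_simp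
          ring
      · field_simp
    rw [circleIntegral.integral_congr hρ.le h1]
    have hi1 : ∀ k ∈ Finset.range n, CircleIntegrable
        (fun s => c k * (deriv σ s / σ s ^ ((n - 1 - k) + 2))) 0 ρ := fun k _ =>
      (continuousOn_const.mul (hcontσ'.div (hcontσ.pow _) fun s hs =>
        pow_ne_zero _ (hσ0 s hs))).circleIntegrable hρ.le
    have hi2 : CircleIntegrable (fun s => c n * (deriv σ s / σ s)) 0 ρ :=
      (continuousOn_const.mul (hcontσ'.div hcontσ hσ0)).circleIntegrable hρ.le
    have hd3 : DifferentiableOn ℂ (fun s => chartRemainder κ f (n + 1) s * deriv σ s) U :=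
      (hdR (n + 1)).mul hσ'
    have hi12 : CircleIntegrable (fun s => ∑ k ∈ Finset.range n,
        c k * (deriv σ s / σ s ^ ((n - 1 - k) + 2)) + c n * (deriv σ s / σ s)) 0 ρ :=
      ((continuousOn_finsetSum _ fun k _ => continuousOn_const.mul (hcontσ'.div (hcontσ.pow _)
        fun s hs => pow_ne_zero _ (hσ0 s hs))).add
        (continuousOn_const.mul (hcontσ'.div hcontσ hσ0))).circleIntegrable hρ.le
    have hi1' : CircleIntegrable (fun s => ∑ k ∈ Finset.range n,
        c k * (deriv σ s / σ s ^ ((n - 1 - k) + 2))) 0 ρ := by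
      have := CircleIntegrable.sum (Finset.range n) hi1
      convert this using 1
      ext s; simp
    rw [circleIntegral.integral_add hi12
      ((hd3.continuousOn.mono hsph).circleIntegrable hρ.le),
      circleIntegral.integral_add hi1' hi2, circleIntegral.integral_fun_sum hi1,
      DiffContOnCl.circleIntegral_eq_zero hρ.le (hd3.diffContOnCl_ball hUρ)]
    simp only [circleIntegral.integral_const_mul, hlog, hpow, mul_zero, Finset.sum_const_zero,
      zero_add, add_zero]
    ring
  obtain ⟨K, hK⟩ := (isCompact_sphere (0 : ℂ) ρ).exists_bound_of_continuousOn
    (((hf.continuousOn.mono hsph).mul hcontσ'))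
  have hK0 : 0 ≤ K := by
    have hmem : (ρ : ℂ) ∈ Metric.sphere (0 : ℂ) ρ := by simp [hρ.le]
    exact (norm_nonneg _).trans (hK _ hmem)
  refine ⟨ρ * (K / m) + 1, by positivity, fun n => ?_⟩
  have hle := circleIntegral.norm_two_pi_i_inv_smul_integral_le_of_norm_le_const
    (f := fun s => f s * deriv σ s / σ s ^ (n + 1)) (c := 0) (C := K / m ^ (n + 1)) hρ.le
    (fun s hs => by
      rw [norm_div, norm_pow]
      have := hK s hs
      have := hσm s hs
      gcongr
      all_goals assumption)
  rw [hcauchy, smul_eq_mul, inv_mul_cancel_left₀ Complex.two_pi_I_ne_zero] at hle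
  refine hle.trans ?_
  rw [le_div_iff₀ (by positivity), pow_succ]
  have : ρ * (K / (m ^ n * m)) * m ^ n = ρ * (K / m) := by field_simp
  linarith

/-- The remainders of the chart expansion, estimated by the maximum principle. -/
theorem exists_norm_chartRemainder_le (hUo : IsOpen U) (hρ : 0 < ρ)
    (hUρ : Metric.closedBall (0 : ℂ) ρ ⊆ U) (hκ : DifferentiableOn ℂ κ U)
    (hκ0 : ∀ s ∈ U, κ s ≠ 0) (hf : DifferentiableOn ℂ f U) (hm : 0 < m)
    (hσm : ∀ s ∈ Metric.sphere (0 : ℂ) ρ, m ≤ ‖s * κ s‖) :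
    ∃ C : ℝ, 0 < C ∧ ∀ n, ‖chartRemainder κ f n 0‖ ≤ C / m ^ n ∧
      ∀ s ∈ Metric.closedBall (0 : ℂ) ρ, ‖chartRemainder κ f n s‖ ≤ C * (n + 1) / m ^ n := by
  obtain ⟨C, hC0, hC⟩ := exists_norm_chartRemainder_zero_le hUo hρ hUρ hκ hκ0 hf hm hσm
  have h0U : (0 : ℂ) ∈ U := hUρ (Metric.mem_closedBall_self hρ.le)
  have hsph : Metric.sphere (0 : ℂ) ρ ⊆ U := Metric.sphere_subset_closedBall.trans hUρ
  obtain ⟨K, hK⟩ := (isCompact_sphere (0 : ℂ) ρ).exists_bound_of_continuousOn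
    (hf.continuousOn.mono hsph)
  have hmem : (ρ : ℂ) ∈ Metric.sphere (0 : ℂ) ρ := by simp [hρ.le]
  have hK0 : 0 ≤ K := (norm_nonneg _).trans (hK _ hmem)
  have hdR := differentiableOn_chartRemainder (hUo.mem_nhds h0U) hκ hκ0 hf
  refine ⟨C + K, by positivity, fun n => ⟨(hC n).trans (by gcongr; linarith), fun s hs => ?_⟩⟩
  refine Complex.norm_le_of_forall_mem_frontier_norm_le Metric.isBounded_ball
    ((hdR n).diffContOnCl_ball hUρ) (fun z hz => ?_) (by rwa [closure_ball _ hρ.ne'])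
  rw [frontier_ball _ hρ.ne'] at hz
  have hb := hσm z hz
  have hb0 : 0 < ‖z * κ z‖ := hm.trans_le hb
  have he := chart_expansion (f := f) hκ0 n (hsph hz)
  set τ := z * κ z with hτ
  have h1 : ‖τ‖ ^ n * ‖chartRemainder κ f n z‖ ≤ K + ∑ k ∈ Finset.range n, C / m ^ k * ‖τ‖ ^ k := by
    have h2 : τ ^ n * chartRemainder κ f n z =
        f z - ∑ k ∈ Finset.range n, chartRemainder κ f k 0 * τ ^ k := by
      rw [he]; ring
    rw [← norm_pow, ← norm_mul, h2]
    refine (norm_sub_le _ _).trans (add_le_add (hK z hz) ((norm_sum_le _ _).trans ?_))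
    refine Finset.sum_le_sum fun k _ => ?_
    rw [norm_mul, norm_pow]
    gcongr
    exact hC k
  have hr : 1 ≤ ‖τ‖ / m := by rwa [one_le_div hm]
  have h3 : K + ∑ k ∈ Finset.range n, C / m ^ k * ‖τ‖ ^ k ≤ (C + K) * (n + 1) * (‖τ‖ / m) ^ n := by
    have h4 : ∑ k ∈ Finset.range n, C / m ^ k * ‖τ‖ ^ k ≤
        ∑ _k ∈ Finset.range n, C * (‖τ‖ / m) ^ n := by
      refine Finset.sum_le_sum fun k hk => ?_
      have h5 : C / m ^ k * ‖τ‖ ^ k = C * (‖τ‖ / m) ^ k := by rw [div_pow]; ring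
      rw [h5]
      have := pow_le_pow_right₀ hr (Finset.mem_range.1 hk).le
      gcongr
    rw [Finset.sum_const, Finset.card_range, nsmul_eq_mul] at h4
    have h6 : 1 ≤ (‖τ‖ / m) ^ n := one_le_pow₀ hr
    have h7 : (0 : ℝ) ≤ n := Nat.cast_nonneg n
    nlinarith [mul_nonneg hK0 h7, mul_le_mul_of_nonneg_left h6 hK0,
      mul_nonneg (mul_nonneg hK0 h7) (zero_le_one.trans h6),
      mul_nonneg hC0.le (zero_le_one.trans h6)]
  have h8 := h1.trans h3
  rw [div_pow] at h8
  have h9 : 0 < ‖τ‖ ^ n := pow_pos hb0 n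
  have h10 : ‖τ‖ ^ n * ‖chartRemainder κ f n z‖ ≤ ‖τ‖ ^ n * ((C + K) * (n + 1) / m ^ n) := by
    refine h8.trans (le_of_eq ?_); ring
  exact le_of_mul_le_mul_left h10 h9

end Chart

/-! ### The saddle chart `σ(s)² = 2 (exp s - 1 - s)` and the germ `ℓ` -/

/-- `2 (exp s - 1 - s) / s²`, with its value `1` at the origin. -/
noncomputable def gapQuot (s : ℂ) : ℂ := 2 * dslope (dslope Complex.exp 0) 0 s

theorem gapQuot_mul_sq (s : ℂ) : s ^ 2 * gapQuot s = 2 * (Complex.exp s - 1 - s) := by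
  have h1 := sub_smul_dslope Complex.exp 0 s
  have h2 := sub_smul_dslope (dslope Complex.exp 0) 0 s
  simp only [sub_zero, smul_eq_mul, dslope_same, Complex.deriv_exp, Complex.exp_zero] at h1 h2
  rw [gapQuot]
  linear_combination 2 * s * h2 + 2 * h1

theorem differentiable_gapQuot : Differentiable ℂ gapQuot := by
  have h : Differentiable ℂ (dslope (dslope Complex.exp 0) 0) := by
    rw [← differentiableOn_univ, Complex.differentiableOn_dslope univ_mem,
      Complex.differentiableOn_dslope univ_mem, differentiableOn_univ]
    exact Complex.differentiable_exp
  exact h.const_mul 2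

theorem gapQuot_zero : gapQuot 0 = 1 := by
  have h1 : AnalyticAt ℂ Complex.exp 0 := Complex.differentiable_exp.analyticAt 0
  have h2 := h1.hasFPowerSeriesAt.has_fpower_series_iterate_dslope_fslope 2
  have h3 := h2.coeff_zero 1
  rw [← FormalMultilinearSeries.coeff, FormalMultilinearSeries.coeff_iterate_fslope,
    FormalMultilinearSeries.coeff_ofScalars, iteratedDeriv_eq_iterate, Complex.iter_deriv_exp] at h3
  have h4 : (Function.swap dslope 0)^[2] Complex.exp 0 = dslope (dslope Complex.exp 0) 0 0 := rfl
  rw [gapQuot, ← h4, ← h3]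
  norm_num [Nat.factorial]

/-- This makes `|gapQuot s - 1| < 1` on the disc of radius `13/10`, so that the principal square
root of `gapQuot` is holomorphic there. -/
theorem exp_lt_quadratic {r : ℝ} (h0 : 0 < r) (h1 : r < 13 / 10) :
    Real.exp r < 1 + r + r ^ 2 := by
  set x := r / 2 with hx
  have hx0 : 0 < x := by positivity
  have hx1 : x < 13 / 20 := by rw [hx]; linarith
  have h2 : Real.exp x ≤ 1 + x + x ^ 2 / 2 + x ^ 3 * (2 / 9) := by
    have := Real.exp_bound' hx0.le (by linarith) (n := 3) (by norm_num)
    simp only [Finset.sum_range_succ, Finset.sum_range_zero, Nat.factorial] at this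
    norm_num at this
    linarith
  have h3 : Real.exp r = Real.exp x ^ 2 := by
    rw [← Real.exp_nat_mul]; congr 1; rw [hx]; push_cast; ring
  have h4 : Real.exp x ^ 2 ≤ (1 + x + x ^ 2 / 2 + x ^ 3 * (2 / 9)) ^ 2 :=
    pow_le_pow_left₀ (Real.exp_pos _).le h2 2
  have h5 : r = 2 * x := by rw [hx]; ring
  rw [h3, h5]
  refine h4.trans_lt ?_
  have hb : 13 / 9 * x + 25 / 36 * x ^ 2 + 2 / 9 * x ^ 3 + 4 / 81 * x ^ 4 < 2 := by
    have h6 : x ^ 2 ≤ (13 / 20) ^ 2 := by gcongr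
    have h7 : x ^ 3 ≤ (13 / 20) ^ 3 := by gcongr
    have h8 : x ^ 4 ≤ (13 / 20) ^ 4 := by gcongr
    norm_num at h6 h7 h8
    linarith
  nlinarith [mul_lt_mul_of_pos_left hb (pow_pos hx0 2)]

theorem norm_exp_sub_quadratic_le (s : ℂ) :
    ‖Complex.exp s - 1 - s - s ^ 2 / 2‖ ≤ Real.exp ‖s‖ - 1 - ‖s‖ - ‖s‖ ^ 2 / 2 := by
  have := Complex.norm_exp_sub_sum_le_exp_norm_sub_sum s 3
  simp only [Finset.sum_range_succ, Finset.sum_range_zero, Nat.factorial] at this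
  norm_num at this
  have h : Complex.exp s - 1 - s - s ^ 2 / 2 = Complex.exp s - (1 + s + s ^ 2 / 2) := by ring
  rw [h]; linarith

theorem gapQuot_re_pos {s : ℂ} (hs : ‖s‖ < 13 / 10) : 0 < (gapQuot s).re := by
  rcases eq_or_ne s 0 with rfl | hs0
  · simp [gapQuot_zero]
  have hr : 0 < ‖s‖ := norm_pos_iff.2 hs0
  have h1 : s ^ 2 * (gapQuot s - 1) = 2 * (Complex.exp s - 1 - s - s ^ 2 / 2) := by
    rw [mul_sub, gapQuot_mul_sq]; ring
  have h2 : ‖s‖ ^ 2 * ‖gapQuot s - 1‖ < ‖s‖ ^ 2 * 1 := by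
    rw [← norm_pow, ← norm_mul, h1, norm_mul, norm_pow]
    have := norm_exp_sub_quadratic_le s
    have := exp_lt_quadratic hr hs
    simp only [Complex.norm_ofNat]
    linarith
  have h3 : ‖gapQuot s - 1‖ < 1 := lt_of_mul_lt_mul_left h2 (by positivity)
  have h4 := (abs_le.1 (Complex.abs_re_le_norm (gapQuot s - 1))).1
  simp at h4
  linarith

/-- Principal square roots have positive real part. -/
theorem cpow_half_re_pos {z : ℂ} (hz : z ∈ Complex.slitPlane) : 0 < (z ^ (1 / 2 : ℂ)).re := by
  rw [Complex.cpow_def_of_ne_zero (Complex.slitPlane_ne_zero hz), Complex.exp_re]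
  apply mul_pos (Real.exp_pos _)
  have h1 : (Complex.log z * (1 / 2)).im = z.arg / 2 := by
    have : (1 / 2 : ℂ) = ((1 / 2 : ℝ) : ℂ) := by push_cast; ring
    rw [this, Complex.im_mul_ofReal, Complex.log_im]; ring
  rw [h1]
  have h2 := Complex.neg_pi_lt_arg z
  have h3 : z.arg < Real.pi := lt_of_le_of_ne (Complex.arg_le_pi z)
    (Complex.mem_slitPlane_iff_arg.1 hz).1
  exact Real.cos_pos_of_mem_Ioo ⟨by linarith, by linarith⟩

theorem cpow_half_sq (z : ℂ) : (z ^ (1 / 2 : ℂ)) ^ 2 = z := by simp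

/-- The factor `κ` of the saddle chart `σ(s) = s κ(s)`, where `σ(s)² = 2 (exp s - 1 - s)` and
`κ(0) = -1`. -/
noncomputable def saddleFactor (s : ℂ) : ℂ := -gapQuot s ^ (1 / 2 : ℂ)

/-- The disc on which the saddle chart is used. -/
def saddleDisc : Set ℂ := Metric.ball 0 (13 / 10)

theorem isOpen_saddleDisc : IsOpen saddleDisc := Metric.isOpen_ball

theorem saddleDisc_mem_nhds : saddleDisc ∈ 𝓝 (0 : ℂ) := Metric.ball_mem_nhds _ (by norm_num)

theorem norm_lt_of_mem_saddleDisc {s : ℂ} (hs : s ∈ saddleDisc) : ‖s‖ < 13 / 10 := by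
  simpa [saddleDisc] using hs

theorem gapQuot_mem_slitPlane {s : ℂ} (hs : s ∈ saddleDisc) : gapQuot s ∈ Complex.slitPlane :=
  Or.inl (gapQuot_re_pos (norm_lt_of_mem_saddleDisc hs))

theorem differentiableOn_saddleFactor : DifferentiableOn ℂ saddleFactor saddleDisc :=
  (differentiable_gapQuot.differentiableOn.cpow (differentiableOn_const _)
    fun _ hs => gapQuot_mem_slitPlane hs).neg

theorem saddleFactor_ne_zero : ∀ s ∈ saddleDisc, saddleFactor s ≠ 0 := by
  intro s hs h
  have h1 := cpow_half_re_pos (gapQuot_mem_slitPlane hs)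
  rw [saddleFactor, neg_eq_zero] at h
  rw [h] at h1
  simp at h1

/-- The saddle chart. -/
noncomputable def saddleChart (s : ℂ) : ℂ := s * saddleFactor s

theorem saddleChart_sq (s : ℂ) : saddleChart s ^ 2 = 2 * (Complex.exp s - 1 - s) := by
  rw [saddleChart, saddleFactor, mul_pow, neg_sq, cpow_half_sq, gapQuot_mul_sq]

theorem differentiableOn_saddleChart : DifferentiableOn ℂ saddleChart saddleDisc :=
  differentiableOn_id.mul differentiableOn_saddleFactor

theorem hasDerivAt_saddleChart {s : ℂ} (hs : s ∈ saddleDisc) :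
    HasDerivAt saddleChart (deriv saddleChart s) s :=
  (differentiableOn_saddleChart.differentiableAt (isOpen_saddleDisc.mem_nhds hs)).hasDerivAt

theorem saddleChart_mul_deriv {s : ℂ} (hs : s ∈ saddleDisc) :
    saddleChart s * deriv saddleChart s = Complex.exp s - 1 := by
  have h1 := (hasDerivAt_saddleChart hs).fun_pow 2
  simp only [saddleChart_sq] at h1
  have h2 : HasDerivAt (fun s : ℂ => 2 * (Complex.exp s - 1 - s)) (2 * (Complex.exp s - 1)) s :=
    (((Complex.hasDerivAt_exp s).sub_const 1).sub (hasDerivAt_id s)).const_mul 2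
  have h3 := h1.unique h2
  simp only [Nat.cast_ofNat, Nat.add_one_sub_one, pow_one] at h3
  linear_combination h3 / 2

theorem saddleFactor_zero : saddleFactor 0 = -1 := by
  simp [saddleFactor, gapQuot_zero]

theorem saddleChart_zero : saddleChart 0 = 0 := by simp [saddleChart]

theorem deriv_saddleChart_zero : deriv saddleChart 0 = -1 := by
  have h1 := (hasDerivAt_id' (0 : ℂ)).fun_mul
    (differentiableOn_saddleFactor.differentiableAt saddleDisc_mem_nhds).hasDerivAt
  have h2 : HasDerivAt saddleChart (1 * saddleFactor 0 + 0 * deriv saddleFactor 0) 0 := h1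
  rw [h2.deriv, saddleFactor_zero]; ring

theorem exp_ne_one_of_mem_saddleDisc {s : ℂ} (hs : s ∈ saddleDisc) (h0 : s ≠ 0) :
    Complex.exp s ≠ 1 := by
  intro h
  obtain ⟨n, hn⟩ := Complex.exp_eq_one_iff.1 h
  have hn0 : n ≠ 0 := by rintro rfl; simp at hn; exact h0 hn
  have h1 : ‖s‖ = |(n : ℝ)| * (2 * Real.pi) := by
    rw [hn]; simp [abs_of_pos Real.pi_pos]
  have h2 : (1 : ℝ) ≤ |(n : ℝ)| := by
    rw [← Int.cast_abs]; exact_mod_cast Int.one_le_abs hn0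
  have h3 := norm_lt_of_mem_saddleDisc hs
  nlinarith [Real.pi_gt_three]

theorem deriv_saddleChart_ne_zero : ∀ s ∈ saddleDisc, deriv saddleChart s ≠ 0 := by
  intro s hs h
  rcases eq_or_ne s 0 with rfl | h0
  · rw [deriv_saddleChart_zero] at h; norm_num at h
  · have := saddleChart_mul_deriv hs
    rw [h, mul_zero] at this
    exact exp_ne_one_of_mem_saddleDisc hs h0 (by linear_combination -this)

/-- `|σ|²/2 = |exp s - 1 - s|` is at least `|s|²/2 - (exp |s| - 1 - |s| - |s|²/2)`, which exceeds
`8/25` at `|s| = 5/4`. -/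
theorem norm_saddleChart_ge :
    ∀ s ∈ Metric.sphere (0 : ℂ) (5 / 4), 4 / 5 ≤ ‖s * saddleFactor s‖ := by
  intro s hs
  have hs' : ‖s‖ = 5 / 4 := by simpa using hs
  have h1 := norm_exp_sub_quadratic_le s
  rw [hs'] at h1
  have h2 : Real.exp (5 / 4) ≤ 34925 / 10000 := by
    have h3 : Real.exp (5 / 4) ^ 4 ≤ (34925 / 10000 : ℝ) ^ 4 := by
      rw [← Real.exp_nat_mul]
      have h4 : ((4 : ℕ) : ℝ) * (5 / 4) = ((5 : ℕ) : ℝ) * 1 := by norm_num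
      rw [h4, Real.exp_nat_mul]
      have h5 := Real.exp_one_lt_d9
      calc Real.exp 1 ^ 5 ≤ 2.7182818286 ^ 5 := by gcongr
        _ ≤ _ := by norm_num
    exact le_of_pow_le_pow_left₀ (by norm_num) (by norm_num) h3
  have h3 : ‖s ^ 2 / 2‖ - ‖Complex.exp s - 1 - s - s ^ 2 / 2‖ ≤ ‖Complex.exp s - 1 - s‖ := by
    have := norm_sub_norm_le (s ^ 2 / 2) (s ^ 2 / 2 - (Complex.exp s - 1 - s))
    rw [sub_sub_cancel, ← norm_neg (s ^ 2 / 2 - _), neg_sub] at this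
    exact this
  have h4 : ‖s ^ 2 / 2‖ = 25 / 32 := by
    rw [norm_div, norm_pow, hs']; norm_num
  have h5 : ‖saddleChart s‖ ^ 2 = 2 * ‖Complex.exp s - 1 - s‖ := by
    rw [← norm_pow, saddleChart_sq, norm_mul]; norm_num
  have h6 : (4 / 5 : ℝ) ^ 2 ≤ ‖saddleChart s‖ ^ 2 := by
    rw [h5]; norm_num at h1 ⊢; linarith
  exact le_of_pow_le_pow_left₀ two_ne_zero (norm_nonneg _) h6

theorem analyticAt_saddleChart : AnalyticAt ℂ saddleChart 0 :=
  differentiableOn_saddleChart.analyticAt saddleDisc_mem_nhds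

theorem exists_saddleChart_inverse : ∃ τ : ℂ → ℂ, AnalyticAt ℂ τ 0 ∧ τ 0 = 0 ∧ deriv τ 0 = -1 ∧
    (∀ᶠ s in 𝓝 0, τ (saddleChart s) = s) ∧ (∀ᶠ z in 𝓝 0, saddleChart (τ z) = z) := by
  have h := analyticAt_saddleChart
  have h' := deriv_saddleChart_ne_zero 0 (mem_of_mem_nhds saddleDisc_mem_nhds)
  have hs := h.hasStrictDerivAt
  refine ⟨hs.localInverse _ _ _ h', ?_, ?_, ?_, hs.eventually_left_inverse h', ?_⟩
  · have := h.analyticAt_localInverse h'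
    rwa [saddleChart_zero] at this
  · have := (hs.eventually_left_inverse h').self_of_nhds
    rwa [saddleChart_zero] at this
  · have := (hs.to_localInverse h').hasDerivAt
    rw [saddleChart_zero] at this
    rw [this.deriv, deriv_saddleChart_zero]
    norm_num
  · have := hs.eventually_right_inverse h'
    rwa [saddleChart_zero] at this

/-- The substitution `ℓ = 1 - exp s` turns the equation of `ℓ` into `σ(s)² = z²`. -/
theorem isEll_of_inverse {τ : ℂ → ℂ} (hτ : AnalyticAt ℂ τ 0) (hτ0 : τ 0 = 0)
    (hτ' : deriv τ 0 = -1) (hr : ∀ᶠ z in 𝓝 0, saddleChart (τ z) = z) :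
    IsEll fun z => 1 - Complex.exp (τ z) := by
  refine ⟨analyticAt_const.sub hτ.cexp, by simp [hτ0], ?_, ?_⟩
  · have h1 := (hτ.differentiableAt.hasDerivAt.cexp.const_sub 1)
    rw [h1.deriv, hτ', hτ0]; simp
  · filter_upwards [hr] with z hz
    have h1 := saddleChart_sq (τ z)
    rw [hz] at h1
    have h2 : 1 - Complex.exp (τ z) - 1 = -Complex.exp (τ z) := by ring
    rw [h2, neg_mul, ← Complex.exp_add, h1]
    congr 2; ring

/-- The germ `ℓ` is `1 - exp s` in the saddle chart; the normalization of `ℓ'(0)` singles out one of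
the two solutions `σ(log (1 - ℓ(z))) = ± z`. -/
theorem IsEll.comp_saddleChart {l : ℂ → ℂ} (hl : IsEll l) :
    ∀ᶠ s in 𝓝 (0 : ℂ), l (saddleChart s) = 1 - Complex.exp s := by
  obtain ⟨τ, hτ, hτ0, hτ', hleft, hright⟩ := exists_saddleChart_inverse
  have hslit : (1 - l 0) ∈ Complex.slitPlane := by rw [hl.value]; simp
  set w : ℂ → ℂ := fun z => Complex.log (1 - l z) with hw
  have hwa : AnalyticAt ℂ w 0 := (analyticAt_const.sub hl.analytic).clog hslit
  have hw0 : w 0 = 0 := by simp [hw, hl.value]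
  have hw' : HasDerivAt w (-1) 0 := by
    have h1 := (hl.analytic.differentiableAt.hasDerivAt.const_sub 1).clog hslit
    rw [hl.derivative, hl.value] at h1
    simpa using h1
  have hexpw : ∀ᶠ z in 𝓝 (0 : ℂ), Complex.exp (w z) = 1 - l z := by
    have h1 : ContinuousAt (fun z => 1 - l z) 0 := continuousAt_const.sub hl.analytic.continuousAt
    filter_upwards [h1.eventually_ne (Complex.slitPlane_ne_zero hslit)] with z hz
    exact Complex.exp_log hz
  have hd : ∀ᶠ z in 𝓝 (0 : ℂ), w z - Complex.exp (w z) + 1 + z ^ 2 / 2 = 0 := by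
    set d : ℂ → ℂ := fun z => w z - Complex.exp (w z) + 1 + z ^ 2 / 2 with hdd
    have hdc : ContinuousAt d 0 := by
      have := hwa.continuousAt
      fun_prop
    have hd0 : d 0 = 0 := by simp [hdd, hw0]
    have hnear : ∀ᶠ z in 𝓝 (0 : ℂ), ‖d z‖ < Real.pi := by
      have := hdc.norm
      refine this.eventually_lt_const ?_
      simpa only [hd0, norm_zero] using Real.pi_pos
    filter_upwards [hnear, hexpw, hl.equation] with z h1 h2 h3
    have h4 : Complex.exp (d z) = 1 := by
      have h5 : (1 - l z) * Complex.exp (-(1 - l z)) = Complex.exp (-1 - z ^ 2 / 2) := by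
        have : -(1 - l z) = l z - 1 := by ring
        rw [this]; linear_combination -h3
      rw [← h2, ← Complex.exp_add] at h5
      have h6 : d z = (w z + -Complex.exp (w z)) - (-1 - z ^ 2 / 2) := by rw [hdd]; ring
      rw [h6, Complex.exp_sub, h5, div_self (Complex.exp_ne_zero _)]
    have h7 := abs_lt.1 ((Complex.abs_im_le_norm (d z)).trans_lt h1)
    have h8 := Complex.log_exp h7.1 h7.2.le
    rw [h4, Complex.log_one] at h8
    exact h8.symm
  have hsa : AnalyticAt ℂ (fun z => saddleChart (w z)) 0 := by
    have : AnalyticAt ℂ saddleChart (w 0) := by rw [hw0]; exact analyticAt_saddleChart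
    exact this.comp hwa
  have hsw' : HasDerivAt (fun z => saddleChart (w z)) 1 0 := by
    have h1 : HasDerivAt saddleChart (-1) (w 0) := by
      rw [hw0, ← deriv_saddleChart_zero]
      exact hasDerivAt_saddleChart (mem_of_mem_nhds saddleDisc_mem_nhds)
    exact (h1.comp (0 : ℂ) hw').congr_deriv (by norm_num)
  have hprod : ∀ᶠ z in 𝓝 (0 : ℂ), (saddleChart (w z) - z) * (saddleChart (w z) + z) = 0 := by
    filter_upwards [hd] with z hz
    have := saddleChart_sq (w z)
    linear_combination this - 2 * hz
  have hid : ∀ᶠ z in 𝓝 (0 : ℂ), saddleChart (w z) = z := by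
    rcases (hsa.sub analyticAt_id).eventually_eq_zero_or_eventually_ne_zero with h | h
    · filter_upwards [h] with z hz
      simpa [sub_eq_zero] using hz
    · exfalso
      have h1 : ∀ᶠ z in 𝓝[≠] (0 : ℂ), saddleChart (w z) = -z := by
        filter_upwards [h, hprod.filter_mono nhdsWithin_le_nhds] with z h2 h3
        have h2' : saddleChart (w z) - z ≠ 0 := h2
        rcases mul_eq_zero.1 h3 with h4 | h4
        · exact absurd h4 h2'
        · linear_combination h4
      have h2 : (fun z => saddleChart (w z)) =ᶠ[𝓝 0] fun z => -z := by
        rw [eventually_nhdsWithin_iff] at h1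
        filter_upwards [h1] with z hz
        rcases eq_or_ne z 0 with rfl | h0
        · simp [hw0, saddleChart_zero]
        · exact hz h0
      have h3 := (hsw'.congr_of_eventuallyEq h2.symm).unique (hasDerivAt_neg (0 : ℂ))
      norm_num at h3
  have hwτ : ∀ᶠ z in 𝓝 (0 : ℂ), w z = τ z := by
    have hwc : Tendsto w (𝓝 0) (𝓝 0) := by
      have := hwa.continuousAt.tendsto
      rwa [hw0] at this
    filter_upwards [hid, hwc.eventually hleft] with z h1 h2
    rw [← h2, h1]
  have hsc : Tendsto saddleChart (𝓝 0) (𝓝 0) := by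
    have := analyticAt_saddleChart.continuousAt.tendsto
    rwa [saddleChart_zero] at this
  filter_upwards [hleft, hsc.eventually hwτ, hsc.eventually hexpw] with s h1 h2 h3
  rw [h2, h1] at h3
  rw [h3]; ring

theorem isEll_ell : IsEll ell := by
  obtain ⟨τ, hτ, hτ0, hτ', -, hright⟩ := exists_saddleChart_inverse
  exact Classical.epsilon_spec ⟨_, isEll_of_inverse hτ hτ0 hτ' hright⟩

/-- The amplitude `exp ((lam / 2) s² + s)` of the saddle point integral, with respect to
`-dσ` instead of `ds`; this is `V` in the saddle chart. -/
noncomputable def chartAmplitude (lam : ℝ) (s : ℂ) : ℂ :=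
  -(Complex.exp ((lam : ℂ) / 2 * s ^ 2 + s)) / deriv saddleChart s

theorem differentiableOn_chartAmplitude (lam : ℝ) :
    DifferentiableOn ℂ (chartAmplitude lam) saddleDisc := by
  refine DifferentiableOn.div ?_ (differentiableOn_saddleChart.deriv isOpen_saddleDisc)
    deriv_saddleChart_ne_zero
  fun_prop

theorem analyticAt_saddleV (lam : ℝ) : AnalyticAt ℂ (saddleV lam) 0 := by
  have h1 := isEll_ell.analytic
  have h2 := h1.deriv
  unfold saddleV
  fun_prop

theorem saddleV_comp_saddleChart (lam : ℝ) :
    ∀ᶠ s in 𝓝 (0 : ℂ), saddleV lam (saddleChart s) = chartAmplitude lam s := by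
  have hsc : Tendsto saddleChart (𝓝 0) (𝓝 0) := by
    have := analyticAt_saddleChart.continuousAt.tendsto
    rwa [saddleChart_zero] at this
  have h1 := isEll_ell.comp_saddleChart
  filter_upwards [h1, h1.eventually_nhds, hsc.eventually isEll_ell.analytic.eventually_analyticAt,
    saddleDisc_mem_nhds] with s h2 h3 h4 h5
  have h6 := (h4.differentiableAt.hasDerivAt.comp s (hasDerivAt_saddleChart h5))
  have h7 := ((Complex.hasDerivAt_exp s).const_sub 1).congr_of_eventuallyEq
    (f₁ := ell ∘ saddleChart) h3
  have h8 := h6.unique h7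
  have h9 := deriv_saddleChart_ne_zero s h5
  have h10 : deriv ell (saddleChart s) = -Complex.exp s / deriv saddleChart s := by
    rw [← h8]; field_simp
  have h11 := saddleChart_sq s
  have h12 : ell (saddleChart s) ^ 2 + saddleChart s ^ 2 * ell (saddleChart s) +
      saddleChart s ^ 4 / 4 = s ^ 2 := by
    have : saddleChart s ^ 4 = (saddleChart s ^ 2) ^ 2 := by ring
    rw [this, h11, h2]; ring
  rw [saddleV, h12, h10, chartAmplitude, Complex.exp_add]
  ring

theorem chartRemainder_zero_eq_coeffV (lam : ℝ) (n : ℕ) :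
    chartRemainder saddleFactor (chartAmplitude lam) n 0 = coeffV lam n :=
  chartRemainder_zero_eq saddleDisc_mem_nhds differentiableOn_saddleFactor saddleFactor_ne_zero
    (analyticAt_saddleV lam)
    (saddleV_comp_saddleChart lam) n

theorem closedBall_subset_saddleDisc : Metric.closedBall (0 : ℂ) (5 / 4) ⊆ saddleDisc :=
  Metric.closedBall_subset_ball (by norm_num)

/-- Bounds for the Taylor coefficients of `V` and for its Taylor remainders in the saddle chart. -/
theorem exists_chartAmplitude_bounds (lam : ℝ) : ∃ C : ℝ, 0 < C ∧ ∀ n : ℕ,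
    ‖coeffV lam n‖ ≤ C / (4 / 5) ^ n ∧ ∀ s ∈ Metric.closedBall (0 : ℂ) (5 / 4),
      ‖chartRemainder saddleFactor (chartAmplitude lam) n s‖ ≤ C * (n + 1) / (4 / 5) ^ n := by
  have := exists_norm_chartRemainder_le isOpen_saddleDisc (by norm_num)
    closedBall_subset_saddleDisc differentiableOn_saddleFactor saddleFactor_ne_zero
    (differentiableOn_chartAmplitude lam) (by norm_num) norm_saddleChart_ge
  simpa only [chartRemainder_zero_eq_coeffV] using this

/-! ### The two branches of the inverse of `1 + s - exp s` and steepest descent curves -/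

/-- The solution `s` of `1 + s - exp s = y`, for `Re y > 0`, in the strip `|Im s - ε π| < π`,
where `ε = ± 1`. -/
noncomputable def saddleBranch (ε : ℝ) (y : ℂ) : ℂ :=
  stripInv (y - 1 - (ε * Real.pi : ℝ) * Complex.I) + (ε * Real.pi : ℝ) * Complex.I

section Branch

variable {ε : ℝ} {y : ℂ}

theorem cexp_sign_pi (hε : ε = 1 ∨ ε = -1) : Complex.exp ((ε * Real.pi : ℝ) * Complex.I) = -1 := by
  rcases hε with rfl | rfl
  · simp
  · simp [Complex.exp_neg]

theorem re_shift_gt (hy : 0 < y.re) : -1 < (y - 1 - (ε * Real.pi : ℝ) * Complex.I).re := by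
  simp [hy]

theorem abs_saddleBranch_im_sub_lt (hy : 0 < y.re) :
    |(saddleBranch ε y).im - ε * Real.pi| < Real.pi := by
  have := stripInv_im (re_shift_gt (ε := ε) hy)
  simpa [saddleBranch] using this

theorem exp_sub_sign_pi (hε : ε = 1 ∨ ε = -1) (s : ℂ) :
    Complex.exp (s - (ε * Real.pi : ℝ) * Complex.I) = -Complex.exp s := by
  rw [Complex.exp_sub, cexp_sign_pi hε, div_neg, div_one]

theorem saddleBranch_eq (hε : ε = 1 ∨ ε = -1) (hy : 0 < y.re) :
    1 + saddleBranch ε y - Complex.exp (saddleBranch ε y) = y := by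
  have h1 := stripInv_eq (re_shift_gt (ε := ε) hy)
  have h2 : stripInv (y - 1 - (ε * Real.pi : ℝ) * Complex.I) =
      saddleBranch ε y - (ε * Real.pi : ℝ) * Complex.I := by rw [saddleBranch]; ring
  rw [h2, exp_sub_sign_pi hε] at h1
  linear_combination h1

theorem one_sub_exp_saddleBranch_ne_zero (hε : ε = 1 ∨ ε = -1) (hy : 0 < y.re) :
    1 - Complex.exp (saddleBranch ε y) ≠ 0 := by
  have h1 := one_add_exp_ne_zero (stripInv_im (re_shift_gt (ε := ε) hy))
  have h2 : stripInv (y - 1 - (ε * Real.pi : ℝ) * Complex.I) =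
      saddleBranch ε y - (ε * Real.pi : ℝ) * Complex.I := by rw [saddleBranch]; ring
  rwa [h2, exp_sub_sign_pi hε, ← sub_eq_add_neg] at h1

theorem hasDerivAt_saddleBranch (hε : ε = 1 ∨ ε = -1) (hy : 0 < y.re) :
    HasDerivAt (saddleBranch ε) (1 - Complex.exp (saddleBranch ε y))⁻¹ y := by
  have h1 := hasDerivAt_stripInv (re_shift_gt (ε := ε) hy)
  have h2 : stripInv (y - 1 - (ε * Real.pi : ℝ) * Complex.I) =
      saddleBranch ε y - (ε * Real.pi : ℝ) * Complex.I := by rw [saddleBranch]; ring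
  rw [h2, exp_sub_sign_pi hε, ← sub_eq_add_neg] at h1
  have h3 : HasDerivAt (fun y : ℂ => y - 1 - (ε * Real.pi : ℝ) * Complex.I) 1 y :=
    ((hasDerivAt_id y).sub_const _).sub_const _
  have h4 := (h1.comp y h3).add_const ((ε * Real.pi : ℝ) * Complex.I)
  rw [mul_one] at h4
  exact h4

theorem saddleBranch_unique (hε : ε = 1 ∨ ε = -1) (hy : 0 < y.re) {s : ℂ}
    (hs : |s.im - ε * Real.pi| < Real.pi) (h : 1 + s - Complex.exp s = y) :
    saddleBranch ε y = s := by
  have h1 := saddleBranch_eq hε hy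
  have h2 := add_exp_injective (p := saddleBranch ε y - (ε * Real.pi : ℝ) * Complex.I)
    (q := s - (ε * Real.pi : ℝ) * Complex.I)
    (by simpa using abs_saddleBranch_im_sub_lt (ε := ε) hy) (by simpa using hs)
    (by rw [exp_sub_sign_pi hε, exp_sub_sign_pi hε]; linear_combination h1 - h)
  linear_combination h2

theorem sign_mul_im_pos_of_abs_lt (hε : ε = 1 ∨ ε = -1) {s : ℂ}
    (h : |s.im - ε * Real.pi| < Real.pi) : 0 < ε * s.im := by
  rw [abs_lt] at h
  rcases hε with rfl | rfl <;> linarith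

theorem abs_im_saddleBranch_le (hε : ε = 1 ∨ ε = -1) (hy : 0 < y.re) :
    |(saddleBranch ε y).im| ≤ 2 * Real.pi := by
  have h := abs_lt.1 (abs_saddleBranch_im_sub_lt (ε := ε) hy)
  rw [abs_le]
  have := Real.pi_pos
  rcases hε with rfl | rfl <;> constructor <;> linarith

/-- Near the saddle both branches stay in the disc of the saddle chart. -/
theorem norm_saddleBranch_lt (hε : ε = 1 ∨ ε = -1) (hy : 0 < y.re) (hy' : ‖y‖ < 8 / 25) :
    ‖saddleBranch ε y‖ < 5 / 4 := by
  have hε2 : ε * ε = 1 := by rcases hε with rfl | rfl <;> norm_num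
  set U : Set ℂ := Metric.ball 0 (5 / 4) ∩ {s : ℂ | 0 < ε * s.im} with hU
  set D : Set ℂ := {y : ℂ | 0 < y.re} ∩ Metric.ball 0 (8 / 25) with hD
  have hd : ∀ s : ℂ, HasDerivAt (fun s : ℂ => 1 + s - Complex.exp s) (1 - Complex.exp s) s :=
    fun s => ((hasDerivAt_id s).const_add 1).sub (Complex.hasDerivAt_exp s)
  have key := subset_image_of_isPreconnected (f := fun s : ℂ => 1 + s - Complex.exp s)
    (U := U) (D := D) (fun s => (hd s).differentiableAt)
    (Metric.isOpen_ball.inter (isOpen_lt continuous_const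
      (continuous_const.mul Complex.continuous_im))) ?_
    ((convex_halfSpace_re_gt 0).inter (convex_ball _ _)).isPreconnected ?_
    (fun R => Metric.isBounded_ball.subset fun s hs => hs.1.1) ?_
  · obtain ⟨s, hs, hsy⟩ := key ⟨hy, by simpa using hy'⟩
    have hs1 : ‖s‖ < 5 / 4 := by simpa using hs.1
    have hs2 : 0 < ε * s.im := hs.2
    have h3 : |s.im| < 5 / 4 := (Complex.abs_im_le_norm s).trans_lt hs1
    rw [saddleBranch_unique hε hy ?_ hsy]
    · exact hs1
    · rw [abs_lt] at h3 ⊢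
      have := Real.pi_gt_three
      rcases hε with rfl | rfl <;> constructor <;> linarith
  · intro s hs h
    rw [(hd s).deriv] at h
    have hs0 : s ≠ 0 := by
      rintro rfl
      have : (0 : ℝ) < ε * (0 : ℂ).im := hs.2
      simp at this
    exact exp_ne_one_of_mem_saddleDisc
      (closedBall_subset_saddleDisc (Metric.ball_subset_closedBall hs.1)) hs0
      (by linear_combination -h)
  · intro s hs hsD
    have hsc : ‖s‖ ≤ 5 / 4 := by
      have : s ∈ Metric.closedBall (0 : ℂ) (5 / 4) :=
        closure_minimal (fun z hz => Metric.ball_subset_closedBall hz.1)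
          Metric.isClosed_closedBall hs
      simpa using this
    have hsi : 0 ≤ ε * s.im := by
      have : s ∈ {s : ℂ | 0 ≤ ε * s.im} :=
        closure_minimal (fun z (hz : z ∈ U) => le_of_lt (show 0 < ε * z.im from hz.2))
          (isClosed_le continuous_const (continuous_const.mul Complex.continuous_im)) hs
      exact this
    have hD1 : 0 < (1 + s - Complex.exp s).re := hsD.1
    have hD2 : ‖1 + s - Complex.exp s‖ < 8 / 25 := by simpa using hsD.2
    refine ⟨?_, ?_⟩
    · rcases lt_or_eq_of_le hsc with h | h
      · simpa using h
      · exfalso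
        have h1 := norm_saddleChart_ge s (by simpa using h)
        have h2 : ‖saddleChart s‖ ^ 2 = 2 * ‖1 + s - Complex.exp s‖ := by
          rw [← norm_pow, saddleChart_sq, norm_mul, ← norm_neg (Complex.exp s - 1 - s)]
          norm_num
          congr 1; ring
        have h3 : (4 / 5 : ℝ) ^ 2 ≤ ‖saddleChart s‖ ^ 2 := pow_le_pow_left₀ (by norm_num) h1 2
        linarith
    · rcases lt_or_eq_of_le hsi with h | h
      · exact h
      · exfalso
        have h0 : s.im = 0 := by
          rcases mul_eq_zero.1 h.symm with h1 | h1
          · rw [h1] at hε2; norm_num at hε2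
          · exact h1
        have h2 : (1 + s - Complex.exp s).re = 1 + s.re - Real.exp s.re := by
          simp [Complex.exp_re, h0]
        rw [h2] at hD1
        linarith [Real.add_one_le_exp s.re]
  -- the point `s = i ε / 2` of the half-disc has an image in the half-disc of radius `8/25`
  · refine ⟨1 + (ε / 2 : ℝ) * Complex.I - Complex.exp ((ε / 2 : ℝ) * Complex.I), ⟨?_, ?_⟩,
      (ε / 2 : ℝ) * Complex.I, ⟨?_, ?_⟩, rfl⟩
    · have hcos : Real.cos (ε / 2) < 1 := by
        have h1 : Real.cos (ε / 2) = Real.cos (1 / 2) := by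
          rcases hε with rfl | rfl
          · rfl
          · rw [neg_div, Real.cos_neg]
        rw [h1]
        have := Real.cos_lt_cos_of_nonneg_of_le_pi (le_refl 0) (by linarith [Real.pi_gt_three])
          (by norm_num : (0 : ℝ) < 1 / 2)
        rwa [Real.cos_zero] at this
      have h2 : (1 + (ε / 2 : ℝ) * Complex.I - Complex.exp ((ε / 2 : ℝ) * Complex.I)).re =
          1 - Real.cos (ε / 2) := by
        rw [Complex.sub_re, Complex.exp_ofReal_mul_I_re]; simp
      change 0 < (1 + (ε / 2 : ℝ) * Complex.I - Complex.exp ((ε / 2 : ℝ) * Complex.I)).re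
      rw [h2]; linarith
    · have h0 : ‖((ε / 2 : ℝ) : ℂ) * Complex.I‖ = 1 / 2 := by
        rw [norm_mul, Complex.norm_I, mul_one, Complex.norm_real]
        rcases hε with rfl | rfl <;> norm_num
      have h1 := norm_exp_sub_quadratic_le ((ε / 2 : ℝ) * Complex.I)
      rw [h0] at h1
      set s := ((ε / 2 : ℝ) : ℂ) * Complex.I with hs
      have h2 : 1 + s - Complex.exp s =
          -(s ^ 2 / 2) - (Complex.exp s - 1 - s - s ^ 2 / 2) := by ring
      have h3 := exp_lt_quadratic (r := 1 / 2) (by norm_num) (by norm_num)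
      have h4 : Real.exp (1 / 2) ≤ 1 + 1 / 2 + (1 / 2) ^ 2 / 2 + (1 / 2) ^ 3 * (2 / 9) := by
        have := Real.exp_bound' (x := 1 / 2) (by norm_num) (by norm_num) (n := 3) (by norm_num)
        simp only [Finset.sum_range_succ, Finset.sum_range_zero, Nat.factorial] at this
        norm_num at this ⊢
        linarith
      have h5 : ‖1 + s - Complex.exp s‖ ≤
          1 / 8 + (Real.exp (1 / 2) - 1 - 1 / 2 - (1 / 2) ^ 2 / 2) := by
        rw [h2]
        refine (norm_sub_le _ _).trans (add_le_add ?_ h1)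
        rw [norm_neg, norm_div, norm_pow, h0]; norm_num
      simp only [Metric.mem_ball, dist_zero_right]
      norm_num at h4 h5 ⊢
      linarith
    · have h0 : ‖((ε / 2 : ℝ) : ℂ) * Complex.I‖ = 1 / 2 := by
        rw [norm_mul, Complex.norm_I, mul_one, Complex.norm_real]
        rcases hε with rfl | rfl <;> norm_num
      simp only [Metric.mem_ball, dist_zero_right, h0]
      norm_num
    · have : 0 < ε * (ε / 2) := by linarith
      simpa using this

/-- The branches grow logarithmically; in particular every quadratic expression in `|s|` is
`o(|y|)`. -/
theorem exists_saddleBranch_growth (hε : ε = 1 ∨ ε = -1) (A K : ℝ) (hA : 0 ≤ A) (hK : 0 ≤ K)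
    {δ : ℝ} (hδ : 0 < δ) : ∃ C : ℝ, ∀ y : ℂ, 0 < y.re →
      A * ‖saddleBranch ε y‖ ^ 2 + K * ‖saddleBranch ε y‖ ≤ C + δ * ‖y‖ := by
  have hpi := Real.pi_pos
  obtain ⟨C, hC⟩ := exists_quadratic_le_exp (κ := δ / 2) (by positivity) A K (2 * Real.pi + 2)
    hA hK (by positivity)
  refine ⟨C + δ / 2 * (3 + 4 * Real.pi), fun y hy => ?_⟩
  set s := saddleBranch ε y with hs
  have him : |s.im| ≤ 2 * Real.pi := abs_im_saddleBranch_le hε hy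
  have heq : 1 + s - Complex.exp s = y := saddleBranch_eq hε hy
  set a := max s.re 0 with ha
  have ha0 : 0 ≤ a := le_max_right _ _
  have hre : -2 ≤ s.re := by
    by_contra! h
    have h1 : (1 + s - Complex.exp s).re = 1 + s.re - Real.exp s.re * Real.cos s.im := by
      simp [Complex.exp_re]
    rw [heq] at h1
    have h2 := Real.neg_one_le_cos s.im
    have h3 : Real.exp s.re ≤ 1 := Real.exp_le_one_iff.2 (by linarith)
    nlinarith [Real.exp_pos s.re]
  have habs : |s.re| ≤ a + 2 := by
    rw [abs_le]
    constructor
    · linarith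
    · linarith [le_max_left s.re 0]
  have hnorm : ‖s‖ ≤ a + (2 * Real.pi + 2) := by
    linarith [Complex.norm_le_abs_re_add_abs_im s]
  have hexp : Real.exp a ≤ 2 * ‖y‖ + 3 + 4 * Real.pi := by
    rcases le_total s.re 0 with h | h
    · rw [ha, max_eq_right h, Real.exp_zero]
      linarith [norm_nonneg y]
    · have ha' : a = s.re := max_eq_left h
      have h1 : Real.exp s.re ≤ 1 + ‖s‖ + ‖y‖ := by
        rw [← Complex.norm_exp]
        have : Complex.exp s = 1 + s - y := by rw [← heq]; ring
        rw [this]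
        refine (norm_sub_le _ _).trans ?_
        gcongr
        refine (norm_add_le _ _).trans ?_
        simp
      have h2 : ‖s‖ ≤ s.re + 2 * Real.pi := by
        have := Complex.norm_le_abs_re_add_abs_im s
        rw [abs_of_nonneg h] at this
        linarith
      have h3 := Real.quadratic_le_exp_of_nonneg h
      have h4 : 2 * s.re ≤ Real.exp s.re := by nlinarith [sq_nonneg (s.re - 1)]
      rw [ha']; linarith
  have h5 := hC a ha0
  have h6 : A * ‖s‖ ^ 2 ≤ A * (a + (2 * Real.pi + 2)) ^ 2 := by gcongr
  have h7 : K * ‖s‖ ≤ K * (a + (2 * Real.pi + 2)) := by gcongr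
  have h8 := mul_le_mul_of_nonneg_left hexp (by positivity : 0 ≤ δ / 2)
  linarith

end Branch

section Curve

variable {ε : ℝ} {e : ℂ}

/-- The integrand `exp ((lam / 2) s² + s) ds` on the curve `s = saddleBranch ε (e q²)`, `q > 0`. -/
noncomputable def curveAmplitude (lam : ℝ) (e : ℂ) (ε q : ℝ) : ℂ :=
  Complex.exp ((lam : ℂ) / 2 * saddleBranch ε (e * q ^ 2) ^ 2 + saddleBranch ε (e * q ^ 2)) *
    ((1 - Complex.exp (saddleBranch ε (e * q ^ 2)))⁻¹ * (2 * e * q))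

theorem re_mul_sq_pos (he : 0 < e.re) {q : ℝ} (hq : 0 < q) : 0 < (e * (q : ℂ) ^ 2).re := by
  rw [← Complex.ofReal_pow, Complex.re_mul_ofReal]; positivity

theorem norm_mul_sq (he1 : ‖e‖ = 1) (q : ℝ) : ‖e * (q : ℂ) ^ 2‖ = q ^ 2 := by
  rw [norm_mul, he1, one_mul, norm_pow, Complex.norm_real, Real.norm_eq_abs, sq_abs]

theorem hasDerivAt_curve (hε : ε = 1 ∨ ε = -1) (he : 0 < e.re) {q : ℝ} (hq : 0 < q) :
    HasDerivAt (fun q : ℝ => saddleBranch ε (e * (q : ℂ) ^ 2))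
      ((1 - Complex.exp (saddleBranch ε (e * q ^ 2)))⁻¹ * (2 * e * q)) q := by
  have h1 : HasDerivAt (fun q : ℝ => e * (q : ℂ) ^ 2) (2 * e * q) q := by
    have h2 := ((hasDerivAt_id (q : ℂ)).fun_pow 2).const_mul e
    have h3 := h2.comp_ofReal
    refine h3.congr_deriv ?_
    simp; ring
  exact HasDerivAt.comp q (hasDerivAt_saddleBranch hε (re_mul_sq_pos he hq)) h1

theorem continuousOn_curveAmplitude (lam : ℝ) (hε : ε = 1 ∨ ε = -1) (he : 0 < e.re) :
    ContinuousOn (curveAmplitude lam e ε) (Set.Ioi 0) := by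
  have h1 : ContinuousOn (fun q : ℝ => saddleBranch ε (e * (q : ℂ) ^ 2)) (Set.Ioi 0) :=
    fun q hq => (hasDerivAt_curve hε he hq).continuousAt.continuousWithinAt
  unfold curveAmplitude
  refine ContinuousOn.mul (by fun_prop) (ContinuousOn.mul (ContinuousOn.inv₀ (by fun_prop) ?_)
    (by fun_prop))
  exact fun q hq => one_sub_exp_saddleBranch_ne_zero hε (re_mul_sq_pos he hq)

/-- In the saddle chart the curves are straight lines. The sign of the square root is determined by
the half-plane that contains the branch. -/
theorem saddleChart_curve (hε : ε = 1 ∨ ε = -1) (he : 0 < e.re) (he1 : ‖e‖ = 1) {q : ℝ}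
    (hq : 0 < q) (hq' : q ^ 2 < 8 / 25) :
    saddleChart (saddleBranch ε (e * q ^ 2)) = -(ε * Complex.I * q * (2 * e) ^ (1 / 2 : ℂ)) := by
  have hε2 : ε * ε = 1 := by rcases hε with rfl | rfl <;> norm_num
  have hε2' : (ε : ℂ) ^ 2 = 1 := by rw [sq]; exact_mod_cast hε2
  have hy := re_mul_sq_pos he hq
  set s := saddleBranch ε (e * q ^ 2) with hs
  have hs5 : ‖s‖ < 5 / 4 := norm_saddleBranch_lt hε hy (by rw [norm_mul_sq he1]; exact hq')
  have hsd : s ∈ saddleDisc := closedBall_subset_saddleDisc (by simpa using hs5.le)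
  have him : 0 < ε * s.im := sign_mul_im_pos_of_abs_lt hε (abs_saddleBranch_im_sub_lt hy)
  set r := (2 * e) ^ (1 / 2 : ℂ) with hr
  have hr2 : r ^ 2 = 2 * e := cpow_half_sq _
  have h2e : 0 < (2 * e).re := by simpa using he
  have hrre : 0 < r.re := cpow_half_re_pos (Or.inl h2e)
  set g := gapQuot s ^ (1 / 2 : ℂ) with hg
  have hg2 : g ^ 2 = gapQuot s := cpow_half_sq _
  have hgre : 0 < g.re := cpow_half_re_pos (gapQuot_mem_slitPlane hsd)
  have hgq : 0 < (g ^ 2).re := by rw [hg2]; exact gapQuot_re_pos (norm_lt_of_mem_saddleDisc hsd)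
  have hrq : 0 < (r ^ 2).re := by rw [hr2]; exact h2e
  have hsq : saddleChart s ^ 2 = (ε * Complex.I * q * r) ^ 2 := by
    have h1 : (ε * Complex.I * q * r) ^ 2 = (ε : ℂ) ^ 2 * Complex.I ^ 2 * q ^ 2 * r ^ 2 := by ring
    rw [saddleChart_sq, h1, hε2', Complex.I_sq, hr2]
    linear_combination -2 * saddleBranch_eq hε hy
  rcases sq_eq_sq_iff_eq_or_eq_neg.1 hsq with h | h
  -- the other sign would give `ε Im s ≤ 0`, since `Re (r * conj g) > 0`
  · exfalso
    have h1 : s * g = -(ε * Complex.I * q * r) := by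
      rw [← h, saddleChart, saddleFactor]; ring
    have h2 : s * (g * (starRingEnd ℂ) g) = -(ε * Complex.I * q * r) * (starRingEnd ℂ) g := by
      rw [← mul_assoc, h1]
    rw [Complex.mul_conj] at h2
    have h3 := congrArg Complex.im h2
    rw [Complex.im_mul_ofReal] at h3
    have h4 : (-(ε * Complex.I * q * r) * (starRingEnd ℂ) g).im =
        -(ε * q * (r.re * g.re + r.im * g.im)) := by
      simp; ring
    rw [h4] at h3
    have h5 : 0 < r.re * g.re + r.im * g.im := by
      have h6 : (r ^ 2).re = r.re ^ 2 - r.im ^ 2 := by rw [sq, Complex.mul_re]; ring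
      have h7 : (g ^ 2).re = g.re ^ 2 - g.im ^ 2 := by rw [sq, Complex.mul_re]; ring
      rw [h6] at hrq
      rw [h7] at hgq
      have h8 : |r.im| < r.re := abs_lt_of_sq_lt_sq (by linarith) hrre.le
      have h9 : |g.im| < g.re := abs_lt_of_sq_lt_sq (by linarith) hgre.le
      have h10 : |r.im * g.im| < r.re * g.re := by
        rw [abs_mul]; exact mul_lt_mul'' h8 h9 (abs_nonneg _) (abs_nonneg _)
      linarith [neg_abs_le (r.im * g.im)]
    have hgn : 0 ≤ Complex.normSq g := Complex.normSq_nonneg g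
    have h11 : (ε * s.im) * Complex.normSq g = -(q * (r.re * g.re + r.im * g.im)) := by
      linear_combination ε * h3 - q * (r.re * g.re + r.im * g.im) * hε2
    have h12 : 0 < q * (r.re * g.re + r.im * g.im) := mul_pos hq h5
    nlinarith [mul_nonneg him.le hgn]
  · exact h

theorem curveAmplitude_eq_chartAmplitude (lam : ℝ) (hε : ε = 1 ∨ ε = -1) (he : 0 < e.re)
    (he1 : ‖e‖ = 1) {q : ℝ} (hq : 0 < q) (hq' : q ^ 2 < 8 / 25) :
    curveAmplitude lam e ε q = ε * Complex.I * (2 * e) ^ (1 / 2 : ℂ) *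
      chartAmplitude lam (saddleBranch ε (e * q ^ 2)) := by
  have hy := re_mul_sq_pos he hq
  have hchart := saddleChart_curve hε he he1 hq hq'
  have hs5 := norm_saddleBranch_lt hε hy (by rw [norm_mul_sq he1]; exact hq')
  have hne := one_sub_exp_saddleBranch_ne_zero hε hy
  rw [curveAmplitude, chartAmplitude]
  set s := saddleBranch ε (e * q ^ 2) with hs
  have hsd : s ∈ saddleDisc := closedBall_subset_saddleDisc (by simpa using hs5.le)
  have hd := deriv_saddleChart_ne_zero s hsd
  have hmul := saddleChart_mul_deriv hsd
  rw [hchart] at hmul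
  set r := (2 * e) ^ (1 / 2 : ℂ) with hr
  have hr2 : r ^ 2 = 2 * e := cpow_half_sq _
  have hq0 : (q : ℂ) ≠ 0 := by exact_mod_cast hq.ne'
  have h1 : 1 - Complex.exp s = ε * Complex.I * q * r * deriv saddleChart s := by
    linear_combination hmul
  rw [h1] at hne
  have hr0 : r ≠ 0 := by
    intro h; rw [h] at hne; simp at hne
  have hε0 : (ε : ℂ) ≠ 0 := by
    intro h; rw [h] at hne; simp at hne
  have hε2 : (ε : ℂ) ^ 2 = 1 := by rcases hε with rfl | rfl <;> norm_num
  rw [h1, ← hr2]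
  have hI : Complex.I ≠ 0 := Complex.I_ne_zero
  field_simp
  rw [hε2, Complex.I_sq]; ring

/-- The curves start at the saddle point. -/
theorem tendsto_curve_zero (hε : ε = 1 ∨ ε = -1) (he : 0 < e.re) (he1 : ‖e‖ = 1) :
    Tendsto (fun q : ℝ => saddleBranch ε (e * (q : ℂ) ^ 2)) (𝓝[>] 0) (𝓝 0) := by
  obtain ⟨z₀, hz₀, hmin⟩ := (isCompact_closedBall (0 : ℂ) (5 / 4)).exists_isMinOn
    ⟨0, Metric.mem_closedBall_self (by norm_num)⟩ ((differentiableOn_saddleFactor.continuousOn.mono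
      closedBall_subset_saddleDisc).norm)
  set k := ‖saddleFactor z₀‖ with hk
  have hk0 : 0 < k := norm_pos_iff.2 (saddleFactor_ne_zero z₀ (closedBall_subset_saddleDisc hz₀))
  have hlim : Tendsto (fun q : ℝ => q * ‖(2 * e) ^ (1 / 2 : ℂ)‖ / k) (𝓝[>] 0) (𝓝 0) := by
    have : Continuous fun q : ℝ => q * ‖(2 * e) ^ (1 / 2 : ℂ)‖ / k := by fun_prop
    have h := this.tendsto 0
    simp only [zero_mul, zero_div] at h
    exact h.mono_left nhdsWithin_le_nhds
  refine squeeze_zero_norm' ?_ hlim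
  have hsmall : ∀ᶠ q : ℝ in 𝓝[>] 0, q ^ 2 < 8 / 25 := by
    have : Continuous fun q : ℝ => q ^ 2 := by fun_prop
    exact (this.tendsto' 0 0 (by norm_num)).mono_left nhdsWithin_le_nhds
      |>.eventually_lt_const (by norm_num)
  filter_upwards [self_mem_nhdsWithin, hsmall] with q hq hq'
  have hq : 0 < q := hq
  have hchart := congrArg norm (saddleChart_curve hε he he1 hq hq')
  have hs5 := norm_saddleBranch_lt hε (re_mul_sq_pos he hq) (by rw [norm_mul_sq he1]; exact hq')
  set s := saddleBranch ε (e * q ^ 2) with hs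
  have h1 : k ≤ ‖saddleFactor s‖ := hmin (by simpa using hs5.le)
  have hεn : ‖(ε : ℂ)‖ = 1 := by rcases hε with rfl | rfl <;> simp
  rw [norm_neg, norm_mul, norm_mul, norm_mul, hεn, Complex.norm_I, Complex.norm_real,
    Real.norm_of_nonneg hq.le, saddleChart, norm_mul, one_mul, one_mul] at hchart
  rw [le_div_iff₀ hk0, ← hchart]
  gcongr

theorem exists_norm_curve_le (hε : ε = 1 ∨ ε = -1) (he : 0 < e.re) (he1 : ‖e‖ = 1) {δ : ℝ}
    (hδ : 0 < δ) :
    ∃ C : ℝ, 0 ≤ C ∧ ∀ q : ℝ, 0 < q → ‖saddleBranch ε (e * q ^ 2)‖ ≤ C + δ * q ^ 2 := by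
  obtain ⟨C, hC⟩ := exists_saddleBranch_growth hε 0 1 le_rfl zero_le_one hδ
  refine ⟨|C|, abs_nonneg _, fun q hq => ?_⟩
  have := hC _ (re_mul_sq_pos he hq)
  rw [norm_mul_sq he1] at this
  linarith [le_abs_self C]

/-- At infinity the curves approach the direction of the line `Im s = ε π + arg e`. -/
theorem tendsto_curve_atTop (hε : ε = 1 ∨ ε = -1) (he : 0 < e.re) (he1 : ‖e‖ = 1) :
    Tendsto (fun q : ℝ => (saddleBranch ε (e * (q : ℂ) ^ 2)).re) atTop atTop ∧
    Tendsto (fun q : ℝ => (saddleBranch ε (e * (q : ℂ) ^ 2)).im) atTop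
      (𝓝 (ε * Real.pi + e.arg)) := by
  set s : ℝ → ℂ := fun q => saddleBranch ε (e * (q : ℂ) ^ 2) with hs
  set w : ℝ → ℂ := fun q => e - (1 + s q) / ((q ^ 2 : ℝ) : ℂ) with hw
  have hlim : Tendsto (fun q : ℝ => (1 + s q) / ((q ^ 2 : ℝ) : ℂ)) atTop (𝓝 0) := by
    rw [tendsto_zero_iff_norm_tendsto_zero, Metric.tendsto_atTop]
    intro η hη
    obtain ⟨C, hC0, hC⟩ := exists_norm_curve_le hε he he1 (half_pos hη)
    refine ⟨max 1 (4 * (C + 1) / η), fun q hq => ?_⟩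
    have hq1 : 1 ≤ q := (le_max_left _ _).trans hq
    have hq0 : 0 < q := by linarith
    have hq2 : 4 * (C + 1) / η ≤ q := (le_max_right _ _).trans hq
    rw [div_le_iff₀ hη] at hq2
    rw [dist_zero_right, norm_norm, norm_div, Complex.norm_real,
      Real.norm_of_nonneg (sq_nonneg q), div_lt_iff₀ (by positivity)]
    have h1 : ‖1 + s q‖ ≤ 1 + ‖s q‖ := by simpa using norm_add_le (1 : ℂ) (s q)
    have h2 := hC q hq0
    have h3 : q ≤ q ^ 2 := by nlinarith
    nlinarith
  have hwlim : Tendsto w atTop (𝓝 e) := by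
    have := hlim.const_sub e
    simpa [hw] using this
  have hlog : ∀ q : ℝ, 0 < q → s q - (ε * Real.pi : ℝ) * Complex.I =
      Complex.log (((q ^ 2 : ℝ) : ℂ) * w q) := by
    intro q hq
    have hy := re_mul_sq_pos he hq
    have h1 := abs_lt.1 (abs_saddleBranch_im_sub_lt (ε := ε) hy)
    have h2 := saddleBranch_eq hε hy
    have h3 : ((q ^ 2 : ℝ) : ℂ) * w q =
        Complex.exp (s q - (ε * Real.pi : ℝ) * Complex.I) := by
      rw [exp_sub_sign_pi hε]
      have hq0 : (q : ℂ) ≠ 0 := by exact_mod_cast hq.ne'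
      simp only [hw]
      push_cast
      field_simp
      linear_combination -h2
    rw [h3, Complex.log_exp]
    · simpa [hs] using h1.1
    · simpa [hs] using h1.2.le
  have hwne : ∀ᶠ q in atTop, w q ≠ 0 := by
    refine hwlim.eventually_ne ?_
    rintro rfl
    simp at he
  constructor
  · have h1 : Tendsto (fun q : ℝ => Real.log (q ^ 2) + Real.log ‖w q‖) atTop atTop := by
      refine tendsto_atTop_add_right_of_le' _ (Real.log (1 / 2)) ?_ ?_
      · exact Real.tendsto_log_atTop.comp (tendsto_pow_atTop two_ne_zero)
      · have h2 := hwlim.norm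
        rw [he1] at h2
        filter_upwards [h2.eventually_const_lt (by norm_num : (1 / 2 : ℝ) < 1)] with q hq
        exact Real.log_le_log (by norm_num) hq.le
    refine h1.congr' ?_
    filter_upwards [eventually_gt_atTop 0, hwne] with q hq hwq
    have h2 := congrArg Complex.re (hlog q hq)
    rw [Complex.log_re, norm_mul, Complex.norm_real, Real.norm_of_nonneg (sq_nonneg q),
      Real.log_mul (by positivity) (norm_ne_zero_iff.2 hwq)] at h2
    rw [← h2]
    simp [hs]
  · have h1 : Tendsto (fun q : ℝ => ε * Real.pi + (w q).arg) atTop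
        (𝓝 (ε * Real.pi + e.arg)) :=
      ((Complex.continuousAt_arg (Or.inl he)).tendsto.comp hwlim).const_add _
    refine h1.congr' ?_
    filter_upwards [eventually_gt_atTop 0] with q hq
    have h2 := congrArg Complex.im (hlog q hq)
    rw [Complex.log_im, Complex.arg_real_mul _ (by positivity)] at h2
    simp at h2
    linarith

/-- Subexponential growth of the amplitude along the curves: `log² q` is negligible against `q²`. -/
theorem exists_norm_curveAmplitude_le {lam : ℝ} (hlam : 0 ≤ lam) (hε : ε = 1 ∨ ε = -1)
    (he : 0 < e.re) (he1 : ‖e‖ = 1) {δ : ℝ} (hδ : 0 < δ) :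
    ∃ C : ℝ, 0 < C ∧ ∀ q : ℝ, 0 < q → ‖curveAmplitude lam e ε q‖ ≤ C * Real.exp (δ * q ^ 2) := by
  obtain ⟨C₀, hC₀, hC₀b⟩ := exists_chartAmplitude_bounds lam
  obtain ⟨C₁, hC₁⟩ := exists_saddleBranch_growth hε (lam / 2) 1 (by positivity) zero_le_one hδ
  obtain ⟨C₂, hC₂0, hC₂⟩ := exists_norm_curve_le hε he he1 (by norm_num : (0 : ℝ) < 1 / 2)
  -- the derivative of the curve is bounded: by compactness in the middle, directly far away
  set Q := max 1 (4 * C₂) with hQ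
  have hQ1 : 1 ≤ Q := le_max_left _ _
  have hcont : ContinuousOn (fun q : ℝ => (1 - Complex.exp (saddleBranch ε (e * (q : ℂ) ^ 2)))⁻¹ *
      (2 * e * q)) (Set.Icc (1 / 2) Q) := by
    have h1 : ContinuousOn (fun q : ℝ => saddleBranch ε (e * (q : ℂ) ^ 2)) (Set.Icc (1 / 2) Q) :=
      fun q hq => (hasDerivAt_curve hε he (by linarith [hq.1])).continuousAt.continuousWithinAt
    refine ContinuousOn.mul (ContinuousOn.inv₀ (by fun_prop) ?_) (by fun_prop)
    exact fun q hq => one_sub_exp_saddleBranch_ne_zero hε (re_mul_sq_pos he (by linarith [hq.1]))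
  obtain ⟨K, hK⟩ := isCompact_Icc.exists_bound_of_continuousOn hcont
  have hmid : ∀ q : ℝ, 1 / 2 ≤ q →
      ‖(1 - Complex.exp (saddleBranch ε (e * (q : ℂ) ^ 2)))⁻¹ * (2 * e * q)‖ ≤ max K 8 := by
    intro q hq
    rcases le_total q Q with h | h
    · exact (hK q ⟨hq, h⟩).trans (le_max_left _ _)
    · refine le_trans ?_ (le_max_right _ _)
      have hq1 : 1 ≤ q := hQ1.trans h
      have hq0 : 0 < q := by linarith
      have hq2 : 4 * C₂ ≤ q := (le_max_right _ _).trans h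
      have h1 := saddleBranch_eq hε (re_mul_sq_pos he hq0)
      have h2 := hC₂ q hq0
      set s := saddleBranch ε (e * (q : ℂ) ^ 2) with hs
      have h3 : 1 - Complex.exp s = e * (q : ℂ) ^ 2 - s := by linear_combination h1
      have h4 : q ^ 2 / 4 ≤ ‖1 - Complex.exp s‖ := by
        rw [h3]
        have := norm_sub_norm_le (e * (q : ℂ) ^ 2) s
        rw [norm_mul_sq he1] at this
        nlinarith
      rw [norm_mul, norm_inv, norm_mul, norm_mul, he1, Complex.norm_real,
        Real.norm_of_nonneg hq0.le]
      rw [inv_mul_le_iff₀ (lt_of_lt_of_le (by positivity) h4)]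
      simp only [Complex.norm_ofNat]
      nlinarith
  have hr0 : 0 ≤ ‖(2 * e) ^ (1 / 2 : ℂ)‖ := norm_nonneg _
  refine ⟨‖(2 * e) ^ (1 / 2 : ℂ)‖ * C₀ + Real.exp C₁ * max K 8, ?_, fun q hq => ?_⟩
  · have : (0 : ℝ) < max K 8 := lt_of_lt_of_le (by norm_num) (le_max_right _ _)
    positivity
  have hK8 : (0 : ℝ) < max K 8 := lt_of_lt_of_le (by norm_num) (le_max_right _ _)
  have hexp1 : 1 ≤ Real.exp (δ * q ^ 2) := Real.one_le_exp (by positivity)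
  rcases lt_or_ge (q ^ 2) (8 / 25) with h | h
  · rw [curveAmplitude_eq_chartAmplitude lam hε he he1 hq h]
    have hs5 := norm_saddleBranch_lt hε (re_mul_sq_pos he hq) (by rw [norm_mul_sq he1]; exact h)
    have h1 := (hC₀b 0).2 (saddleBranch ε (e * (q : ℂ) ^ 2)) (by simpa using hs5.le)
    simp only [chartRemainder, Nat.cast_zero, zero_add, mul_one, pow_zero, div_one] at h1
    have hεn : ‖(ε : ℂ)‖ = 1 := by rcases hε with rfl | rfl <;> simp
    rw [norm_mul, norm_mul, norm_mul, hεn, Complex.norm_I, one_mul, one_mul]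
    have h2 : ‖(2 * e) ^ (1 / 2 : ℂ)‖ * ‖chartAmplitude lam (saddleBranch ε (e * (q : ℂ) ^ 2))‖ ≤
        ‖(2 * e) ^ (1 / 2 : ℂ)‖ * C₀ := by gcongr
    have h3 : 0 ≤ Real.exp C₁ * max K 8 := by positivity
    have h4 : 0 ≤ ‖(2 * e) ^ (1 / 2 : ℂ)‖ * C₀ := by positivity
    nlinarith
  · have hq2 : 1 / 2 ≤ q := by nlinarith
    have h1 := hmid q hq2
    have h2 := hC₁ _ (re_mul_sq_pos he hq)
    rw [norm_mul_sq he1] at h2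
    rw [curveAmplitude, norm_mul, Complex.norm_exp]
    set s := saddleBranch ε (e * (q : ℂ) ^ 2) with hs
    have h3 : ((lam : ℂ) / 2 * s ^ 2 + s).re ≤ C₁ + δ * q ^ 2 := by
      refine (Complex.re_le_norm _).trans ((norm_add_le _ _).trans ?_)
      rw [norm_mul, norm_div, Complex.norm_real, Real.norm_of_nonneg hlam, norm_pow]
      simp only [Complex.norm_ofNat]
      linarith
    calc _ ≤ Real.exp (C₁ + δ * q ^ 2) * max K 8 := by gcongr
      _ = Real.exp C₁ * max K 8 * Real.exp (δ * q ^ 2) := by rw [Real.exp_add]; ring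
      _ ≤ _ := by gcongr; linarith [mul_nonneg hr0 hC₀.le]

end Curve

/-! ### The saddle point representation -/

section Representation

variable {lam : ℝ} {e w : ℂ}

theorem integrableOn_gauss_curveAmplitude (hlam : 0 ≤ lam) {ε : ℝ} (hε : ε = 1 ∨ ε = -1)
    (he : 0 < e.re) (he1 : ‖e‖ = 1) (hwe : 0 < (w * e).re) :
    IntegrableOn (fun q : ℝ => Complex.exp (-(w * e) * (q : ℂ) ^ 2) * curveAmplitude lam e ε q)
      (Set.Ioi 0) := by
  obtain ⟨C, hC0, hC⟩ := exists_norm_curveAmplitude_le hlam hε he he1 (half_pos hwe)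
  have hint : IntegrableOn (fun q : ℝ => C * Real.exp (-((w * e).re / 2) * q ^ 2)) (Set.Ioi 0) :=
    ((integrable_exp_neg_mul_sq (half_pos hwe)).const_mul C).integrableOn
  refine hint.mono' ?_ ?_
  · refine ContinuousOn.aestronglyMeasurable ?_ measurableSet_Ioi
    exact ContinuousOn.mul (by fun_prop) (continuousOn_curveAmplitude lam hε he)
  · refine (ae_restrict_iff' measurableSet_Ioi).2 (Eventually.of_forall fun q hq => ?_)
    rw [norm_mul, Complex.norm_exp, ← Complex.ofReal_pow, Complex.re_mul_ofReal, Complex.neg_re]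
    calc _ ≤ Real.exp (-(w * e).re * q ^ 2) * (C * Real.exp ((w * e).re / 2 * q ^ 2)) := by
          gcongr; exact hC q hq
      _ = C * Real.exp (-((w * e).re / 2) * q ^ 2) := by
          rw [mul_left_comm, ← Real.exp_add]; congr 2; ring

theorem abs_arg_add_arg_lt (he : 0 < e.re) (hw : w ∈ Complex.slitPlane) (hwe : 0 < (w * e).re) :
    |e.arg + w.arg| < Real.pi / 2 := by
  have he0 : e ≠ 0 := by rintro rfl; simp at he
  have hw0 : w ≠ 0 := Complex.slitPlane_ne_zero hw
  have h1 : |e.arg| < Real.pi / 2 := Complex.abs_arg_lt_pi_div_two_iff.2 (Or.inl he)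
  have h2 := Complex.neg_pi_lt_arg w
  have h3 : w.arg < Real.pi := lt_of_le_of_ne (Complex.arg_le_pi w)
    (Complex.mem_slitPlane_iff_arg.1 hw).1
  have hcos : (w * e).re = ‖e‖ * ‖w‖ * Real.cos (e.arg + w.arg) := by
    rw [Real.cos_add, Complex.mul_re, ← Complex.norm_mul_cos_arg e, ← Complex.norm_mul_sin_arg e,
      ← Complex.norm_mul_cos_arg w, ← Complex.norm_mul_sin_arg w]
    ring
  rw [hcos] at hwe
  have hpos : 0 < Real.cos (e.arg + w.arg) :=
    pos_of_mul_pos_right hwe (by positivity)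
  rw [abs_lt] at h1
  by_contra! h
  have h4 : |e.arg + w.arg| ≤ 3 * (Real.pi / 2) := by
    rw [abs_le]; constructor <;> linarith
  rw [← Real.cos_abs] at hpos
  have := Real.cos_nonpos_of_pi_div_two_le_of_le h (by linarith)
  linarith

/-- The contour through the saddle point `M = log ω`: along each of the two curves leaving the
saddle, the exponent is `-ω e q²`. -/
theorem hankelValue_eq_integral (hlam : 0 < lam) {ζ v : ℂ} (hw : w ∈ Complex.slitPlane)
    (hv : w = lam * v) (hζ : Complex.log w = ζ - v) (he : 0 < e.re) (he1 : ‖e‖ = 1)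
    (hwe : 0 < (w * e).re) :
    hankelValue lam ζ = Complex.exp (1 / (2 * (lam : ℂ)) * w ^ 2 + (1 - 1 / (lam : ℂ)) * w) *
      ∫ q in Set.Ioi (0 : ℝ), Complex.exp (-(w * e) * (q : ℂ) ^ 2) *
        (curveAmplitude lam e 1 q - curveAmplitude lam e (-1) q) := by
  obtain ⟨F, hF⟩ := exists_primitive_logKernel lam ζ
  have hw0 : w ≠ 0 := Complex.slitPlane_ne_zero hw
  have hlam0 : (lam : ℂ) ≠ 0 := by exact_mod_cast hlam.ne'
  set P := Complex.exp (1 / (2 * (lam : ℂ)) * w ^ 2 + (1 - 1 / (lam : ℂ)) * w) with hP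
  have hβ := abs_arg_add_arg_lt he hw hwe
  obtain ⟨β, hβ1, hβ2⟩ := exists_between hβ
  have key : ∀ ε : ℝ, ε = 1 ∨ ε = -1 →
      P * ∫ q in Set.Ioi (0 : ℝ), Complex.exp (-(w * e) * (q : ℂ) ^ 2) * curveAmplitude lam e ε q =
      (F ((ε * Real.pi : ℝ) * Complex.I) + ∫ t in Set.Ioi (0 : ℝ),
        logKernel lam ζ (t + (ε * Real.pi : ℝ) * Complex.I)) - F (Complex.log w) := by
    intro ε hε
    set s : ℝ → ℂ := fun q => saddleBranch ε (e * (q : ℂ) ^ 2) with hs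
    have hderiv : ∀ q ∈ Set.Ioi (0 : ℝ), HasDerivAt
        ((Set.Ioi (0 : ℝ)).piecewise (fun q => F (s q + Complex.log w)) fun _ => F (Complex.log w))
        (P * (Complex.exp (-(w * e) * (q : ℂ) ^ 2) * curveAmplitude lam e ε q)) q := by
      intro q hq
      have h1 := (hF (s q + Complex.log w)).comp_of_eq q
        ((hasDerivAt_curve hε he hq).add_const (Complex.log w)) rfl
      have h2 : logKernel lam ζ (s q + Complex.log w) = P * (Complex.exp (-(w * e) * (q : ℂ) ^ 2) *
          Complex.exp ((lam : ℂ) / 2 * s q ^ 2 + s q)) := by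
        have hy := saddleBranch_eq hε (re_mul_sq_pos he hq)
        change 1 + s q - Complex.exp (s q) = _ at hy
        rw [logKernel, Complex.exp_add (s q), Complex.exp_log hw0, hP, ← Complex.exp_add,
          ← Complex.exp_add]
        congr 1
        have h3 : -(w * e) * (q : ℂ) ^ 2 = -w * (1 + s q - Complex.exp (s q)) := by
          rw [hy]; ring
        rw [h3, hζ, hv]
        field_simp
        ring
      rw [h2] at h1
      refine (h1.congr_of_eventuallyEq (f := F ∘ fun q => s q + Complex.log w) ?_).congr_deriv ?_
      · filter_upwards [Ioi_mem_nhds hq] with t ht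
        rw [Set.piecewise_eq_of_mem _ _ _ ht]; rfl
      · rw [curveAmplitude]; ring
    have hcont : ContinuousWithinAt
        ((Set.Ioi (0 : ℝ)).piecewise (fun q => F (s q + Complex.log w)) fun _ => F (Complex.log w))
        (Set.Ici 0) 0 := by
      rw [← continuousWithinAt_Ioi_iff_Ici, ContinuousWithinAt,
        Set.piecewise_eq_of_notMem _ _ _ Set.self_notMem_Ioi]
      have h1 : Tendsto (fun q => F (s q + Complex.log w)) (𝓝[>] 0) (𝓝 (F (Complex.log w))) := by
        have h2 := (tendsto_curve_zero hε he he1).add_const (Complex.log w)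
        rw [zero_add] at h2
        exact (hF _).continuousAt.tendsto.comp h2
      refine h1.congr' ?_
      filter_upwards [self_mem_nhdsWithin] with t ht
      rw [Set.piecewise_eq_of_mem _ _ _ ht]
    obtain ⟨hre, him⟩ := tendsto_curve_atTop hε he he1
    have hlim := tendsto_primitive_logKernel hlam.le hF (c := ε * Real.pi)
      (by rcases hε with rfl | rfl <;> simp) hβ2 (l := atTop)
      (M := fun q => s q + Complex.log w)
      (by simpa using tendsto_atTop_add_const_right _ _ hre)
      (by
        have h1 : Tendsto (fun q => |(s q + Complex.log w).im - ε * Real.pi|) atTop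
            (𝓝 |e.arg + w.arg|) := by
          have h2 := ((him.add_const w.arg).sub_const (ε * Real.pi)).abs
          have h3 : ε * Real.pi + e.arg + w.arg - ε * Real.pi = e.arg + w.arg := by ring
          rw [h3] at h2
          simpa [Complex.log_im] using h2
        filter_upwards [h1.eventually_lt_const hβ1] with q hq using hq.le)
    have hlim' := hlim.congr' (f₂ := (Set.Ioi (0 : ℝ)).piecewise
      (fun q => F (s q + Complex.log w)) fun _ => F (Complex.log w)) (by
        filter_upwards [Ioi_mem_atTop 0] with t ht
        rw [Set.piecewise_eq_of_mem _ _ _ ht])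
    have h := integral_Ioi_of_hasDerivAt_of_tendsto hcont hderiv
      ((integrableOn_gauss_curveAmplitude hlam.le hε he he1 hwe).const_mul P) hlim'
    rw [integral_const_mul, Set.piecewise_eq_of_notMem _ _ _ Set.self_notMem_Ioi] at h
    exact h
  simp only [mul_sub]
  rw [integral_sub (integrableOn_gauss_curveAmplitude hlam.le (Or.inl rfl) he he1 hwe)
    (integrableOn_gauss_curveAmplitude hlam.le (Or.inr rfl) he he1 hwe), mul_sub,
    key 1 (Or.inl rfl), key (-1) (Or.inr rfl), hankelValue_eq hF]
  simp

end Representation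

/-! ### Gaussian moments -/

theorem integrableOn_pow_mul_gauss {b : ℝ} (hb : 0 < b) (n : ℕ) :
    IntegrableOn (fun q : ℝ => q ^ n * Real.exp (-b * q ^ 2)) (Set.Ioi 0) := by
  have h := integrable_rpow_mul_exp_neg_mul_sq hb (s := n)
    (by have : (0 : ℝ) ≤ n := Nat.cast_nonneg n
        linarith)
  simpa only [Real.rpow_natCast] using h.integrableOn

theorem integrableOn_pow_mul_cexp {μ : ℂ} (hμ : 0 < μ.re) (n : ℕ) :
    IntegrableOn (fun q : ℝ => (q : ℂ) ^ n * Complex.exp (-μ * (q : ℂ) ^ 2)) (Set.Ioi 0) := by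
  refine (integrableOn_pow_mul_gauss hμ n).mono' ?_ ?_
  · exact (Continuous.aestronglyMeasurable (by fun_prop))
  · refine (ae_restrict_iff' measurableSet_Ioi).2 (Eventually.of_forall fun q hq => ?_)
    have hq : (0 : ℝ) < q := hq
    rw [norm_mul, norm_pow, Complex.norm_real, Real.norm_of_nonneg hq.le, Complex.norm_exp,
      ← Complex.ofReal_pow, Complex.re_mul_ofReal, Complex.neg_re]

/-- The even moments of a complex Gaussian, by repeated integration by parts. -/
theorem integral_pow_mul_cexp {μ : ℂ} (hμ : 0 < μ.re) (n : ℕ) :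
    ∫ q in Set.Ioi (0 : ℝ), (q : ℂ) ^ (2 * n) * Complex.exp (-μ * (q : ℂ) ^ 2) =
      ((2 * n).factorial : ℂ) / (4 ^ n * (n.factorial : ℂ)) * (1 / μ) ^ n *
        ((Real.pi / μ) ^ (1 / 2 : ℂ) / 2) := by
  have hμ0 : μ ≠ 0 := by rintro rfl; simp at hμ
  induction n with
  | zero => simpa using integral_gaussian_complex_Ioi hμ
  | succ n ih =>
    have hd : ∀ q : ℝ, HasDerivAt
        (fun q : ℝ => (q : ℂ) ^ (2 * n + 1) * Complex.exp (-μ * (q : ℂ) ^ 2))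
        ((2 * n + 1) * ((q : ℂ) ^ (2 * n) * Complex.exp (-μ * (q : ℂ) ^ 2)) -
          2 * μ * ((q : ℂ) ^ (2 * (n + 1)) * Complex.exp (-μ * (q : ℂ) ^ 2))) q := by
      intro q
      have h1 := (hasDerivAt_id' (q : ℂ)).fun_pow (2 * n + 1)
      have h2 := (((hasDerivAt_id' (q : ℂ)).fun_pow 2).const_mul (-μ)).cexp
      have h3 := (h1.fun_mul h2).comp_ofReal
      refine h3.congr_deriv ?_
      push_cast
      ring
    have hlim : Tendsto (fun q : ℝ => (q : ℂ) ^ (2 * n + 1) * Complex.exp (-μ * (q : ℂ) ^ 2)) atTop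
        (𝓝 0) := by
      rw [tendsto_zero_iff_norm_tendsto_zero]
      have h1 := (rpow_mul_exp_neg_mul_sq_isLittleO_exp_neg hμ (2 * n + 1)).tendsto_zero_of_tendsto
        (by
          have := tendsto_id.const_mul_atTop (by norm_num : (0 : ℝ) < 1 / 2)
          exact (Real.tendsto_exp_neg_atTop_nhds_zero.comp this).congr fun q => by simp)
      refine h1.congr' ?_
      filter_upwards [eventually_gt_atTop 0] with q hq
      rw [norm_mul, norm_pow, Complex.norm_real, Real.norm_of_nonneg hq.le, Complex.norm_exp,
        ← Complex.ofReal_pow, Complex.re_mul_ofReal, Complex.neg_re]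
      congr 1
      exact_mod_cast Real.rpow_natCast q (2 * n + 1)
    have h := integral_Ioi_of_hasDerivAt_of_tendsto' (a := 0) (fun q _ => hd q)
      (((integrableOn_pow_mul_cexp hμ (2 * n)).const_mul _).sub
        ((integrableOn_pow_mul_cexp hμ (2 * (n + 1))).const_mul _)) hlim
    rw [integral_sub ((integrableOn_pow_mul_cexp hμ (2 * n)).const_mul _)
      ((integrableOn_pow_mul_cexp hμ (2 * (n + 1))).const_mul _), integral_const_mul,
      integral_const_mul, ih] at h
    have h4 : ∫ q in Set.Ioi (0 : ℝ), (q : ℂ) ^ (2 * (n + 1)) * Complex.exp (-μ * (q : ℂ) ^ 2) =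
        (2 * n + 1) / (2 * μ) * (((2 * n).factorial : ℂ) / (4 ^ n * (n.factorial : ℂ)) *
          (1 / μ) ^ n * ((Real.pi / μ) ^ (1 / 2 : ℂ) / 2)) := by
      generalize ((2 * n).factorial : ℂ) / (4 ^ n * (n.factorial : ℂ)) * (1 / μ) ^ n *
        ((Real.pi / μ) ^ (1 / 2 : ℂ) / 2) = X at h ⊢
      generalize ∫ q in Set.Ioi (0 : ℝ), (q : ℂ) ^ (2 * (n + 1)) *
        Complex.exp (-μ * (q : ℂ) ^ 2) = J at h ⊢
      have h0 : (((0 : ℝ) : ℂ)) ^ (2 * n + 1) = 0 := by simp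
      rw [h0, zero_mul, sub_zero] at h
      field_simp
      linear_combination -h
    rw [h4]
    have h5 : (2 * (n + 1)).factorial = (2 * n + 2) * ((2 * n + 1) * (2 * n).factorial) := by
      rw [show 2 * (n + 1) = (2 * n + 1) + 1 by ring, Nat.factorial_succ, Nat.factorial_succ]
    have h6 : (n.factorial : ℂ) ≠ 0 := by exact_mod_cast n.factorial_ne_zero
    have h7 : (n + 1 : ℂ) ≠ 0 := by exact_mod_cast n.succ_ne_zero
    rw [h5, Nat.factorial_succ]
    push_cast
    rw [pow_succ, pow_succ]
    field_simp
    ring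

/-- The real even moments, bounded through `(2n)! ≤ 4 ^ n (n!)²`. -/
theorem integral_pow_mul_gauss_le {b : ℝ} (hb : 0 < b) (n : ℕ) :
    ∫ q in Set.Ioi (0 : ℝ), q ^ (2 * n) * Real.exp (-b * q ^ 2) ≤
      n.factorial * (1 / b) ^ n * (Real.sqrt (Real.pi / b) / 2) := by
  have h := integral_pow_mul_cexp (μ := b) (by simpa using hb) n
  have h1 : ∀ q : ℝ, (q : ℂ) ^ (2 * n) * Complex.exp (-(b : ℂ) * (q : ℂ) ^ 2) =
      ((q ^ (2 * n) * Real.exp (-b * q ^ 2) : ℝ) : ℂ) := by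
    intro q; push_cast; rfl
  simp only [h1] at h
  rw [integral_complex_ofReal] at h
  have h2 : ((Real.pi : ℂ) / b) ^ (1 / 2 : ℂ) = ((Real.sqrt (Real.pi / b) : ℝ) : ℂ) := by
    rw [Real.sqrt_eq_rpow, Complex.ofReal_cpow (by positivity)]
    push_cast; rfl
  rw [h2] at h
  have h3 : ∫ q in Set.Ioi (0 : ℝ), q ^ (2 * n) * Real.exp (-b * q ^ 2) =
      (2 * n).factorial / (4 ^ n * n.factorial) * (1 / b) ^ n * (Real.sqrt (Real.pi / b) / 2) := by
    apply Complex.ofReal_injective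
    push_cast
    refine Eq.trans ?_ h
    rfl
  rw [h3]
  have h4 : ((2 * n).factorial : ℝ) / (4 ^ n * n.factorial) ≤ n.factorial := by
    rw [div_le_iff₀ (by positivity)]
    have h5 : (2 * n).factorial = n.centralBinom * n.factorial * n.factorial := by
      have := Nat.choose_mul_factorial_mul_factorial (n := 2 * n) (k := n) (by omega)
      rw [← this, Nat.centralBinom]
      congr 2; omega
    have h6 : n.centralBinom ≤ 4 ^ n := by
      rw [Nat.centralBinom]
      calc (2 * n).choose n ≤ 2 ^ (2 * n) := Nat.choose_le_two_pow _ _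
        _ = 4 ^ n := by rw [pow_mul]; norm_num
    rw [h5]
    push_cast
    have h7 : (n.centralBinom : ℝ) ≤ 4 ^ n := by exact_mod_cast h6
    have h8 : (0 : ℝ) ≤ n.factorial * n.factorial := by positivity
    nlinarith
  gcongr

/-! ### The remainder estimate -/

theorem coeffV_zero (lam : ℝ) : coeffV lam 0 = 1 := by
  rw [← chartRemainder_zero_eq_coeffV]
  simp [chartRemainder, chartAmplitude, deriv_saddleChart_zero]

theorem sum_even_part (c : ℕ → ℂ) (z : ℂ) (M : ℕ) :
    ∑ n ∈ Finset.range (2 * M), c n * z ^ n + ∑ n ∈ Finset.range (2 * M), c n * (-z) ^ n =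
      2 * ∑ j ∈ Finset.range M, c (2 * j) * (z ^ 2) ^ j := by
  induction M with
  | zero => simp
  | succ M ih =>
    rw [show 2 * (M + 1) = 2 * M + 1 + 1 by ring]
    simp only [Finset.sum_range_succ]
    have h1 : (-z) ^ (2 * M) = z ^ (2 * M) := by rw [pow_mul, neg_sq, pow_mul]
    have h2 : (-z) ^ (2 * M + 1) = -z ^ (2 * M + 1) := by rw [pow_succ, h1, pow_succ]; ring
    rw [h1, h2, ← pow_mul]
    linear_combination ih

theorem norm_cpow_half_sq (z : ℂ) : ‖z ^ (1 / 2 : ℂ)‖ ^ 2 = ‖z‖ := by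
  rw [← norm_pow, cpow_half_sq]

/-- The polynomial that approximates the difference of the two curve amplitudes near `q = 0`. -/
noncomputable def amplitudePoly (lam : ℝ) (e : ℂ) (N : ℕ) (q : ℝ) : ℂ :=
  2 * (Complex.I * (2 * e) ^ (1 / 2 : ℂ)) *
    ∑ j ∈ Finset.range (N + 1), coeffV lam (2 * j) * ((-2 * e) ^ j * (q : ℂ) ^ (2 * j))

/-- Taylor remainder of the amplitude, uniform in `N` and on the whole half-line: beyond the disc of
convergence the amplitude and every term of the polynomial are dominated by
`(q² / (8/25)) ^ (N + 1)`. -/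
theorem exists_norm_amplitude_sub_le {lam : ℝ} (hlam : 0 ≤ lam) {e : ℂ} (he : 0 < e.re)
    (he1 : ‖e‖ = 1) {δ : ℝ} (hδ : 0 < δ) :
    ∃ C : ℝ, 0 < C ∧ ∀ (N : ℕ) (q : ℝ), 0 < q →
      ‖curveAmplitude lam e 1 q - curveAmplitude lam e (-1) q - amplitudePoly lam e N q‖ ≤
        C * (N + 1) * (q ^ 2 / (8 / 25)) ^ (N + 1) * Real.exp (δ * q ^ 2) := by
  obtain ⟨C, hC0, hC⟩ := exists_chartAmplitude_bounds lam
  obtain ⟨K₁, hK₁, hb₁⟩ := exists_norm_curveAmplitude_le (ε := 1) hlam (Or.inl rfl) he he1 hδ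
  obtain ⟨K₂, hK₂, hb₂⟩ := exists_norm_curveAmplitude_le (ε := -1) hlam (Or.inr rfl) he he1 hδ
  refine ⟨12 * C + K₁ + K₂, by positivity, fun N q hq => ?_⟩
  set r := (2 * e) ^ (1 / 2 : ℂ) with hr
  have hr2 : r ^ 2 = 2 * e := cpow_half_sq _
  have hrn : ‖r‖ ^ 2 = 2 := by rw [hr, norm_cpow_half_sq, norm_mul, he1]; simp
  have hrn2 : ‖r‖ ≤ 2 := by nlinarith [norm_nonneg r]
  have hexp1 : 1 ≤ Real.exp (δ * q ^ 2) := Real.one_le_exp (by positivity)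
  set t := q ^ 2 / (8 / 25) with ht
  have ht0 : 0 < t := by positivity
  have hN : (0 : ℝ) ≤ N := Nat.cast_nonneg N
  rcases lt_or_ge (q ^ 2) (8 / 25) with h | h
  -- inside the disc of the saddle chart: the Taylor remainders at `± σ`
  · set s₁ := saddleBranch 1 (e * q ^ 2) with hs₁
    set s₂ := saddleBranch (-1) (e * q ^ 2) with hs₂
    have hy := re_mul_sq_pos he hq
    have hyn : ‖e * (q : ℂ) ^ 2‖ < 8 / 25 := by rw [norm_mul_sq he1]; exact h
    have hm₁ : s₁ ∈ Metric.closedBall (0 : ℂ) (5 / 4) := by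
      simpa using (norm_saddleBranch_lt (Or.inl rfl) hy hyn).le
    have hm₂ : s₂ ∈ Metric.closedBall (0 : ℂ) (5 / 4) := by
      simpa using (norm_saddleBranch_lt (Or.inr rfl) hy hyn).le
    set z := -(Complex.I * q * r) with hz
    have hσ₁ : s₁ * saddleFactor s₁ = z := by
      have := saddleChart_curve (Or.inl rfl) he he1 hq h
      rw [saddleChart] at this
      rw [this, hz]; push_cast; ring
    have hσ₂ : s₂ * saddleFactor s₂ = -z := by
      have := saddleChart_curve (Or.inr rfl) he he1 hq h
      rw [saddleChart] at this
      rw [this, hz]; push_cast; ring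
    have hz2 : z ^ 2 = -2 * e * (q : ℂ) ^ 2 := by
      have : z ^ 2 = Complex.I ^ 2 * q ^ 2 * r ^ 2 := by rw [hz]; ring
      rw [this, Complex.I_sq, hr2]; ring
    have hzn : ‖z‖ ^ 2 = 2 * q ^ 2 := by
      rw [← norm_pow, hz2, mul_assoc, norm_mul, norm_mul_sq he1]; simp
    have hx₁ := chart_expansion (f := chartAmplitude lam) saddleFactor_ne_zero (2 * (N + 1))
      (closedBall_subset_saddleDisc hm₁)
    have hx₂ := chart_expansion (f := chartAmplitude lam) saddleFactor_ne_zero (2 * (N + 1))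
      (closedBall_subset_saddleDisc hm₂)
    simp only [chartRemainder_zero_eq_coeffV, hσ₁] at hx₁
    simp only [chartRemainder_zero_eq_coeffV, hσ₂] at hx₂
    set R₁ := chartRemainder saddleFactor (chartAmplitude lam) (2 * (N + 1)) s₁ with hR₁
    set R₂ := chartRemainder saddleFactor (chartAmplitude lam) (2 * (N + 1)) s₂ with hR₂
    have hpoly : amplitudePoly lam e N q = Complex.I * r *
        (2 * ∑ j ∈ Finset.range (N + 1), coeffV lam (2 * j) * (z ^ 2) ^ j) := by
      rw [amplitudePoly, ← hr]
      have : ∀ j ∈ Finset.range (N + 1), coeffV lam (2 * j) * ((-2 * e) ^ j * (q : ℂ) ^ (2 * j)) =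
          coeffV lam (2 * j) * (z ^ 2) ^ j := by
        intro j _
        rw [hz2, pow_mul, ← mul_pow]
      rw [Finset.sum_congr rfl this]
      ring
    have hdiff : curveAmplitude lam e 1 q - curveAmplitude lam e (-1) q - amplitudePoly lam e N q =
        Complex.I * r * (z ^ (2 * (N + 1)) * (R₁ + R₂)) := by
      rw [curveAmplitude_eq_chartAmplitude lam (Or.inl rfl) he he1 hq h,
        curveAmplitude_eq_chartAmplitude lam (Or.inr rfl) he he1 hq h, ← hs₁, ← hs₂, ← hr, hx₁, hx₂,
        hpoly, ← sum_even_part]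
      have h1 : (-z) ^ (2 * (N + 1)) = z ^ (2 * (N + 1)) := by rw [pow_mul, neg_sq, pow_mul]
      rw [h1]
      push_cast
      ring
    have hzt : ‖z‖ ^ (2 * (N + 1)) = t ^ (N + 1) * (4 / 5) ^ (2 * (N + 1)) := by
      rw [pow_mul, pow_mul, ← mul_pow, hzn]
      congr 1
      rw [ht]; ring
    have hRb : ‖R₁ + R₂‖ ≤ 2 * (C * (2 * N + 3) / (4 / 5) ^ (2 * (N + 1))) := by
      have h1 := (hC (2 * (N + 1))).2 s₁ hm₁
      have h2 := (hC (2 * (N + 1))).2 s₂ hm₂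
      have h3 : (((2 * (N + 1) : ℕ) : ℝ) + 1) = 2 * N + 3 := by push_cast; ring
      rw [h3] at h1 h2
      exact (norm_add_le _ _).trans (by linarith)
    rw [hdiff, norm_mul, norm_mul, Complex.norm_I, one_mul, norm_mul, norm_pow, hzt]
    calc _ ≤ 2 * (t ^ (N + 1) * (4 / 5) ^ (2 * (N + 1)) *
            (2 * (C * (2 * N + 3) / (4 / 5) ^ (2 * (N + 1))))) := by gcongr
      _ = 4 * C * (2 * N + 3) * t ^ (N + 1) * 1 := by field_simp; ring
      _ ≤ (12 * C + K₁ + K₂) * (N + 1) * t ^ (N + 1) * Real.exp (δ * q ^ 2) := by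
          have : 4 * C * (2 * N + 3) ≤ (12 * C + K₁ + K₂) * (N + 1) := by nlinarith
          gcongr
  -- outside, `t ≥ 1` and every term is estimated separately
  · have ht1 : 1 ≤ t := by rw [ht, one_le_div (by norm_num)]; exact h
    have htp : 1 ≤ t ^ (N + 1) := one_le_pow₀ ht1
    have hpoly : ‖amplitudePoly lam e N q‖ ≤ 4 * C * (N + 1) * t ^ (N + 1) := by
      rw [amplitudePoly, ← hr, norm_mul, norm_mul, norm_mul, Complex.norm_I, one_mul,
        Complex.norm_ofNat]
      have hsum : ‖∑ j ∈ Finset.range (N + 1),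
          coeffV lam (2 * j) * ((-2 * e) ^ j * (q : ℂ) ^ (2 * j))‖ ≤
          ∑ _j ∈ Finset.range (N + 1), C * t ^ (N + 1) := by
        refine (norm_sum_le _ _).trans (Finset.sum_le_sum fun j hj => ?_)
        have h1 := (hC (2 * j)).1
        have h2 : ‖(-2 * e) ^ j * (q : ℂ) ^ (2 * j)‖ = t ^ j * (4 / 5) ^ (2 * j) := by
          rw [pow_mul, ← mul_pow, norm_pow, mul_assoc, norm_mul, norm_mul_sq he1, pow_mul,
            ← mul_pow]
          congr 1
          rw [ht, norm_neg, Complex.norm_ofNat]; ring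
        rw [norm_mul, h2]
        calc _ ≤ C / (4 / 5) ^ (2 * j) * (t ^ j * (4 / 5) ^ (2 * j)) := by gcongr
          _ = C * t ^ j := by field_simp
          _ ≤ C * t ^ (N + 1) := by
              have := pow_le_pow_right₀ ht1 (Finset.mem_range.1 hj).le
              gcongr
      rw [Finset.sum_const, Finset.card_range, nsmul_eq_mul] at hsum
      push_cast at hsum
      calc _ ≤ 2 * 2 * ((N + 1) * (C * t ^ (N + 1))) := by gcongr
        _ = _ := by ring
    have h1 : ‖curveAmplitude lam e 1 q - curveAmplitude lam e (-1) q‖ ≤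
        (K₁ + K₂) * Real.exp (δ * q ^ 2) := by
      refine (norm_sub_le _ _).trans ?_
      linarith [hb₁ q hq, hb₂ q hq]
    refine (norm_sub_le _ _).trans ?_
    set E := Real.exp (δ * q ^ 2)
    have h2 : (K₁ + K₂) * E ≤ (K₁ + K₂) * ((N + 1) * t ^ (N + 1)) * E := by
      have : 1 ≤ (N + 1) * t ^ (N + 1) := by nlinarith
      have h3 : 0 ≤ (K₁ + K₂) * E := by positivity
      nlinarith
    have h3 : 4 * C * (N + 1) * t ^ (N + 1) ≤ 12 * C * ((N + 1) * t ^ (N + 1)) * E := by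
      have h4 : 0 ≤ C * ((N + 1) * t ^ (N + 1)) := by positivity
      nlinarith
    calc _ ≤ (K₁ + K₂) * ((N + 1) * t ^ (N + 1)) * E + 12 * C * ((N + 1) * t ^ (N + 1)) * E := by
          linarith
      _ = _ := by ring

/-- Compatibility of the principal square roots along the rotated contour. -/
theorem cpow_half_mul_cpow_half {e w : ℂ} (he : 0 < e.re) (hw : w ∈ Complex.slitPlane)
    (hwe : 0 < (w * e).re) :
    (2 * e) ^ (1 / 2 : ℂ) * (Real.pi / (w * e)) ^ (1 / 2 : ℂ) =
      (2 * (Real.pi : ℂ) / w) ^ (1 / 2 : ℂ) := by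
  have he0 : e ≠ 0 := by rintro rfl; simp at he
  have hw0 : w ≠ 0 := Complex.slitPlane_ne_zero hw
  have h2e : 0 < (2 * e).re := by simpa using he
  have hpos : 0 < (Real.pi / (w * e) : ℂ).re := by
    rw [Complex.div_re]
    simp only [Complex.ofReal_re, Complex.ofReal_im, zero_mul, zero_div, add_zero]
    have : 0 < Complex.normSq (w * e) := Complex.normSq_pos.2 (mul_ne_zero hw0 he0)
    have := Real.pi_pos
    positivity
  have hslit : 2 * (Real.pi : ℂ) / w ∈ Complex.slitPlane := by
    have h1 : 2 * (Real.pi : ℂ) / w = ((2 * Real.pi : ℝ) : ℂ) * w⁻¹ := by push_cast; ring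
    rw [h1, Complex.mem_slitPlane_iff_arg, Complex.arg_real_mul _ (by positivity)]
    refine ⟨?_, mul_ne_zero (by exact_mod_cast (by positivity : 2 * Real.pi ≠ 0))
      (inv_ne_zero hw0)⟩
    have h2 := (Complex.mem_slitPlane_iff_arg.1 hw).1
    rw [Complex.arg_inv, if_neg h2]
    exact fun h3 => (Complex.neg_pi_lt_arg w).ne (by linarith)
  set a := (2 * e) ^ (1 / 2 : ℂ) with ha
  set b := (Real.pi / (w * e) : ℂ) ^ (1 / 2 : ℂ) with hb
  set c := (2 * (Real.pi : ℂ) / w) ^ (1 / 2 : ℂ) with hc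
  have ha2 : a ^ 2 = 2 * e := cpow_half_sq _
  have hb2 : b ^ 2 = Real.pi / (w * e) := cpow_half_sq _
  have hc2 : c ^ 2 = 2 * (Real.pi : ℂ) / w := cpow_half_sq _
  have ha0 : 0 < a.re := cpow_half_re_pos (Or.inl h2e)
  have hb0 : 0 < b.re := cpow_half_re_pos (Or.inl hpos)
  have hc0 : 0 < c.re := cpow_half_re_pos hslit
  have hsq : (a * b) ^ 2 = c ^ 2 := by
    rw [mul_pow, ha2, hb2, hc2]; field_simp
  have hab : 0 < (a * b).re := by
    rw [← ha2, sq, Complex.mul_re] at h2e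
    rw [← hb2, sq, Complex.mul_re] at hpos
    have h1 : |a.im| < a.re := abs_lt_of_sq_lt_sq (by nlinarith) ha0.le
    have h2 : |b.im| < b.re := abs_lt_of_sq_lt_sq (by nlinarith) hb0.le
    have h3 : |a.im * b.im| < a.re * b.re := by
      rw [abs_mul]; exact mul_lt_mul'' h1 h2 (abs_nonneg _) (abs_nonneg _)
    rw [Complex.mul_re]
    linarith [le_abs_self (a.im * b.im)]
  rcases sq_eq_sq_iff_eq_or_eq_neg.1 hsq with h | h
  · exact h
  · rw [h, Complex.neg_re] at hab
    linarith

theorem integral_amplitudePoly (lam : ℝ) {e w : ℂ} (he : 0 < e.re) (hw : w ∈ Complex.slitPlane)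
    (hwe : 0 < (w * e).re) (N : ℕ) :
    IntegrableOn (fun q : ℝ => Complex.exp (-(w * e) * (q : ℂ) ^ 2) * amplitudePoly lam e N q)
      (Set.Ioi 0) ∧
    ∫ q in Set.Ioi (0 : ℝ), Complex.exp (-(w * e) * (q : ℂ) ^ 2) * amplitudePoly lam e N q =
      Complex.I * (2 * (Real.pi : ℂ) / w) ^ (1 / 2 : ℂ) * partialU lam N w := by
  have he0 : e ≠ 0 := by rintro rfl; simp at he
  have hw0 : w ≠ 0 := Complex.slitPlane_ne_zero hw
  set r := (2 * e) ^ (1 / 2 : ℂ) with hr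
  have heq : ∀ q : ℝ, Complex.exp (-(w * e) * (q : ℂ) ^ 2) * amplitudePoly lam e N q =
      ∑ j ∈ Finset.range (N + 1), (2 * (Complex.I * r) * (coeffV lam (2 * j) * (-2 * e) ^ j)) *
        ((q : ℂ) ^ (2 * j) * Complex.exp (-(w * e) * (q : ℂ) ^ 2)) := by
    intro q
    rw [amplitudePoly, ← hr, Finset.mul_sum, Finset.mul_sum]
    exact Finset.sum_congr rfl fun j _ => by ring
  have hint : ∀ j ∈ Finset.range (N + 1), IntegrableOn (fun q : ℝ =>
      (2 * (Complex.I * r) * (coeffV lam (2 * j) * (-2 * e) ^ j)) *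
        ((q : ℂ) ^ (2 * j) * Complex.exp (-(w * e) * (q : ℂ) ^ 2))) (Set.Ioi 0) :=
    fun j _ => (integrableOn_pow_mul_cexp hwe (2 * j)).const_mul _
  simp only [heq]
  refine ⟨integrable_finsetSum _ hint, ?_⟩
  rw [integral_finsetSum _ hint]
  simp only [integral_const_mul, integral_pow_mul_cexp hwe]
  rw [← cpow_half_mul_cpow_half he hw hwe, ← hr]
  have hU : partialU lam N w = ∑ j ∈ Finset.range (N + 1),
      (((2 * j).factorial : ℂ) * coeffV lam (2 * j) / (2 ^ j * (j.factorial : ℂ))) *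
        (-1 / w) ^ j := by
    rw [partialU, Finset.sum_range_succ', Finset.range_eq_Ico,
      Finset.sum_Ico_add' (fun j => (((2 * j).factorial : ℂ) * coeffV lam (2 * j) /
        (2 ^ j * (j.factorial : ℂ))) * (-1 / w) ^ j) 0 N 1]
    simp [coeffV_zero, add_comm]
    rfl
  rw [hU, Finset.mul_sum]
  refine Finset.sum_congr rfl fun j _ => ?_
  have h1 : (4 : ℂ) ^ j = 2 ^ j * 2 ^ j := by rw [← mul_pow]; norm_num
  have h2 : (j.factorial : ℂ) ≠ 0 := by exact_mod_cast j.factorial_ne_zero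
  rw [h1, neg_mul, neg_pow (2 * e), mul_pow, div_pow, div_pow, mul_pow, one_pow]
  field_simp

/-- Watson's lemma with bounds of Gevrey type along a ray on which `Re (w e) ≥ (13/25) |w|`. The
rate `25/4` is the inverse of `(1/2) (8/25)`, the decay rate left for the Gaussian times the radius
of the disc in the `q²`-plane. -/
theorem exists_watson_bound {lam : ℝ} (hlam : 0 < lam) {e : ℂ} (he : 0 < e.re) (he1 : ‖e‖ = 1)
    {w₀ : ℝ} (hw₀ : 0 < w₀) :
    ∃ C : ℝ, 0 < C ∧ ∀ (N : ℕ) (w : ℂ), w ∈ Complex.slitPlane → w₀ ≤ ‖w‖ →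
      13 / 25 * ‖w‖ ≤ (w * e).re →
      ‖(∫ q in Set.Ioi (0 : ℝ), Complex.exp (-(w * e) * (q : ℂ) ^ 2) *
        (curveAmplitude lam e 1 q - curveAmplitude lam e (-1) q)) /
          (Complex.I * (2 * (Real.pi : ℂ) / w) ^ (1 / 2 : ℂ)) - partialU lam N w‖ ≤
        C * (N + 1) * (25 / 4) ^ (N + 1) * (N + 1).factorial / ‖w‖ ^ (N + 1) := by
  obtain ⟨C, hC0, hC⟩ := exists_norm_amplitude_sub_le hlam.le he he1
    (by positivity : 0 < w₀ / 50)
  refine ⟨C, hC0, fun N w hw hwn hwe' => ?_⟩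
  have hw0 : 0 < ‖w‖ := hw₀.trans_le hwn
  have hwe : 0 < (w * e).re := lt_of_lt_of_le (by positivity) hwe'
  have hwz : w ≠ 0 := Complex.slitPlane_ne_zero hw
  obtain ⟨hpi, hpv⟩ := integral_amplitudePoly lam he hw hwe N
  set c := (2 * (Real.pi : ℂ) / w) ^ (1 / 2 : ℂ) with hc
  have hcn : ‖c‖ = Real.sqrt (2 * Real.pi / ‖w‖) := by
    rw [eq_comm, Real.sqrt_eq_iff_eq_sq (by positivity) (norm_nonneg _), hc, norm_cpow_half_sq,
      norm_div, norm_mul, Complex.norm_real, Real.norm_of_nonneg Real.pi_pos.le,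
      Complex.norm_ofNat]
  have hcpos : 0 < ‖c‖ := by
    rw [hcn]; apply Real.sqrt_pos.2; have := Real.pi_pos; positivity
  have hI : Complex.I * c ≠ 0 := mul_ne_zero Complex.I_ne_zero (norm_pos_iff.1 hcpos)
  have hHi : IntegrableOn (fun q : ℝ => Complex.exp (-(w * e) * (q : ℂ) ^ 2) *
      (curveAmplitude lam e 1 q - curveAmplitude lam e (-1) q)) (Set.Ioi 0) := by
    simp only [mul_sub]
    exact (integrableOn_gauss_curveAmplitude hlam.le (Or.inl rfl) he he1 hwe).sub
      (integrableOn_gauss_curveAmplitude hlam.le (Or.inr rfl) he he1 hwe)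
  set J := ∫ q in Set.Ioi (0 : ℝ), Complex.exp (-(w * e) * (q : ℂ) ^ 2) *
        (curveAmplitude lam e 1 q - curveAmplitude lam e (-1) q) with hJ
  have hdiff : J - Complex.I * c * partialU lam N w = ∫ q in Set.Ioi (0 : ℝ),
      Complex.exp (-(w * e) * (q : ℂ) ^ 2) * (curveAmplitude lam e 1 q -
        curveAmplitude lam e (-1) q - amplitudePoly lam e N q) := by
    rw [← hpv, hJ, ← integral_sub hHi hpi]
    refine integral_congr_ae (Eventually.of_forall fun q => ?_)
    simp only; ring
  set b := ‖w‖ / 2 with hb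
  have hb0 : 0 < b := by positivity
  have hbound : ‖J - Complex.I * c * partialU lam N w‖ ≤
      (C * (N + 1) * (25 / 8) ^ (N + 1)) *
        ∫ q in Set.Ioi (0 : ℝ), q ^ (2 * (N + 1)) * Real.exp (-b * q ^ 2) := by
    rw [hdiff, ← integral_const_mul]
    refine norm_integral_le_of_norm_le ((integrableOn_pow_mul_gauss hb0 _).const_mul _) ?_
    refine (ae_restrict_iff' measurableSet_Ioi).2 (Eventually.of_forall fun q hq => ?_)
    rw [norm_mul, Complex.norm_exp, ← Complex.ofReal_pow, Complex.re_mul_ofReal, Complex.neg_re]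
    calc _ ≤ Real.exp (-(w * e).re * q ^ 2) * (C * (N + 1) * (q ^ 2 / (8 / 25)) ^ (N + 1) *
          Real.exp (w₀ / 50 * q ^ 2)) := by gcongr; exact hC N q hq
      _ = C * (N + 1) * (q ^ 2 / (8 / 25)) ^ (N + 1) *
          Real.exp (-((w * e).re - w₀ / 50) * q ^ 2) := by
          rw [mul_left_comm, ← Real.exp_add]; congr 2; ring
      _ ≤ C * (N + 1) * (q ^ 2 / (8 / 25)) ^ (N + 1) * Real.exp (-b * q ^ 2) := by
          -- `13/25 - 1/50 = 1/2`
          have h1 : b ≤ (w * e).re - w₀ / 50 := by rw [hb]; linarith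
          gcongr
      _ = C * (N + 1) * (25 / 8) ^ (N + 1) * (q ^ (2 * (N + 1)) * Real.exp (-b * q ^ 2)) := by
          rw [show q ^ 2 / (8 / 25) = 25 / 8 * q ^ 2 by ring, mul_pow, pow_mul]; ring
  have hsqrt : Real.sqrt (Real.pi / b) = ‖c‖ := by
    rw [hcn, hb]; congr 1; field_simp
  have hquot : J / (Complex.I * c) - partialU lam N w =
      (J - Complex.I * c * partialU lam N w) / (Complex.I * c) := by
    rw [sub_div, mul_div_cancel_left₀ _ hI]
  rw [hquot, norm_div, norm_mul, Complex.norm_I, one_mul, div_le_iff₀ hcpos]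
  have hm := integral_pow_mul_gauss_le hb0 (N + 1)
  rw [hsqrt] at hm
  calc _ ≤ (C * (N + 1) * (25 / 8) ^ (N + 1)) *
        ((N + 1).factorial * (1 / b) ^ (N + 1) * (‖c‖ / 2)) :=
        hbound.trans (by gcongr)
    _ = C * (N + 1) * (25 / 4) ^ (N + 1) * (N + 1).factorial / ‖w‖ ^ (N + 1) * ‖c‖ * (1 / 2) := by
        have h1 : (25 / 4 : ℝ) ^ (N + 1) = (25 / 8) ^ (N + 1) * 2 ^ (N + 1) := by
          rw [← mul_pow]; norm_num
        have h2 : (1 / b) ^ (N + 1) = 2 ^ (N + 1) / ‖w‖ ^ (N + 1) := by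
          rw [hb, ← div_pow]; congr 1; field_simp
        rw [h1, h2]; ring
    _ ≤ _ := by
        have : 0 ≤ C * (N + 1) * (25 / 4) ^ (N + 1) * (N + 1).factorial / ‖w‖ ^ (N + 1) * ‖c‖ := by
          positivity
        linarith

/-- `A > 25/4` absorbs the polynomial factors. -/
theorem exists_absorb {A : ℝ} (hA : 25 / 4 < A) : ∃ K : ℝ, 0 < K ∧ ∀ N : ℕ,
    ((N : ℝ) + 1) * (25 / 4) ^ (N + 1) * (N + 1).factorial ≤ K * A ^ N * N.factorial := by
  have hA0 : 0 < A := by linarith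
  have hq : |25 / 4 / A| < 1 := by
    rw [abs_of_pos (by positivity), div_lt_one hA0]; exact hA
  have h2 := tendsto_pow_const_mul_const_pow_of_abs_lt_one 2 hq
  have h1 := tendsto_pow_const_mul_const_pow_of_abs_lt_one 1 hq
  have h0 := tendsto_pow_const_mul_const_pow_of_abs_lt_one 0 hq
  have hlim : Tendsto (fun n : ℕ => ((n : ℝ) + 1) ^ 2 * (25 / 4 / A) ^ n) atTop (𝓝 0) := by
    have h := (h2.add (h1.const_mul 2)).add h0
    simp only [mul_zero, add_zero] at h
    refine h.congr fun n => ?_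
    ring
  obtain ⟨K, hK⟩ := hlim.bddAbove_range
  have hKb : ∀ n : ℕ, ((n : ℝ) + 1) ^ 2 * (25 / 4 / A) ^ n ≤ K := fun n => hK ⟨n, rfl⟩
  have hK0 : 0 < K := lt_of_lt_of_le one_pos (by simpa using hKb 0)
  refine ⟨25 / 4 * K, by positivity, fun N => ?_⟩
  have h3 := hKb N
  rw [div_pow, ← mul_div_assoc, div_le_iff₀ (by positivity)] at h3
  rw [Nat.factorial_succ, pow_succ]
  push_cast
  have h4 : (0 : ℝ) ≤ N.factorial := by positivity
  calc _ = 25 / 4 * (((N : ℝ) + 1) ^ 2 * (25 / 4) ^ N) * N.factorial := by ring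
    _ ≤ 25 / 4 * (K * A ^ N) * N.factorial := by gcongr
    _ = _ := by ring

/-- The direction `e = (3 - 4i)/5` of the rotated contour for `Im w ≥ 0`; its conjugate serves for
`Im w ≤ 0`. -/
noncomputable def lowerDir : ℂ := ⟨3 / 5, -4 / 5⟩

/-- The direction `e = (3 + 4i)/5`, conjugate to `lowerDir`. -/
noncomputable def upperDir : ℂ := ⟨3 / 5, 4 / 5⟩

theorem norm_dir : ‖lowerDir‖ = 1 ∧ ‖upperDir‖ = 1 := by
  constructor <;>
  · rw [← sq_eq_sq₀ (norm_nonneg _) zero_le_one, Complex.sq_norm, Complex.normSq_apply]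
    norm_num [lowerDir, upperDir]

/-- With `w = X ± iY` and `e = (3 ∓ 4i)/5` the right-hand side is `Re (w e)`. The worst case is
`X = -n / exp 1`, where `Y ≥ 0.9295 n`. -/
theorem le_re_mul_dir {X Y n : ℝ} (hn : 0 < n) (hXY : X ^ 2 + Y ^ 2 = n ^ 2) (hY : 0 ≤ Y)
    (hX : -X * Real.exp 1 ≤ n) : 13 / 25 * n ≤ X * (3 / 5) + Y * (4 / 5) := by
  rcases le_total 0 X with h | h
  · have h1 : n ≤ X + Y := by
      refine (abs_le_of_sq_le_sq' ?_ (add_nonneg h hY)).2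
      nlinarith [mul_nonneg h hY]
    linarith
  · have h1 : -X ≤ 368 / 1000 * n := by
      have h2 := Real.exp_one_gt_d9
      nlinarith
    have h3 : 9295 / 10000 * n ≤ Y := by
      refine (abs_le_of_sq_le_sq' ?_ hY).2
      nlinarith
    linarith

/-! ### The asymptotic expansion of `u` -/

theorem log_modulus_ofLog (ζ : ℂ) :
    (Real.log (LogSurface.ofLog ζ).modulus : ℂ) + (LogSurface.ofLog ζ).arg * Complex.I = ζ := by
  simp [LogSurface.ofLog, Complex.re_add_im]

theorem divPos_mem_exterior_one {lam ρ : ℝ} (hlam : 0 < lam) (hρ : lam < ρ) {x : LogSurface}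
    (hx : x ∈ LogSurface.exterior ρ) : x.divPos lam hlam ∈ LogSurface.exterior 1 := by
  have hx' : ρ < x.modulus := hx
  change 1 < x.modulus / lam
  rw [one_lt_div hlam]
  exact hρ.trans hx'

/-- In the logarithmic chart `W e^W = z` reads `W + log W = log z`; it says that `log ω(x)` is the
saddle of the phase, at a distance `ω(x) / lam` from `log x`. -/
theorem log_omega {lam : ℝ} (hlam : 0 < lam) {x : LogSurface}
    (hx : x.divPos lam hlam ∈ LogSurface.exterior 1) :
    Complex.log (omega lam hlam x) =
      (Real.log x.modulus + x.arg * Complex.I) - lambertW (x.divPos lam hlam) := by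
  have h := lambertW_add_log hx
  have h1 : (Real.log (x.divPos lam hlam).modulus : ℂ) = Real.log x.modulus - Real.log lam := by
    rw [← Complex.ofReal_sub, ← Real.log_div x.modulus_pos.ne' hlam.ne']
    rfl
  have h2 : (x.divPos lam hlam).arg = x.arg := rfl
  rw [h1, h2] at h
  rw [omega, Complex.log_ofReal_mul hlam (lambertW_ne_zero hx)]
  linear_combination h

theorem theorem7p2 (lam : ℝ) (hlam : 0 < lam) :
    ∃ u : LogSurface → ℂ,
      LogSurface.IsAnalyticOn u Set.univ ∧
      (∀ L : ℝ → ℂ, IsHankelContour L → ∀ x : LogSurface, |x.arg| < Real.pi / 2 →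
        Integrable (hankelIntegrand lam x.toComplex L) ∧
        u x = ∫ s : ℝ, hankelIntegrand lam x.toComplex L s) ∧
      ∀ ρ : ℝ, lam < ρ → ∀ A : ℝ, 2 * Real.pi < A →
        ∃ C : ℝ, 0 < C ∧ ∃ r : ℕ → LogSurface → ℂ,
          ∀ N : ℕ, 1 ≤ N → ∀ x ∈ LogSurface.exterior ρ,
            u x = Complex.I *
                Complex.exp (1 / (2 * (lam : ℂ)) * omega lam hlam x ^ 2 +
                  (1 - 1 / (lam : ℂ)) * omega lam hlam x) *
                (2 * (Real.pi : ℂ) / omega lam hlam x) ^ (1 / 2 : ℂ) *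
                (partialU lam N (omega lam hlam x) + r N x) ∧
            ‖r N x‖ ≤ C * A ^ N * (N.factorial : ℝ) /
              (omega lam hlam x.absPoint).re ^ (N + 1) := by
  refine ⟨fun x => hankelValue lam (Real.log x.modulus + x.arg * Complex.I), ?_, ?_, ?_⟩
  · unfold LogSurface.IsAnalyticOn
    simp only [log_modulus_ofLog]
    exact (differentiable_hankelValue hlam.le).differentiableOn
  · intro L hL x hx
    exact hankelContour_integral hlam.le hL x hx
  intro ρ hρ A hA
  -- the rate `25/4` of the rotated contours is just below `2π`
  have hA' : 25 / 4 < A := by linarith [Real.pi_gt_d2]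
  obtain ⟨C₁, hC₁, hb₁⟩ := exists_watson_bound hlam (e := lowerDir) (by norm_num [lowerDir])
    norm_dir.1 (half_pos hlam)
  obtain ⟨C₂, hC₂, hb₂⟩ := exists_watson_bound hlam (e := upperDir) (by norm_num [upperDir])
    norm_dir.2 (half_pos hlam)
  obtain ⟨K, hK, hKb⟩ := exists_absorb hA'
  refine ⟨(C₁ + C₂) * K, by positivity, fun N x =>
    hankelValue lam (Real.log x.modulus + x.arg * Complex.I) / (Complex.I *
      Complex.exp (1 / (2 * (lam : ℂ)) * omega lam hlam x ^ 2 +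
        (1 - 1 / (lam : ℂ)) * omega lam hlam x) *
      (2 * (Real.pi : ℂ) / omega lam hlam x) ^ (1 / 2 : ℂ)) - partialU lam N (omega lam hlam x),
    fun N _ x hx => ?_⟩
  have hx1 := divPos_mem_exterior_one hlam hρ hx
  have hlog := log_omega hlam hx1
  set ζ : ℂ := Real.log x.modulus + x.arg * Complex.I with hζ
  set v := lambertW (x.divPos lam hlam) with hv
  set w := omega lam hlam x with hw
  have hwv : w = lam * v := rfl
  have hwn : ‖w‖ = lam * ‖v‖ := by
    rw [hwv, norm_mul, Complex.norm_real, Real.norm_of_nonneg hlam.le]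
  have hslit : w ∈ Complex.slitPlane := by
    rw [hwv]
    have h1 := Complex.mem_slitPlane_iff_arg.1 (lambertW_mem_slitPlane hx1)
    rw [Complex.mem_slitPlane_iff_arg, Complex.arg_real_mul _ hlam]
    exact ⟨h1.1, mul_ne_zero (by exact_mod_cast hlam.ne') h1.2⟩
  have hw0 : w ≠ 0 := Complex.slitPlane_ne_zero hslit
  have hwpos : 0 < ‖w‖ := norm_pos_iff.2 hw0
  have hwhalf : lam / 2 ≤ ‖w‖ := by
    rw [hwn]; nlinarith [half_lt_norm_lambertW hx1]
  have hpre : Complex.I * Complex.exp (1 / (2 * (lam : ℂ)) * w ^ 2 + (1 - 1 / (lam : ℂ)) * w) *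
      (2 * (Real.pi : ℂ) / w) ^ (1 / 2 : ℂ) ≠ 0 := by
    refine mul_ne_zero (mul_ne_zero Complex.I_ne_zero (Complex.exp_ne_zero _)) ?_
    rw [Ne, Complex.cpow_eq_zero_iff]
    exact fun h => div_ne_zero (mul_ne_zero two_ne_zero (by exact_mod_cast Real.pi_ne_zero)) hw0 h.1
  refine ⟨by rw [add_sub_cancel, mul_div_cancel₀ _ hpre], ?_⟩
  obtain ⟨ho0, ho1⟩ : 0 < (omega lam hlam x.absPoint).re ∧
      (omega lam hlam x.absPoint).re ≤ ‖w‖ := by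
    have h := re_lambertW_absPoint_le hx1
    have h1 : (omega lam hlam x.absPoint).re =
        lam * (lambertW (x.divPos lam hlam).absPoint).re := Complex.re_ofReal_mul _ _
    rw [h1, hwn]
    exact ⟨mul_pos hlam h.1, mul_le_mul_of_nonneg_left h.2 hlam.le⟩
  have key : ∀ e : ℂ, 0 < e.re → ‖e‖ = 1 → 0 < (w * e).re →
      hankelValue lam ζ / (Complex.I *
        Complex.exp (1 / (2 * (lam : ℂ)) * w ^ 2 + (1 - 1 / (lam : ℂ)) * w) *
        (2 * (Real.pi : ℂ) / w) ^ (1 / 2 : ℂ)) =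
      (∫ q in Set.Ioi (0 : ℝ), Complex.exp (-(w * e) * (q : ℂ) ^ 2) *
        (curveAmplitude lam e 1 q - curveAmplitude lam e (-1) q)) /
          (Complex.I * (2 * (Real.pi : ℂ) / w) ^ (1 / 2 : ℂ)) := by
    intro e he he1 hwe
    rw [hankelValue_eq_integral hlam hslit hwv hlog he he1 hwe,
      mul_comm Complex.I (Complex.exp _), mul_assoc (Complex.exp _) Complex.I,
      mul_div_mul_left _ _ (Complex.exp_ne_zero _)]
  have hX : -w.re * Real.exp 1 ≤ ‖w‖ := by
    have h := neg_re_lambertW_le hx1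
    have h1 : w.re = lam * v.re := Complex.re_ofReal_mul _ _
    rw [hwn, h1]
    nlinarith
  have hnorm : w.re ^ 2 + w.im ^ 2 = ‖w‖ ^ 2 := by
    rw [Complex.sq_norm, Complex.normSq_apply]; ring
  have hmain : ‖hankelValue lam ζ / (Complex.I *
        Complex.exp (1 / (2 * (lam : ℂ)) * w ^ 2 + (1 - 1 / (lam : ℂ)) * w) *
        (2 * (Real.pi : ℂ) / w) ^ (1 / 2 : ℂ)) - partialU lam N w‖ ≤
      (C₁ + C₂) * (N + 1) * (25 / 4) ^ (N + 1) * (N + 1).factorial / ‖w‖ ^ (N + 1) := by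
    rcases le_total 0 w.im with him | him
    · have hdir : 13 / 25 * ‖w‖ ≤ (w * lowerDir).re := by
        have h := le_re_mul_dir hwpos hnorm him hX
        simp only [Complex.mul_re, lowerDir]
        linarith
      rw [key lowerDir (by norm_num [lowerDir]) norm_dir.1 (lt_of_lt_of_le (by positivity) hdir)]
      refine (hb₁ N w hslit hwhalf hdir).trans ?_
      gcongr
      linarith
    · have hdir : 13 / 25 * ‖w‖ ≤ (w * upperDir).re := by
        have h := le_re_mul_dir (Y := -w.im) hwpos (by rw [neg_sq]; exact hnorm) (by linarith) hX
        simp only [Complex.mul_re, upperDir]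
        linarith
      rw [key upperDir (by norm_num [upperDir]) norm_dir.2 (lt_of_lt_of_le (by positivity) hdir)]
      refine (hb₂ N w hslit hwhalf hdir).trans ?_
      gcongr
      linarith
  refine hmain.trans ?_
  calc _ = (C₁ + C₂) * (((N : ℝ) + 1) * (25 / 4) ^ (N + 1) * (N + 1).factorial) /
        ‖w‖ ^ (N + 1) := by ring
    _ ≤ (C₁ + C₂) * (K * A ^ N * N.factorial) / (omega lam hlam x.absPoint).re ^ (N + 1) := by
        have := hKb N
        gcongr
    _ = _ := by ring
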